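/- **Theorem (correctness of the ladder algorithm).** *Setting.* Let $\mathbb F_q$ be a finite field of characteristic different from $2,3$, let $f(x)=x^3+Ax+B$ with $A,B\in\mathbb F_q$ and $4A^3+27B^2\neq 0$, and let $E: y^2=f(x)$. Let $\varphi(x,y)=(x^q,y^q)$ be the Frobenius endomorphism of $E(\mathbb F_{q^3})$ and let $T_3=\{P\in E(\mathbb F_{q^3}) : P+\varphi(P)+\varphi^2(P)=P_\infty\}$ be the trace zero subgroup. Assume that $T_3=\langle P\rangle$ is cyclic of prime order $p$, with $p>10800$, and let $s\in\mathbb Z/p\mathbb Z$ be the class with $\varphi(P)=sP$. For $Q\in T_3\setminus\{P_\infty\}$ let $h_Q=y-(\alpha_1x+\alpha_0)$, $\alpha_0,\alpha_1\in\mathbb F_q$, be the equation of the line through $Q,\varphi(Q),\varphi^2(Q)$. A line is given by its coefficients $(\alpha_1,\alpha_0)$, and $h_{-Q}$ is obtained from $h_Q$ by changing the sign of both. *Basic operations.* (i) Doubling $D(h_Q)=h_{2Q}$ and tripling $h_Q\mapsto h_{3Q}$, computed by explicit rational formulas in $A,B$ and the coefficients of $h_Q$. (ii) From $h_Q,h_R$,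 the function $S=S_1+yS_2$, $S_1=\sum_{i\le 4}a_ix^i$, $S_2=\sum_{i\le 3}b_ix^i$ in $\mathbb F_q[x]+y\,\mathbb F_q[x]$ with divisor $\sum_{0\le i,j\le 2}(\varphi^i(Q)+\varphi^j(R))-9P_\infty$, computed by explicit polynomial formulas in $A,B$ and the coefficients of $h_Q,h_R$, and scaled so that $b_3=1$ if $b_3\ne 0$. (iii) For $W=x^3+w_2x^2+w_1x+w_0$ and $S$ as in (ii), $L(W,S)$ is the linear system in $(\gamma_1,\gamma_0)$ $$\begin{aligned} w_0(w_2-b_2)\gamma_1+(b_0-w_0)\gamma_0&=w_0a_3-a_4w_2w_0-a_0,\\ w_0(w_1-b_1)\gamma_1+(b_0w_2-w_0b_2)\gamma_0&=w_0a_2-a_4w_1w_0-a_0w_2,\\ w_0(w_0-b_0)\gamma_1+(b_0w_1-b_1w_0)\gamma_0&=w_0a_1-a_4w_0^2-a_0w_1;\end{aligned}$$ solving it means finding its unique solution, recorded as the line $y-(\gamma_1x+\gamma_0)$; if there is no unique solution, nothing is returned. *Subalgorithm* $\mathrm{Subalg}(g_1,g_2,g_3,g_4)$, on four lines. For a line $g=y-(\alpha_1x+\alpha_0)$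 write $\bar g=y+(\alpha_1x+\alpha_0)$. 1. If $g_1=g_2$, return $\bar g_1$. If $g_3=g_4$, return $\bar g_3$. 2. Compute $S=S_1+yS_2$ from $g_1,g_2$ and $S'=S'_1+yS'_2$ from $g_3,g_4$. 3. If $g_1=\bar g_2$, solve $L(W,S')$ with $W$ the monic multiple of $S_1$, and return the solution. If $g_3=\bar g_4$, solve $L(W,S)$ with $W$ the monic multiple of $S'_1$, and return the solution. 4. Let $G=\gcd(fS_2^2-S_1^2,\ fS_2'^2-S_1'^2)$. For each monic irreducible factor $W$ of $G$ of degree $3$: if $W\neq S_2$, solve $L(W,S)$ and return the solution $y-(\gamma_1x+\gamma_0)$ if $W\mid(\gamma_1x+\gamma_0)S'_2+S'_1$, otherwise go to the next $W$; if $W=S_2$, solve $L(W,S')$ and return the solution. *Algorithm 1.* Input: $h_P$ and an integer $0<m<p$. Let $m=\sum_{i=0}^{\ell-1}m_i2^i$ with $m_i\in\{0,1\}$, $m_{\ell-1}=1$, and $k_i=\sum_{j=i}^{\ell-1}m_j2^{j-i}$. Let $$M=\left\{\frac{\pm3}{2s+1},\frac{s-4}{3s},\frac{4s-1}{2s+1},\frac{s+5}{3(s+1)},\frac{4s+5}{2s+1}\right\}\subset\mathbb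 Z/p\mathbb Z,$$ let $\mathcal M$ be the set of odd integers in $[0,p)$ whose class lies in $M$, and call $i\le\ell-2$ *special* if $k_i\in\mathcal M$ or $k_i+1\in\mathcal M$. Compute $h_{2P}=D(h_P)$, $h_{4P}=D^2(h_P)$, $h_{3P}$ by tripling, $h_{6P}=D(h_{3P})$, $h_{5P}=\mathrm{Subalg}(h_P,h_{4P},h_{2P},h_{3P})$ and $h_{7P}=\mathrm{Subalg}(h_P,h_{6P},h_{3P},h_{4P})$. Put $(u_{\ell-1},v_{\ell-1})=(h_P,h_{2P})$. If $\ell\ge 2$, put $(u_{\ell-2},v_{\ell-2})=(h_{2P},h_{3P})$ if $m_{\ell-2}=0$ and $(h_{3P},h_{4P})$ if $m_{\ell-2}=1$. For $i=\ell-3,\dots,0$ compute a line $w$ as follows. - If $i$ is not special (input of type (a)): $w=\mathrm{Subalg}(h_P,D(u_{i+1}),u_{i+1},v_{i+1})$. - If $i$ is special (input of type (b)): $w$ is - $\mathrm{Subalg}(h_{3P},D^2(u_{i+2}),h_{7P},D^3(u_{i+3}))$ if $m_{i+1}=m_{i+2}=1$, - $\mathrm{Subalg}(h_{3P},D^3(u_{i+3}),h_{-5P},D^3(v_{i+3}))$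 if $m_{i+1}=1$, $m_{i+2}=0$, - $\mathrm{Subalg}(h_{-3P},D^3(v_{i+3}),h_{5P},D^3(u_{i+3}))$ if $m_{i+1}=0$, $m_{i+2}=1$, - $\mathrm{Subalg}(h_{-3P},D^2(v_{i+2}),h_{-7P},D^3(v_{i+3}))$ if $m_{i+1}=m_{i+2}=0$. Then put $(u_i,v_i)=(D(u_{i+1}),w)$ if $m_i=0$ and $(u_i,v_i)=(w,D(v_{i+1}))$ if $m_i=1$. Only the last three pairs are stored, in a list. Output $u_0$. *Claim.* For every integer $m$ with $0<m<p$ the lines $h_P$ and $h_{mP}$ exist and are unique, and Algorithm 1 on input $h_P$ and $m$ returns $h_{mP}$. -/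

import Mathlib

open Polynomial

namespace TraceZero

/-! ## The curve, the Frobenius endomorphism and the trace zero subgroup -/

section Curve

variable {F : Type*} [Field F]

/-- The curve `y² = x³ + A x + B`. -/
def curve (A B : F) : WeierstrassCurve F := ⟨0, 0, 0, A, B⟩

variable (K : Type*) [Field K] [Algebra F K]

/-- The group `E(K)` of `K`-rational points of `E : y² = x³ + A x + B`. -/
abbrev Pts (A B : F) : Type _ := ((curve A B).baseChange K).toAffine.Point

variable [Fintype F] [DecidableEq K]

/-- The Frobenius endomorphism `(x, y) ↦ (x ^ q, y ^ q)` of `E(K)`, where `q = |F|`. -/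
noncomputable def frob (A B : F) : Pts K A B →+ Pts K A B :=
  WeierstrassCurve.Affine.Point.map (W' := (curve A B).toAffine) (FiniteField.frobeniusAlgHom F K)

/-- The trace zero subgroup `{P ∈ E(K) | P + φ(P) + φ²(P) = 0}` (used with `[K : F] = 3`). -/
noncomputable def traceZero (A B : F) : AddSubgroup (Pts K A B) :=
  (AddMonoidHom.id _ + frob K A B + (frob K A B).comp (frob K A B)).ker

end Curve

/-- The line `y = a1 * x + a0`, i.e. the polynomial `y - (a1 * x + a0)`. -/
@[ext]
structure Line (F : Type*) where
  a1 : F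
  a0 : F

section Lines

variable {F : Type*} [Field F]

/-- From the line `h(x, y) = y - (a1 x + a0)` to the line `-h(x, -y) = y + (a1 x + a0)`. -/
def Line.neg (h : Line F) : Line F := ⟨-h.a1, -h.a0⟩

variable {K : Type*} [Field K] [Algebra F K]

/-- The (affine) point `P` lies on the line `h`. -/
def Line.Contains {A B : F} (h : Line F) : Pts K A B → Prop
  | .zero => False
  | .some x y _ => y = algebraMap F K h.a1 * x + algebraMap F K h.a0

/-- `h` is the equation `h_P` of the line through `P`, `φ(P)` and `φ²(P)`. -/
def IsLineOf [Fintype F] [DecidableEq K] {A B : F} (h : Line F) (P : Pts K A B) : Prop :=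
  h.Contains P ∧ h.Contains (frob K A B P) ∧ h.Contains (frob K A B (frob K A B P))

end Lines

section Formulas

variable {F : Type*} [Field F]

/-! ## Explicit formulas

Coefficients of `S = (A4 x⁴ + A3 x³ + A2 x² + A1 x + A0) + y (B3 x³ + B2 x² + B1 x + B0)`, the
function with divisor `∑ (φⁱ(P) + φʲ(Q)) - 9 P∞`, in terms of `h = h_P` and `k = h_Q`. -/

def coefA4 (A B : F) (h k : Line F) : F :=
  -h.a1^3 * k.a1 * k.a0^2 - 3 * B * h.a1^3 * k.a1 + 2 * A * h.a1^3 * k.a0 + 2 * h.a1^2 * h.a0 *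
    k.a1^2 * k.a0 + A * h.a1^2 * h.a0 * k.a1 - 6 * B * h.a1^2 * k.a1^2 + 3 * A * h.a1^2 * k.a1 *
    k.a0 + A^2 * h.a1^2 - h.a1 * h.a0^2 * k.a1^3 + 6 * h.a1 * h.a0^2 * k.a0 + 3 * A * h.a1 *
    h.a0 * k.a1^2 + 3 * h.a1 * h.a0 * k.a0^2 + 9 * B * h.a1 * h.a0 - 3 * B * h.a1 * k.a1^3 + A *
    h.a1 * k.a1^2 * k.a0 + 2 * A^2 * h.a1 * k.a1 - 3 * h.a1 * k.a0^3 + 9 * B * h.a1 * k.a0 - 3 *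
    h.a0^3 * k.a1 + 3 * h.a0^2 * k.a1 * k.a0 - 3 * A * h.a0^2 + 2 * A * h.a0 * k.a1^3 + 6 * h.a0 *
    k.a1 * k.a0^2 + 9 * B * h.a0 * k.a1 - 6 * A * h.a0 * k.a0 + A^2 * k.a1^2 + 9 * B * k.a1 *
    k.a0 - 3 * A * k.a0^2

def coefA3 (A B : F) (h k : Line F) : F :=
  4 * B * h.a1^3 * k.a1^3 - 2 * A * h.a1^3 * k.a1^2 * k.a0 + A^2 * h.a1^3 * k.a1 - h.a1^3 *
    k.a0^3 + 9 * B * h.a1^3 * k.a0 - 2 * A * h.a1^2 * h.a0 * k.a1^3 - h.a1^2 * h.a0 * k.a1 *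
    k.a0^2 + 3 * B * h.a1^2 * h.a0 * k.a1 - 7 * A * h.a1^2 * h.a0 * k.a0 + A^2 * h.a1^2 * k.a1^2 -
    6 * B * h.a1^2 * k.a1 * k.a0 + 3 * A * h.a1^2 * k.a0^2 + 6 * A * B * h.a1^2 - h.a1 *
    h.a0^2 * k.a1^2 * k.a0 + A * h.a1 * h.a0^2 * k.a1 - 6 * B * h.a1 * h.a0 * k.a1^2 + 12 * A *
    h.a1 * h.a0 * k.a1 * k.a0 - 8 * A^2 * h.a1 * h.a0 + A^2 * h.a1 * k.a1^3 + 3 * B * h.a1 *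
    k.a1^2 * k.a0 + A * h.a1 * k.a1 * k.a0^2 - 6 * A * B * h.a1 * k.a1 + 4 * A^2 * h.a1 * k.a0 -
    h.a0^3 * k.a1^3 - 3 * h.a0^3 * k.a0 + 3 * A * h.a0^2 * k.a1^2 + 21 * h.a0^2 * k.a0^2 - 18 *
    B * h.a0^2 + 9 * B * h.a0 * k.a1^3 - 7 * A * h.a0 * k.a1^2 * k.a0 + 4 * A^2 * h.a0 * k.a1 -
    3 * h.a0 * k.a0^3 + 18 * B * h.a0 * k.a0 + 6 * A * B * k.a1^2 - 8 * A^2 * k.a1 * k.a0 - 18 *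
    B * k.a0^2 + 4 * A^3 + 27 * B^2

def coefA2 (A B : F) (h k : Line F) : F :=
  -A^2 * h.a1^3 * k.a1^3 - 2 * A * h.a1^3 * k.a1 * k.a0^2 - 6 * A * B * h.a1^3 * k.a1 + A^2 *
    h.a1^3 * k.a0 - 2 * A * h.a1^2 * h.a0 * k.a1^2 * k.a0 + 5 * A^2 * h.a1^2 * h.a0 * k.a1 - 3 *
    h.a1^2 * h.a0 * k.a0^3 - 9 * B * h.a1^2 * h.a0 * k.a0 + 6 * A * B * h.a1^2 * k.a1^2 + 9 * B *
    h.a1^2 * k.a0^2 + (2 * A^3 + 27 * B^2) * h.a1^2 - 2 * A * h.a1 * h.a0^2 * k.a1^3 - 3 *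
    h.a1 * h.a0^2 * k.a1 * k.a0^2 + 9 * B * h.a1 * h.a0^2 * k.a1 + 9 * A * h.a1 * h.a0^2 * k.a0 +
    36 * B * h.a1 * h.a0 * k.a1 * k.a0 - 12 * A * h.a1 * h.a0 * k.a0^2 - 18 * A * B * h.a1 *
    h.a0 - 6 * A * B * h.a1 * k.a1^3 + 5 * A^2 * h.a1 * k.a1^2 * k.a0 + 9 * B * h.a1 * k.a1 *
    k.a0^2 + (4 * A^3 - 27 * B^2) * h.a1 * k.a1 - 3 * A * h.a1 * k.a0^3 + 36 * A * B * h.a1 *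
    k.a0 - 3 * h.a0^3 * k.a1^2 * k.a0 - 3 * A * h.a0^3 * k.a1 + 9 * B * h.a0^2 * k.a1^2 - 12 * A *
    h.a0^2 * k.a1 * k.a0 + 6 * A^2 * h.a0^2 + A^2 * h.a0 * k.a1^3 - 9 * B * h.a0 * k.a1^2 *
    k.a0 + 9 * A * h.a0 * k.a1 * k.a0^2 + 36 * A * B * h.a0 * k.a1 - 24 * A^2 * h.a0 * k.a0 + (2 *
    A^3 + 27 * B^2) * k.a1^2 - 18 * A * B * k.a1 * k.a0 + 6 * A^2 * k.a0^2

def coefA1 (A B : F) (h k : Line F) : F :=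
  -A^2 * h.a1^3 * k.a1^2 * k.a0 - 4 * B * h.a1^3 * k.a1 * k.a0^2 + (A^3 - 12 * B^2) * h.a1^3 *
    k.a1 + 8 * A * B * h.a1^3 * k.a0 - A^2 * h.a1^2 * h.a0 * k.a1^3 - 4 * B * h.a1^2 * h.a0 *
    k.a1^2 * k.a0 + 16 * A * B * h.a1^2 * h.a0 * k.a1 - 3 * A^2 * h.a1^2 * h.a0 * k.a0 + (-3 *
    A^3 + 12 * B^2) * h.a1^2 * k.a1^2 - 24 * A * B * h.a1^2 * k.a1 * k.a0 + 3 * A^2 * h.a1^2 *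
    k.a0^2 - 2 * A^2 * B * h.a1^2 - 4 * B * h.a1 * h.a0^2 * k.a1^3 - 3 * A^2 * h.a1 * h.a0^2 *
    k.a1 - 3 * h.a1 * h.a0^2 * k.a0^3 + 15 * B * h.a1 * h.a0^2 * k.a0 - 24 * A * B * h.a1 * h.a0 *
    k.a1^2 + 12 * A^2 * h.a1 * h.a0 * k.a1 * k.a0 - 6 * B * h.a1 * h.a0 * k.a0^2 - 18 * B^2 *
    h.a1 * h.a0 + (A^3 - 12 * B^2) * h.a1 * k.a1^3 + 16 * A * B * h.a1 * k.a1^2 * k.a0 - 3 * A^2 *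
    h.a1 * k.a1 * k.a0^2 + 14 * A^2 * B * h.a1 * k.a1 - 3 * B * h.a1 * k.a0^3 + 63 * B^2 *
    h.a1 * k.a0 - 3 * h.a0^3 * k.a1 * k.a0^2 - 3 * B * h.a0^3 * k.a1 - 3 * A * h.a0^3 * k.a0 + 3 *
    A^2 * h.a0^2 * k.a1^2 - 6 * B * h.a0^2 * k.a1 * k.a0 + 9 * A * h.a0^2 * k.a0^2 + 6 * A * B *
    h.a0^2 + 8 * A * B * h.a0 * k.a1^3 - 3 * A^2 * h.a0 * k.a1^2 * k.a0 + 15 * B * h.a0 * k.a1 *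
    k.a0^2 + 63 * B^2 * h.a0 * k.a1 - 3 * A * h.a0 * k.a0^3 - 42 * A * B * h.a0 * k.a0 - 2 *
    A^2 * B * k.a1^2 - 18 * B^2 * k.a1 * k.a0 + 6 * A * B * k.a0^2 + 4 * A^4 + 27 * A * B^2

def coefA0 (A B : F) (h k : Line F) : F :=
  2 * A^2 * B * h.a1^3 * k.a1 - A^3 * h.a1^3 * k.a0 - A^2 * h.a1^2 * h.a0 * k.a1^2 * k.a0 - 4 *
    B * h.a1^2 * h.a0 * k.a1 * k.a0^2 + 12 * B^2 * h.a1^2 * h.a0 * k.a1 - 4 * A * B * h.a1^2 *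
    h.a0 * k.a0 - 5 * A^2 * B * h.a1^2 * k.a1^2 + (A^3 - 24 * B^2) * h.a1^2 * k.a1 * k.a0 + 6 *
    A * B * h.a1^2 * k.a0^2 + (A^4 + 6 * A * B^2) * h.a1^2 - 4 * B * h.a1 * h.a0^2 * k.a1^2 *
    k.a0 + 2 * A * h.a1 * h.a0^2 * k.a1 * k.a0^2 - 2 * A * B * h.a1 * h.a0^2 * k.a1 - A^2 * h.a1 *
    h.a0^2 * k.a0 + (A^3 - 24 * B^2) * h.a1 * h.a0 * k.a1^2 + 24 * A * B * h.a1 * h.a0 * k.a1 *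
    k.a0 - 3 * A^2 * h.a1 * h.a0 * k.a0^2 + A^2 * B * h.a1 * h.a0 + 2 * A^2 * B * h.a1 *
    k.a1^3 + 12 * B^2 * h.a1 * k.a1^2 * k.a0 - 2 * A * B * h.a1 * k.a1 * k.a0^2 + (-2 * A^4 - 6 *
    A * B^2) * h.a1 * k.a1 - 5 * A^2 * B * h.a1 * k.a0 - h.a0^3 * k.a0^3 - 3 * B * h.a0^3 *
    k.a0 + 6 * A * B * h.a0^2 * k.a1^2 - 3 * A^2 * h.a0^2 * k.a1 * k.a0 + 3 * B * h.a0^2 *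
    k.a0^2 + (A^3 + 9 * B^2) * h.a0^2 - A^3 * h.a0 * k.a1^3 - 4 * A * B * h.a0 * k.a1^2 * k.a0 -
    A^2 * h.a0 * k.a1 * k.a0^2 - 5 * A^2 * B * h.a0 * k.a1 - 3 * B * h.a0 * k.a0^3 + (2 * A^3 -
    9 * B^2) * h.a0 * k.a0 + (A^4 + 6 * A * B^2) * k.a1^2 + A^2 * B * k.a1 * k.a0 + (A^3 + 9 *
    B^2) * k.a0^2 + 4 * A^3 * B + 27 * B^3

def coefB3 (A B : F) (h k : Line F) : F :=
  h.a1^3 * k.a0^2 - B * h.a1^3 - 2 * h.a1^2 * h.a0 * k.a1 * k.a0 + A * h.a1^2 * h.a0 + h.a1^2 *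
    k.a1 * k.a0^2 - 3 * B * h.a1^2 * k.a1 + A * h.a1^2 * k.a0 + h.a1 * h.a0^2 * k.a1^2 - 2 *
    h.a1 * h.a0 * k.a1^2 * k.a0 + 2 * A * h.a1 * h.a0 * k.a1 - 3 * B * h.a1 * k.a1^2 + 2 * A *
    h.a1 * k.a1 * k.a0 + h.a0^3 + h.a0^2 * k.a1^3 + 3 * h.a0^2 * k.a0 + A * h.a0 * k.a1^2 + 3 *
    h.a0 * k.a0^2 - B * k.a1^3 + A * k.a1^2 * k.a0 + k.a0^3

def coefB2 (A B : F) (h k : Line F) : F :=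
  A^2 * h.a1^3 + 3 * h.a1^2 * h.a0 * k.a0^2 + 9 * B * h.a1^2 * h.a0 + 3 * A^2 * h.a1^2 * k.a1 +
    3 * h.a1^2 * k.a0^3 + 9 * B * h.a1^2 * k.a0 - 6 * h.a1 * h.a0^2 * k.a1 * k.a0 - 3 * A * h.a1 *
    h.a0^2 - 6 * h.a1 * h.a0 * k.a1 * k.a0^2 + 18 * B * h.a1 * h.a0 * k.a1 - 6 * A * h.a1 *
    h.a0 * k.a0 + 3 * A^2 * h.a1 * k.a1^2 + 18 * B * h.a1 * k.a1 * k.a0 - 3 * A * h.a1 * k.a0^2 +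
    3 * h.a0^3 * k.a1^2 + 3 * h.a0^2 * k.a1^2 * k.a0 - 3 * A * h.a0^2 * k.a1 + 9 * B * h.a0 *
    k.a1^2 - 6 * A * h.a0 * k.a1 * k.a0 + A^2 * k.a1^3 + 9 * B * k.a1^2 * k.a0 - 3 * A * k.a1 *
    k.a0^2

def coefB1 (A B : F) (h k : Line F) : F :=
  -A^2 * h.a1^3 * k.a1^2 - 2 * A * h.a1^3 * k.a0^2 + 2 * A * B * h.a1^3 - 12 * B * h.a1^2 * h.a0 *
    k.a1^2 + 4 * A * h.a1^2 * h.a0 * k.a1 * k.a0 - 3 * A^2 * h.a1^2 * h.a0 - A^2 * h.a1^2 *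
    k.a1^3 - 12 * B * h.a1^2 * k.a1^2 * k.a0 + 4 * A * h.a1^2 * k.a1 * k.a0^2 + A^2 * h.a1^2 *
    k.a0 + 4 * A * h.a1 * h.a0^2 * k.a1^2 - 3 * h.a1 * h.a0^2 * k.a0^2 - 9 * B * h.a1 * h.a0^2 +
    4 * A * h.a1 * h.a0 * k.a1^2 * k.a0 + 2 * A^2 * h.a1 * h.a0 * k.a1 + 6 * h.a1 * h.a0 *
    k.a0^3 + 18 * B * h.a1 * h.a0 * k.a0 + 2 * A^2 * h.a1 * k.a1 * k.a0 + 9 * B * h.a1 * k.a0^2 +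
    (4 * A^3 + 27 * B^2) * h.a1 + 6 * h.a0^3 * k.a1 * k.a0 + A * h.a0^3 - 2 * A * h.a0^2 *
    k.a1^3 - 3 * h.a0^2 * k.a1 * k.a0^2 + 9 * B * h.a0^2 * k.a1 - 9 * A * h.a0^2 * k.a0 + A^2 *
    h.a0 * k.a1^2 + 18 * B * h.a0 * k.a1 * k.a0 - 9 * A * h.a0 * k.a0^2 + 2 * A * B * k.a1^3 - 3 *
    A^2 * k.a1^2 * k.a0 - 9 * B * k.a1 * k.a0^2 + (4 * A^3 + 27 * B^2) * k.a1 + A * k.a0^3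

def coefB0 (A B : F) (h k : Line F) : F :=
  -2 * A^2 * h.a1^3 * k.a1 * k.a0 - 8 * B * h.a1^3 * k.a0^2 + (A^3 + 8 * B^2) * h.a1^3 + A^2 *
    h.a1^2 * h.a0 * k.a1^2 - 8 * B * h.a1^2 * h.a0 * k.a1 * k.a0 + 6 * A * h.a1^2 * h.a0 *
    k.a0^2 - 2 * A * B * h.a1^2 * h.a0 + A^2 * h.a1^2 * k.a1^2 * k.a0 + 4 * B * h.a1^2 * k.a1 *
    k.a0^2 + (-A^3 - 12 * B^2) * h.a1^2 * k.a1 + 4 * A * B * h.a1^2 * k.a0 + 4 * B * h.a1 *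
    h.a0^2 * k.a1^2 + A^2 * h.a1 * h.a0^2 - 2 * A^2 * h.a1 * h.a0 * k.a1^3 - 8 * B * h.a1 * h.a0 *
    k.a1^2 * k.a0 + 8 * A * B * h.a1 * h.a0 * k.a1 - 6 * A^2 * h.a1 * h.a0 * k.a0 + (-A^3 - 12 *
    B^2) * h.a1 * k.a1^2 + 8 * A * B * h.a1 * k.a1 * k.a0 - 3 * A^2 * h.a1 * k.a0^2 + 3 *
    h.a0^3 * k.a0^2 + B * h.a0^3 - 8 * B * h.a0^2 * k.a1^3 + 6 * A * h.a0^2 * k.a1^2 * k.a0 - 3 *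
    A^2 * h.a0^2 * k.a1 + 3 * h.a0^2 * k.a0^3 - 15 * B * h.a0^2 * k.a0 + 4 * A * B * h.a0 *
    k.a1^2 - 6 * A^2 * h.a0 * k.a1 * k.a0 - 15 * B * h.a0 * k.a0^2 + (4 * A^3 + 27 * B^2) * h.a0 +
    (A^3 + 8 * B^2) * k.a1^3 - 2 * A * B * k.a1^2 * k.a0 + A^2 * k.a1 * k.a0^2 + B * k.a0^3 +
    (4 * A^3 + 27 * B^2) * k.a0

/-! Doubling formulas `h_{2P} = dblC y - (dblU1 x + dblU0)` and tripling formulas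
`h_{3P} = triD y - (triV1 x + triV0)`, in terms of `h = h_P`. -/

def dblU1 (A B : F) (h : Line F) : F :=
  4 * B * h.a1^4 - 4 * A * h.a1^3 * h.a0 + 4 * A^2 * h.a1^2 - 4 * h.a1 * h.a0^3 + 36 * B * h.a1 *
    h.a0 - 12 * A * h.a0^2

def dblU0 (A B : F) (h : Line F) : F :=
  -A^2 * h.a1^4 - 8 * B * h.a1^3 * h.a0 + 2 * A * h.a1^2 * h.a0^2 + 6 * A * B * h.a1^2 - 8 * A^2 *
    h.a1 * h.a0 - h.a0^4 - 18 * B * h.a0^2 + 4 * A^3 + 27 * B^2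

def dblC (A B : F) (h : Line F) : F :=
  8 * B * h.a1^3 - 8 * A * h.a1^2 * h.a0 - 8 * h.a0^3

def triV1 (A B : F) (h : Line F) : F :=
  (1 / 3) * A^4 * h.a1^9 + 8 * A^2 * B * h.a1^8 * h.a0 + (-4 * A^3 + 48 * B^2) * h.a1^7 * h.a0^2 +
    (16 * A^3 * B + 144 * B^3) * h.a1^7 - 48 * A * B * h.a1^6 * h.a0^3 + (-16 * A^4 - 240 * A *
    B^2) * h.a1^6 * h.a0 + 10 * A^2 * h.a1^5 * h.a0^4 + 192 * A^2 * B * h.a1^5 * h.a0^2 + (8 *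
    A^5 + 54 * A^2 * B^2) * h.a1^5 - 24 * B * h.a1^4 * h.a0^5 + (-112 * A^3 + 144 * B^2) *
    h.a1^4 * h.a0^3 + (96 * A^3 * B + 648 * B^3) * h.a1^4 * h.a0 + 12 * A * h.a1^3 * h.a0^6 -
    240 * A * B * h.a1^3 * h.a0^4 + (-48 * A^4 - 324 * A * B^2) * h.a1^3 * h.a0^2 + (-32 * A^4 *
    B - 216 * A * B^3) * h.a1^3 - 48 * A^2 * h.a1^2 * h.a0^5 + (64 * A^5 + 432 * A^2 * B^2) *
    h.a1^2 * h.a0 + 3 * h.a1 * h.a0^8 - 288 * B * h.a1 * h.a0^6 + (-24 * A^3 - 162 * B^2) * h.a1 *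
    h.a0^4 + (288 * A^3 * B + 1944 * B^3) * h.a1 * h.a0^2 + (-16 * A^6 - 216 * A^3 * B^2 - 729 *
    B^4) * h.a1 + 48 * A * h.a0^7 + (-64 * A^4 - 432 * A * B^2) * h.a0^3

def triV0 (A B : F) (h : Line F) : F :=
  (-(8 / 3) * A^3 * B - (64 / 3) * B^3) * h.a1^9 + (3 * A^4 + 32 * A * B^2) * h.a1^8 * h.a0 - 16 *
    A^2 * B * h.a1^7 * h.a0^2 - 8 * A^2 * B^2 * h.a1^7 + (12 * A^3 + 16 * B^2) * h.a1^6 *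
    h.a0^3 + (8 * A^3 * B - 144 * B^3) * h.a1^6 * h.a0 + 8 * A * B * h.a1^5 * h.a0^4 + 288 * A *
    B^2 * h.a1^5 * h.a0^2 + (32 * A^4 * B + 216 * A * B^3) * h.a1^5 + 10 * A^2 * h.a1^4 * h.a0^5 -
    200 * A^2 * B * h.a1^4 * h.a0^3 + (-24 * A^5 - 162 * A^2 * B^2) * h.a1^4 * h.a0 + 32 * B *
    h.a1^3 * h.a0^6 + (64 * A^3 + 72 * B^2) * h.a1^3 * h.a0^4 + (192 * A^3 * B + 1296 * B^3) *
    h.a1^3 * h.a0^2 + (96 * A^3 * B^2 + 648 * B^4) * h.a1^3 - 4 * A * h.a1^2 * h.a0^7 - 72 * A *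
    B * h.a1^2 * h.a0^5 + (-176 * A^4 - 1188 * A * B^2) * h.a1^2 * h.a0^3 + (-192 * A^4 * B -
    1296 * A * B^3) * h.a1^2 * h.a0 + 64 * A^2 * h.a1 * h.a0^6 + (128 * A^5 + 864 * A^2 * B^2) *
    h.a1 * h.a0^2 + (1 / 3) * h.a0^9 + 72 * B * h.a0^7 + (-120 * A^3 - 810 * B^2) * h.a0^5 +
    (192 * A^3 * B + 1296 * B^3) * h.a0^3 + (-16 * A^6 - 216 * A^3 * B^2 - 729 * B^4) * h.a0

def triD (A B : F) (h : Line F) : F :=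
  A^4 * h.a1^8 + 24 * A^2 * B * h.a1^7 * h.a0 + (-12 * A^3 + 144 * B^2) * h.a1^6 * h.a0^2 + (-24 *
    A^3 * B - 144 * B^3) * h.a1^6 - 144 * A * B * h.a1^5 * h.a0^3 + (32 * A^4 + 144 * A * B^2) *
    h.a1^5 * h.a0 + 30 * A^2 * h.a1^4 * h.a0^4 + 120 * A^2 * B * h.a1^4 * h.a0^2 + (-8 * A^5 -
    54 * A^2 * B^2) * h.a1^4 - 72 * B * h.a1^3 * h.a0^5 + 720 * B^2 * h.a1^3 * h.a0^3 + (-96 *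
    A^3 * B - 648 * B^3) * h.a1^3 * h.a0 + 36 * A * h.a1^2 * h.a0^6 - 360 * A * B * h.a1^2 *
    h.a0^4 + (48 * A^4 + 324 * A * B^2) * h.a1^2 * h.a0^2 + 96 * A^2 * h.a1 * h.a0^5 + 9 *
    h.a0^8 + 72 * B * h.a0^6 + (24 * A^3 + 162 * B^2) * h.a0^4 - (16 / 3) * A^6 - 72 * A^3 * B^2 -
    243 * B^4

open Classical in
/-- `D(h_P) = h_{2P}`; undefined when the coefficient of `y` vanishes. -/
noncomputable def double (A B : F) (h : Line F) : Option (Line F) :=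
  if dblC A B h = 0 then none else some ⟨dblU1 A B h / dblC A B h, dblU0 A B h / dblC A B h⟩

open Classical in
/-- The tripling map `h_P ↦ h_{3P}`. -/
noncomputable def triple (A B : F) (h : Line F) : Option (Line F) :=
  if triD A B h = 0 then none else some ⟨triV1 A B h / triD A B h, triV0 A B h / triD A B h⟩

/-! ## The subalgorithm -/

/-- A function `fst + y * snd` on the curve, with `fst`, `snd` polynomials in `x`. -/
structure SPoly (F : Type*) [Field F] where
  fst : F[X]
  snd : F[X]

open Classical in
/-- The function `S_{P,Q}` computed from `h_P` and `h_Q`. It is defined up to a nonzero constant;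
it is normalised by `b₃ = 1` if `b₃ ≠ 0`. -/
noncomputable def sPoly (A B : F) (h k : Line F) : SPoly F :=
  let c : F := if coefB3 A B h k = 0 then 1 else (coefB3 A B h k)⁻¹
  { fst := C c * (C (coefA4 A B h k) * X ^ 4 + C (coefA3 A B h k) * X ^ 3
      + C (coefA2 A B h k) * X ^ 2 + C (coefA1 A B h k) * X + C (coefA0 A B h k))
    snd := C c * (C (coefB3 A B h k) * X ^ 3 + C (coefB2 A B h k) * X ^ 2
      + C (coefB1 A B h k) * X + C (coefB0 A B h k)) }

/-- `f * snd² - fst²`, where `f = x³ + A x + B`. -/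
noncomputable def sigma (A B : F) (S : SPoly F) : F[X] :=
  (X ^ 3 + C A * X + C B) * S.snd ^ 2 - S.fst ^ 2

/-- `g = y - (γ₁ x + γ₀)` solves the linear system with augmented matrix `L(W, S)`, where
`W = x³ + w₂ x² + w₁ x + w₀`. -/
def IsSolution (W : F[X]) (S : SPoly F) (g : Line F) : Prop :=
  let w := W.coeff
  let a := S.fst.coeff
  let b := S.snd.coeff
  w 0 * (w 2 - b 2) * g.a1 + (b 0 - w 0) * g.a0 = w 0 * a 3 - a 4 * w 2 * w 0 - a 0 ∧
  w 0 * (w 1 - b 1) * g.a1 + (b 0 * w 2 - w 0 * b 2) * g.a0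
    = w 0 * a 2 - a 4 * w 1 * w 0 - a 0 * w 2 ∧
  w 0 * (w 0 - b 0) * g.a1 + (b 0 * w 1 - b 1 * w 0) * g.a0
    = w 0 * a 1 - a 4 * w 0 ^ 2 - a 0 * w 1

open Classical in
/-- The unique solution of the linear system `L(W, S)`; undefined if there is none or several. -/
noncomputable def solve (W : F[X]) (S : SPoly F) : Option (Line F) :=
  if h : ∃! g : Line F, IsSolution W S g then some h.choose else none

/-- The monic multiple of a polynomial. -/
noncomputable def toMonic (G : F[X]) : F[X] := C G.leadingCoeff⁻¹ * G

open Classical in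
/-- The distinct monic irreducible factors of degree `3` of `G`. -/
noncomputable def cubicFactors (G : F[X]) : List F[X] :=
  ((UniqueFactorizationMonoid.normalizedFactors G).toFinset.filter
    (fun W => W.natDegree = 3)).toList

open Classical in
/-- The loop over the factors `W₁, …, W_s` in the subalgorithm. -/
noncomputable def factorLoop (S₁ S₂ : SPoly F) : List F[X] → Option (Line F)
  | [] => none
  | W :: Ws =>
    if W ≠ S₁.snd then
      (solve W S₁).bind fun g =>
        if W ∣ (C g.a1 * X + C g.a0) * S₂.snd + S₂.fst then some g else factorLoop S₁ S₂ Ws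
    else solve W S₂

open Classical in
/-- The subalgorithm, on the input lines `hm₁ = h_{m₁P}`, `hm₂ = h_{m₂P}`, `hn₁ = h_{n₁P}`,
`hn₂ = h_{n₂P}`. -/
noncomputable def subalg (A B : F) (hm₁ hm₂ hn₁ hn₂ : Line F) : Option (Line F) :=
  if hm₁ = hm₂ then some hm₁.neg
  else if hn₁ = hn₂ then some hn₁.neg
  else
    let S₁ := sPoly A B hm₁ hm₂
    let S₂ := sPoly A B hn₁ hn₂
    if hm₁ = hm₂.neg then solve (toMonic S₁.fst) S₂
    else if hn₁ = hn₂.neg then solve (toMonic S₂.fst) S₁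
    else factorLoop S₁ S₂ (cubicFactors (EuclideanDomain.gcd (sigma A B S₁) (sigma A B S₂)))

/-! The operations above, on lines that may be undefined. -/

/-- `Dⁿ`. -/
noncomputable def dbl (A B : F) (n : ℕ) (h : Option (Line F)) : Option (Line F) :=
  (fun x => x.bind (double A B))^[n] h

/-- The subalgorithm on four lines; undefined if one of them is. -/
noncomputable def subalgO (A B : F) (h₁ h₂ h₃ h₄ : Option (Line F)) : Option (Line F) :=
  h₁.bind fun x₁ => h₂.bind fun x₂ => h₃.bind fun x₃ => h₄.bind fun x₄ => subalg A B x₁ x₂ x₃ x₄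

end Formulas

/-! ## The ladder -/

/-- The set `M` of residue classes modulo `p`. -/
def setM {p : ℕ} [Fact p.Prime] (s : ZMod p) : Set (ZMod p) :=
  {3 / (2 * s + 1), -3 / (2 * s + 1), (s - 4) / (3 * s), (4 * s - 1) / (2 * s + 1),
    (s + 5) / (3 * (s + 1)), (4 * s + 5) / (2 * s + 1)}

/-- The odd integers in `M`, residue classes being represented by integers in `[0, p)`. -/
def setMOdd {p : ℕ} [Fact p.Prime] (s : ZMod p) : Set ℕ :=
  {k | k < p ∧ Odd k ∧ (k : ZMod p) ∈ setM s}

/-- The number of binary digits of `m`. -/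
def len (m : ℕ) : ℕ := Nat.size m

/-- The `i`-th binary digit `m_i` of `m`. -/
def bit (m i : ℕ) : ℕ := (m.testBit i).toNat

/-- `k_i = ∑_{j = i}^{ℓ - 1} m_j 2^{j - i}`. -/
def prefixVal (m i : ℕ) : ℕ := ∑ j ∈ Finset.Ico i (len m), bit m j * 2 ^ (j - i)

/-- The set `S` of special steps. -/
def specialSteps {p : ℕ} [Fact p.Prime] (s : ZMod p) (m : ℕ) : Set ℕ :=
  {i | i + 2 ≤ len m ∧ (prefixVal m i ∈ setMOdd s ∨ prefixVal m i + 1 ∈ setMOdd s)}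

section Ladder

variable {F : Type*} [Field F]

/-- `L[j][1]`, where `L` is indexed from `1`. -/
def uAt (L : List (Option (Line F) × Option (Line F))) (j : ℕ) : Option (Line F) :=
  L[j - 1]?.bind Prod.fst

/-- `L[j][2]`, where `L` is indexed from `1`. -/
def vAt (L : List (Option (Line F) × Option (Line F))) (j : ℕ) : Option (Line F) :=
  L[j - 1]?.bind Prod.snd

/-- The line `h_{3P}`. -/
noncomputable def h3 (A B : F) (h : Line F) : Option (Line F) := triple A B h

/-- The line `h_{5P}`, computed from `h_P`, `h_{4P}`, `h_{2P}`, `h_{3P}`. -/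
noncomputable def h5 (A B : F) (h : Line F) : Option (Line F) :=
  subalgO A B (some h) (dbl A B 2 (some h)) (dbl A B 1 (some h)) (h3 A B h)

/-- The line `h_{7P}`, computed from `h_P`, `h_{6P}`, `h_{3P}`, `h_{4P}`. -/
noncomputable def h7 (A B : F) (h : Line F) : Option (Line F) :=
  subalgO A B (some h) (dbl A B 1 (h3 A B h)) (h3 A B h) (dbl A B 2 (some h))

/-- The line `h_exc` of a special step, with input of type (b). -/
noncomputable def hExc (A B : F) (h : Line F) (m i : ℕ)
    (L : List (Option (Line F) × Option (Line F))) : Option (Line F) :=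
  if bit m (i + 1) = 1 then
    if bit m (i + 2) = 1 then
      subalgO A B (h3 A B h) (dbl A B 2 (uAt L 2)) (h7 A B h) (dbl A B 3 (uAt L 1))
    else
      subalgO A B (h3 A B h) (dbl A B 3 (uAt L 1)) ((h5 A B h).map Line.neg)
        (dbl A B 3 (vAt L 1))
  else
    if bit m (i + 2) = 1 then
      subalgO A B ((h3 A B h).map Line.neg) (dbl A B 3 (vAt L 1)) (h5 A B h)
        (dbl A B 3 (uAt L 1))
    else
      subalgO A B ((h3 A B h).map Line.neg) (dbl A B 2 (vAt L 2)) ((h7 A B h).map Line.neg)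
        (dbl A B 3 (vAt L 1))

open Classical in
/-- One step of the cycle: from the list `L` at the beginning of step `i` to the list at its
end. -/
noncomputable def step (A B : F) {p : ℕ} [Fact p.Prime] (s : ZMod p) (h : Line F) (m i : ℕ)
    (L : List (Option (Line F) × Option (Line F))) : List (Option (Line F) × Option (Line F)) :=
  let exc := hExc A B h m i L
  let L' := if L.length = 3 then L.tail else L
  let new :=
    if i ∈ specialSteps s m then exc
    else subalgO A B (some h) (dbl A B 1 (uAt L' 2)) (uAt L' 2) (vAt L' 2)
  if bit m i = 0 then L' ++ [(dbl A B 1 (uAt L' 2), new)]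
  else L' ++ [(new, dbl A B 1 (vAt L' 2))]

/-- The cycle: the steps `n - 1, n - 2, …, 0`. -/
noncomputable def cycle (A B : F) {p : ℕ} [Fact p.Prime] (s : ZMod p) (h : Line F) (m : ℕ) :
    ℕ → List (Option (Line F) × Option (Line F)) → List (Option (Line F) × Option (Line F))
  | 0, L => L
  | i + 1, L => cycle A B s h m i (step A B s h m i L)

/-- The Montgomery-ladder-style algorithm on input `h = h_P` and `m`. The value `none` means that
no line is returned. -/
noncomputable def montgomeryLadder (A B : F) {p : ℕ} [Fact p.Prime] (s : ZMod p) (h : Line F) (m : ℕ) :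
    Option (Line F) :=
  let first := (some h, dbl A B 1 (some h))
  if len m = 1 then first.1
  else
    let second :=
      if bit m (len m - 2) = 0 then (dbl A B 1 (some h), h3 A B h)
      else (h3 A B h, dbl A B 2 (some h))
    if len m = 2 then second.1
    else uAt (cycle A B s h m (len m - 2) [first, second]) 3

end Ladder

end TraceZero

namespace TraceZero

/-! ### Polynomial identities behind the explicit formulas. -/

section Identities

set_option maxHeartbeats 1000000

/-! Write the points of the cyclic group as multiples `c` in `ZMod p`. Frobenius becomes
multiplication by `s`, and the trace zero condition gives `s² + s + 1 = 0`. The three points on one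
line are then `c, sc, s²c`, so a line determines `c` exactly up to powers of `s`. Their
`x`-coordinates are the roots of the irreducible cubic `f - h²`; this irreducibility makes the
denominators in the formulas nonzero (`dblC_ne_zero`, `coefB3_ne_zero`). The denominator for
tripling is instead a norm of the 3-division polynomial (`triD_ne_zero`).

For two lines that are neither equal nor opposite, the function `S` vanishes at the nine distinct
points `sⁱc + sʲd`, and its norm `f S₂² - S₁²` has degree nine. Hence there are no further affine
zeros in the group, and every irreducible cubic factor of the norm is the minimal polynomial of the
`x`-coordinate of one of the nine (`Generic.roots_eq`, `Generic.exists_eq_minpoly`). The system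
`L(W, S)` says that `W` divides `γ S₂ + S₁` (`isSolution_iff`); at a zero of `S` this forces `γ(x) =
y`, so its solution is the line sought, unless `W = S₂`.

The subalgorithm therefore returns the line of `t = c₁ + d₁ = c₂ + d₂` as soon as the two families
of nine points meet only in the orbit of `t` (`OnlyCommon`, `subalg_eq`). For inputs of type (a),
with `N = 2k + 1`, any other coincidence is a linear equation over `ℤ[s]` whose solutions are `N =
1`, `N = 3` and the six classes of `M` (`onlyCommon_of_notMem`). For `N` in `M`, where type (b) is
used, a bad coincidence would make a nonzero Eisenstein integer of norm at most 10800 vanish modulo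
`p`, which the size of `p` forbids (`onlyCommon_of_mem`).

The ladder then follows by induction on the steps, the invariant being that the stored pairs are the
lines of `kᵢ` and `kᵢ + 1` (`exists_step`, `isLineAt_cycle`). -/

def sShift {R : Type*} [CommRing R] (a b y d u e w : R) : R :=
  let y0 : R := 2 * a * b * u ^ 2 * w ^ 2 + a * b ^ 2 * d ^ 2 * u * w + a * b ^ 2 * e ^ 2 * u * w
    - a * b ^ 3 * d * u + a * b ^ 3 * d * w + a * b ^ 3 * e * u - a * b ^ 3 * e * w - a ^ 2 * b ^
    2 * u * w + 2 * b * d * e * u ^ 2 * w ^ 2 - 3 * b ^ 2 * d * u * w ^ 2 - b ^ 2 * d * u ^ 2 * w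
    - b ^ 2 * d ^ 2 * e ^ 2 * u * w - b ^ 2 * e * u * w ^ 2 - 3 * b ^ 2 * e * u ^ 2 * w + b ^ 3 *
    d * e ^ 2 * u + b ^ 3 * d ^ 2 * e * w - b ^ 3 * d ^ 3 * w - b ^ 3 * e ^ 3 * u + 2 * b ^ 3 * u
    * w + b ^ 3 * u ^ 2 + b ^ 3 * w ^ 2 - 2 * b ^ 4 * d * e + b ^ 4 * d ^ 2 + b ^ 4 * e ^ 2 - u ^
    3 * w ^ 3
  let y1 : R := -2 * a * b * u * w ^ 2 - 2 * a * b * u ^ 2 * w + 2 * a * b ^ 2 * d * e * u + 2 * a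
    * b ^ 2 * d * e * w - 2 * a * b ^ 2 * d ^ 2 * u - 2 * a * b ^ 2 * e ^ 2 * w - 4 * a * d * u ^
    2 * w ^ 2 - 4 * a * e * u ^ 2 * w ^ 2 - 4 * b * d * e * u * w ^ 2 - 4 * b * d * e * u ^ 2 * w
    + 6 * b * d ^ 2 * u * w ^ 2 + 6 * b * e ^ 2 * u ^ 2 * w - 2 * b ^ 2 * d * e ^ 3 * u + 2 * b ^
    2 * d * u * w + 2 * b ^ 2 * d * u ^ 2 + 2 * b ^ 2 * d ^ 2 * e ^ 2 * u + 2 * b ^ 2 * d ^ 2 * e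
    ^ 2 * w - 2 * b ^ 2 * d ^ 3 * e * w + 2 * b ^ 2 * e * u * w + 2 * b ^ 2 * e * w ^ 2 - 2 * b ^
    3 * d * e ^ 2 - 2 * b ^ 3 * d ^ 2 * e + 2 * b ^ 3 * d ^ 3 + 2 * b ^ 3 * e ^ 3 + 6 * u ^ 2 * w
    ^ 3 + 6 * u ^ 3 * w ^ 2
  let y2 : R := -4 * a * b * d * e ^ 2 * u - 4 * a * b * d ^ 2 * e * w + 4 * a * b * d ^ 3 * w + 4
    * a * b * e ^ 3 * u - 8 * a * b * u * w - 4 * a * b * u ^ 2 - 4 * a * b * w ^ 2 + 8 * a * b ^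
    2 * d * e - 4 * a * b ^ 2 * d ^ 2 - 4 * a * b ^ 2 * e ^ 2 + 4 * a * d * u * w ^ 2 + 16 * a * d
    * u ^ 2 * w + 4 * a * d ^ 2 * e ^ 2 * u * w + 16 * a * e * u * w ^ 2 + 4 * a * e * u ^ 2 * w +
    4 * a ^ 2 * b * d * u - 4 * a ^ 2 * b * d * w - 4 * a ^ 2 * b * e * u + 4 * a ^ 2 * b * e * w
    - 4 * a ^ 2 * d ^ 2 * u * w - 4 * a ^ 2 * e ^ 2 * u * w + 4 * a ^ 3 * u * w + 32 * b * d * e *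
    u * w - 16 * b * d ^ 2 * u * w - 16 * b * e ^ 2 * u * w + 4 * b ^ 2 * d * e ^ 3 - 8 * b ^ 2 *
    d ^ 2 * e ^ 2 + 4 * b ^ 2 * d ^ 3 * e - 4 * d * e ^ 2 * u ^ 2 * w - 4 * d ^ 2 * e * u * w ^ 2
    - 12 * u * w ^ 3 - 24 * u ^ 2 * w ^ 2 - 12 * u ^ 3 * w
  let y3 : R := 8 * a * b * d * e ^ 2 + 8 * a * b * d ^ 2 * e - 8 * a * b * d ^ 3 - 8 * a * b * e
    ^ 3 + 8 * a * d * e ^ 3 * u - 8 * a * d * u * w - 16 * a * d * u ^ 2 + 8 * a * d * w ^ 2 - 8 *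
    a * d ^ 2 * e ^ 2 * u - 8 * a * d ^ 2 * e ^ 2 * w + 8 * a * d ^ 3 * e * w - 8 * a * e * u * w
    + 8 * a * e * u ^ 2 - 16 * a * e * w ^ 2 - 8 * a ^ 2 * d * e * u - 8 * a ^ 2 * d * e * w + 8 *
    a ^ 2 * d ^ 2 * u + 8 * a ^ 2 * e ^ 2 * w - 16 * b * d * e * u - 16 * b * d * e * w + 8 * b *
    d ^ 2 * u + 8 * b * d ^ 2 * w + 8 * b * e ^ 2 * u + 8 * b * e ^ 2 * w + 8 * d * e ^ 2 * u ^ 2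
    + 8 * d ^ 2 * e * w ^ 2 - 8 * d ^ 3 * w ^ 2 - 8 * e ^ 3 * u ^ 2 + 24 * u * w ^ 2 + 24 * u ^ 2
    * w + 8 * u ^ 3 + 8 * w ^ 3
  let y4 : R := -16 * a * d * e ^ 3 + 32 * a * d ^ 2 * e ^ 2 - 16 * a * d ^ 3 * e - 32 * d * e ^ 2
    * u + 16 * d * e ^ 2 * w + 16 * d ^ 2 * e * u - 32 * d ^ 2 * e * w + 16 * d ^ 3 * w + 16 * e ^
    3 * u
  y0 + y1 * y + y2 * y ^ 2 + y3 * y ^ 3 + y4 * y ^ 4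
-- Three times the tripling denominator with the origin of the `x`-axis moved to the point: the
-- curve is `Y² = t³ + a t² + b t + y²` and the line is `Y = y + d t`. The factor 3 clears the
-- fractions in the formulas; the next two definitions are the numerators in the same coordinates.
def triDShift {R : Type*} [CommRing R] (a b y d : R) : R :=
  let d0 : R := 576 * a * b * y ^ 6 + 144 * a * b ^ 4 * y ^ 2 - 288 * a ^ 2 * b ^ 2 * y ^ 4 + 8 *
    a ^ 2 * b ^ 5 - 68 * a ^ 3 * b ^ 3 * y ^ 2 - 128 * a ^ 3 * y ^ 6 + 144 * a ^ 4 * b * y ^ 4 - a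
    ^ 4 * b ^ 4 + 8 * a ^ 5 * b ^ 2 * y ^ 2 - 16 * a ^ 6 * y ^ 4 - 144 * b ^ 3 * y ^ 4 - 16 * b ^
    6
  let d1 : R := -96 * a * b ^ 3 * y ^ 3 - 1152 * a * y ^ 7 + 384 * a ^ 2 * b * y ^ 5 + 24 * a ^ 3
    * b ^ 2 * y ^ 3 - 96 * a ^ 4 * y ^ 5 + 288 * b ^ 2 * y ^ 5
  let d2 : R := -768 * a * b ^ 2 * y ^ 4 - 36 * a ^ 2 * b ^ 3 * y ^ 2 + 768 * a ^ 2 * y ^ 6 + 144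
    * a ^ 3 * b * y ^ 4 + 144 * b ^ 4 * y ^ 2
  let d3 : R := 1152 * a * b * y ^ 5 + 152 * a ^ 2 * b ^ 2 * y ^ 3 - 608 * a ^ 3 * y ^ 5 - 288 * b
    ^ 3 * y ^ 3
  let d4 : R := 84 * a * b ^ 3 * y ^ 2 - 1152 * a * y ^ 6 + 48 * a ^ 2 * b * y ^ 4 + 6 * a ^ 2 * b
    ^ 4 - 48 * a ^ 3 * b ^ 2 * y ^ 2 + 96 * a ^ 4 * y ^ 4 + 288 * b ^ 2 * y ^ 4 - 24 * b ^ 5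
  let d5 : R := -504 * a * b ^ 2 * y ^ 3 + 480 * a ^ 2 * y ^ 5 + 96 * b ^ 4 * y
  let d6 : R := 432 * a * b * y ^ 4 - 8 * a * b ^ 4 + 64 * a ^ 2 * b ^ 2 * y ^ 2 - 128 * a ^ 3 * y
    ^ 4 - 108 * b ^ 3 * y ^ 2
  let d7 : R := -288 * a * y ^ 5 + 72 * b ^ 2 * y ^ 3
  let d8 : R := -24 * a * b ^ 2 * y ^ 2 + 48 * a ^ 2 * y ^ 4 + 3 * b ^ 4
  d0 + d1 * d + d2 * d ^ 2 + d3 * d ^ 3 + d4 * d ^ 4 + d5 * d ^ 5 + d6 * d ^ 6 + d7 * d ^ 7 + d8 * d ^ 8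

def triV1Shift {R : Type*} [CommRing R] (a b y d : R) : R :=
  let d0 : R := 864 * a * b ^ 2 * y ^ 5 + 112 * a ^ 2 * b ^ 3 * y ^ 3 + 384 * a ^ 2 * y ^ 7 - 480
    * a ^ 3 * b * y ^ 5 - 16 * a ^ 4 * b ^ 2 * y ^ 3 + 64 * a ^ 5 * y ^ 5 - 1152 * b * y ^ 7 - 192
    * b ^ 4 * y ^ 3
  let d1 : R := -1344 * a * b * y ^ 6 + 336 * a * b ^ 4 * y ^ 2 - 576 * a ^ 2 * b ^ 2 * y ^ 4 + 24
    * a ^ 2 * b ^ 5 - 180 * a ^ 3 * b ^ 3 * y ^ 2 + 192 * a ^ 3 * y ^ 6 + 336 * a ^ 4 * b * y ^ 4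
    - 3 * a ^ 4 * b ^ 4 + 24 * a ^ 5 * b ^ 2 * y ^ 2 - 48 * a ^ 6 * y ^ 4 + 144 * b ^ 3 * y ^ 4 -
    48 * b ^ 6 + 2304 * y ^ 8
  let d2 : R := -1344 * a * b ^ 3 * y ^ 3 - 1536 * a * y ^ 7 + 2016 * a ^ 2 * b * y ^ 5 - 48 * a ^
    2 * b ^ 4 * y + 312 * a ^ 3 * b ^ 2 * y ^ 3 - 480 * a ^ 4 * y ^ 5 + 1152 * b ^ 2 * y ^ 5 + 192
    * b ^ 5 * y
  let d3 : R := 1344 * a * b ^ 2 * y ^ 4 - 32 * a * b ^ 5 + 332 * a ^ 2 * b ^ 3 * y ^ 2 - 320 * a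
    ^ 2 * y ^ 6 - 816 * a ^ 3 * b * y ^ 4 + 8 * a ^ 3 * b ^ 4 - 64 * a ^ 4 * b ^ 2 * y ^ 2 + 128 *
    a ^ 5 * y ^ 4 - 2304 * b * y ^ 6 - 240 * b ^ 4 * y ^ 2
  let d4 : R := -672 * a * b * y ^ 5 - 168 * a ^ 2 * b ^ 2 * y ^ 3 + 672 * a ^ 3 * y ^ 5 - 48 * b
    ^ 3 * y ^ 3 + 2304 * y ^ 7
  let d5 : R := -60 * a * b ^ 3 * y ^ 2 - 960 * a * y ^ 6 - 144 * a ^ 2 * b * y ^ 4 - 6 * a ^ 2 *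
    b ^ 4 + 48 * a ^ 3 * b ^ 2 * y ^ 2 - 96 * a ^ 4 * y ^ 4 + 768 * b ^ 2 * y ^ 4 + 24 * b ^ 5
  let d6 : R := 104 * a * b ^ 2 * y ^ 3 + 352 * a ^ 2 * y ^ 5 - 864 * b * y ^ 5 - 48 * b ^ 4 * y
  let d7 : R := -144 * a * b * y ^ 4 + 36 * b ^ 3 * y ^ 2 + 576 * y ^ 6
  let d8 : R := -96 * a * y ^ 5 + 24 * b ^ 2 * y ^ 3
  let d9 : R := -8 * a * b ^ 2 * y ^ 2 + 16 * a ^ 2 * y ^ 4 + b ^ 4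
  d0 + d1 * d + d2 * d ^ 2 + d3 * d ^ 3 + d4 * d ^ 4 + d5 * d ^ 5 + d6 * d ^ 6 + d7 * d ^ 7 + d8 * d ^ 8 + d9 * d ^ 9

def triV0Shift {R : Type*} [CommRing R] (a b y d : R) : R :=
  let d0 : R := 192 * a * b * y ^ 7 + 176 * a * b ^ 4 * y ^ 3 + 288 * a ^ 2 * b ^ 2 * y ^ 5 + 24 *
    a ^ 2 * b ^ 5 * y - 76 * a ^ 3 * b ^ 3 * y ^ 3 - 112 * a ^ 4 * b * y ^ 5 - 3 * a ^ 4 * b ^ 4 *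
    y + 8 * a ^ 5 * b ^ 2 * y ^ 3 + 16 * a ^ 6 * y ^ 5 - 432 * b ^ 3 * y ^ 5 - 48 * b ^ 6 * y -
    512 * y ^ 9
  let d1 : R := -1440 * a * b ^ 3 * y ^ 4 + 1152 * a * y ^ 8 - 1920 * a ^ 2 * b * y ^ 6 - 192 * a
    ^ 2 * b ^ 4 * y ^ 2 + 744 * a ^ 3 * b ^ 2 * y ^ 4 + 24 * a ^ 4 * b ^ 3 * y ^ 2 + 288 * a ^ 4 *
    y ^ 6 - 96 * a ^ 5 * b * y ^ 4 + 2784 * b ^ 2 * y ^ 6 + 384 * b ^ 5 * y ^ 2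
  let d2 : R := 4608 * a * b ^ 2 * y ^ 5 + 276 * a ^ 2 * b ^ 3 * y ^ 3 + 1152 * a ^ 2 * y ^ 7 -
    1104 * a ^ 3 * b * y ^ 5 - 7680 * b * y ^ 7 - 1104 * b ^ 4 * y ^ 3
  let d3 : R := -2176 * a * b * y ^ 6 + 256 * a * b ^ 4 * y ^ 2 - 1176 * a ^ 2 * b ^ 2 * y ^ 4 -
    64 * a ^ 3 * b ^ 3 * y ^ 2 + 96 * a ^ 3 * y ^ 6 + 256 * a ^ 4 * b * y ^ 4 + 1056 * b ^ 3 * y ^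
    4 + 6144 * y ^ 8
  let d4 : R := -132 * a * b ^ 3 * y ^ 3 - 2304 * a * y ^ 7 + 1872 * a ^ 2 * b * y ^ 5 + 18 * a ^
    2 * b ^ 4 * y - 48 * a ^ 3 * b ^ 2 * y ^ 3 - 96 * a ^ 4 * y ^ 5 - 1056 * b ^ 2 * y ^ 5 - 72 *
    b ^ 5 * y
  let d5 : R := -264 * a * b ^ 2 * y ^ 4 + 48 * a ^ 2 * b ^ 3 * y ^ 2 - 96 * a ^ 2 * y ^ 6 - 192 *
    a ^ 3 * b * y ^ 4 + 1536 * b * y ^ 6 + 96 * b ^ 4 * y ^ 2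
  let d6 : R := -496 * a * b * y ^ 5 - 24 * a * b ^ 4 * y + 64 * a ^ 2 * b ^ 2 * y ^ 3 + 128 * a ^
    3 * y ^ 5 + 60 * b ^ 3 * y ^ 3 - 384 * y ^ 7
  let d7 : R := 288 * a * y ^ 6 - 72 * b ^ 2 * y ^ 4
  let d8 : R := -24 * a * b ^ 2 * y ^ 3 - 48 * a ^ 2 * y ^ 5 + 96 * b * y ^ 5 + 9 * b ^ 4 * y
  let d9 : R := 32 * a * b * y ^ 4 - 8 * b ^ 3 * y ^ 2 - 64 * y ^ 6
  d0 + d1 * d + d2 * d ^ 2 + d3 * d ^ 3 + d4 * d ^ 4 + d5 * d ^ 5 + d6 * d ^ 6 + d7 * d ^ 7 + d8 * d ^ 8 + d9 * d ^ 9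

/-- Moves the origin to `(x, -y)`, the third point of the chord whose end points add up to `(x, y)`.
The curve becomes `Y² = t³ + 3x t² + b t + y²`, up to the shift of `Y`, and the two lines have
slopes `d, e` and heights `u, w` above the new origin. -/
theorem coef_eval_eq_sShift {R : Type*} [Field R] (x b y d u e w : R) :
    let A := b - 3 * x ^ 2
    let B := y ^ 2 - x ^ 3 - A * x
    let h : Line R := ⟨d, u - y - d * x⟩
    let k : Line R := ⟨e, w - y - e * x⟩
    (coefA4 A B h k * x ^ 4 + coefA3 A B h k * x ^ 3 + coefA2 A B h k * x ^ 2 +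
      coefA1 A B h k * x + coefA0 A B h k) +
    y * (coefB3 A B h k * x ^ 3 + coefB2 A B h k * x ^ 2 + coefB1 A B h k * x +
      coefB0 A B h k) = sShift (3 * x) b y d u e w := by
  simp only [coefA4, coefA3, coefA2, coefA1, coefA0, coefB3, coefB2, coefB1, coefB0, sShift]
  ring

/-- A chord of slope `l` through the origin meets the shifted curve at abscissas `s, t` with `s + t
= l² - a` and `s t = b + 2 l y`. A line of slope `l - m` through the first point has height `m s`.
These substitutions use up the curve equation, so a free polynomial identity remains. -/
theorem sShift_identity {R : Type*} [CommRing R] (l m n s t y : R) :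
    sShift (l ^ 2 - s - t) (s * t - 2 * l * y) y (l - m) (m * s) (l - n) (n * t) = 0 := by
  simp only [sShift]
  ring

theorem triD_eq_shift {K : Type*} [Field K] (h3 : (3 : K) ≠ 0) (x b y d : K) :
    3 * triD (b - 3 * x ^ 2) (y ^ 2 - x ^ 3 - (b - 3 * x ^ 2) * x) ⟨d, y - d * x⟩ =
      triDShift (3 * x) b y d := by
  simp only [triD, triDShift]
  field_simp
  ring

theorem triV1_eq_shift {K : Type*} [Field K] (h3 : (3 : K) ≠ 0) (x b y d : K) :
    3 * triV1 (b - 3 * x ^ 2) (y ^ 2 - x ^ 3 - (b - 3 * x ^ 2) * x) ⟨d, y - d * x⟩ =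
      triV1Shift (3 * x) b y d := by
  simp only [triV1, triV1Shift]
  field_simp
  ring

theorem triV0_eq_shift {K : Type*} [Field K] (h3 : (3 : K) ≠ 0) (x b y d : K) :
    3 * (triV1 (b - 3 * x ^ 2) (y ^ 2 - x ^ 3 - (b - 3 * x ^ 2) * x) ⟨d, y - d * x⟩ * x +
      triV0 (b - 3 * x ^ 2) (y ^ 2 - x ^ 3 - (b - 3 * x ^ 2) * x) ⟨d, y - d * x⟩) =
      triV0Shift (3 * x) b y d := by
  simp only [triV1, triV0, triV0Shift]
  field_simp
  ring

/-- Free parameters for tripling: `l` is the tangent slope at `P`, `t = x(2P) - x(P)`, and `2r - l`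
is the slope of the chord through `P` and `2P`. Then `y(P) = -r t`, and `x(3P) - x(P) = (2r - l)² -
l² = 4r(r - l)`. -/
theorem triShift_identity {R : Type*} [CommRing R] (l t r d : R) :
    triDShift (l ^ 2 - t) (-2 * l * r * t) (-(r * t)) d *
        (-(-(r * t) + (2 * r - l) * (4 * r * (r - l)))) =
      triV1Shift (l ^ 2 - t) (-2 * l * r * t) (-(r * t)) d * (4 * r * (r - l)) +
        triV0Shift (l ^ 2 - t) (-2 * l * r * t) (-(r * t)) d := by
  simp only [triDShift, triV1Shift, triV0Shift]
  ring

/-- With `0, s, t` the abscissas on the line, each factor is the 3-division polynomial at one of the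
three points. -/
theorem triDShift_eq_prod {R : Type*} [CommRing R] (s t y d : R) :
    let a := d ^ 2 - s - t
    let b := s * t + 2 * d * y
    triDShift a b y d = (4 * a * y ^ 2 - b ^ 2) *
      (4 * (a + 3 * s) * (y + d * s) ^ 2 - (b + 2 * a * s + 3 * s ^ 2) ^ 2) *
      (4 * (a + 3 * t) * (y + d * t) ^ 2 - (b + 2 * a * t + 3 * t ^ 2) ^ 2) := by
  simp only [triDShift]
  ring

variable {K : Type*} [Field K]

/-- The function attached to two lines vanishes at the sum of a point of the first and a point
of the second. -/
theorem coef_eval_eq_zero {A B x₁ y₁ x₂ y₂ x₃ y₃ l : K} {h k : Line K}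
    (hl : l ^ 2 = x₁ + x₂ + x₃) (h₁ : y₁ = l * (x₁ - x₃) - y₃) (h₂ : y₂ = l * (x₂ - x₃) - y₃)
    (hb : 3 * x₃ ^ 2 + A = (x₁ - x₃) * (x₂ - x₃) - 2 * l * y₃) (hc : y₃ ^ 2 = x₃ ^ 3 + A * x₃ + B)
    (hh : y₁ = h.a1 * x₁ + h.a0) (hk : y₂ = k.a1 * x₂ + k.a0) :
    (coefA4 A B h k * x₃ ^ 4 + coefA3 A B h k * x₃ ^ 3 + coefA2 A B h k * x₃ ^ 2 +
      coefA1 A B h k * x₃ + coefA0 A B h k) +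
    y₃ * (coefB3 A B h k * x₃ ^ 3 + coefB2 A B h k * x₃ ^ 2 + coefB1 A B h k * x₃ +
      coefB0 A B h k) = 0 := by
  have e₁ := coef_eval_eq_sShift x₃ (3 * x₃ ^ 2 + A) y₃ h.a1 (h.a1 * x₃ + h.a0 + y₃) k.a1
    (k.a1 * x₃ + k.a0 + y₃)
  have e₂ := sShift_identity l (l - h.a1) (l - k.a1) (x₁ - x₃) (x₂ - x₃) y₃
  have hA : 3 * x₃ ^ 2 + A - 3 * x₃ ^ 2 = A := by ring
  have hB : y₃ ^ 2 - x₃ ^ 3 - A * x₃ = B := by linear_combination hc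
  have ha : l ^ 2 - (x₁ - x₃) - (x₂ - x₃) = 3 * x₃ := by linear_combination hl
  have hu : (l - h.a1) * (x₁ - x₃) = h.a1 * x₃ + h.a0 + y₃ := by linear_combination hh - h₁
  have hw : (l - k.a1) * (x₂ - x₃) = k.a1 * x₃ + k.a0 + y₃ := by linear_combination hk - h₂
  have hh' : (⟨h.a1, h.a1 * x₃ + h.a0 + y₃ - y₃ - h.a1 * x₃⟩ : Line K) = h := by
    ext <;> simp
  have hk' : (⟨k.a1, k.a1 * x₃ + k.a0 + y₃ - y₃ - k.a1 * x₃⟩ : Line K) = k := by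
    ext <;> simp
  rw [ha, ← hb, hu, hw, sub_sub_cancel, sub_sub_cancel] at e₂
  dsimp only at e₁
  rw [hA, hB, hh', hk', e₂] at e₁
  exact e₁

/-- The tangent `Y = l X + m` touches at `x` and meets the curve again at `x₃`, so Vieta's formulas
express `A` and `B`; `h` is an arbitrary line through the point of tangency, of slope `l + e`. -/
theorem dbl_identity (x l m e : K) :
    let x₃ := l ^ 2 - x - x
    let A := x * x + (x + x) * x₃ + 2 * l * m
    let B := m ^ 2 - x * x * x₃
    let h : Line K := ⟨l + e, m - e * x⟩
    dblC A B h * (-(l * x₃ + m)) = dblU1 A B h * x₃ + dblU0 A B h := by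
  simp only [dblC, dblU1, dblU0]
  ring

theorem dbl_eval {A B x y x₂ y₂ l : K} {h : Line K}
    (hl : l ^ 2 = x + x + x₂) (h₁ : y = l * (x - x₂) - y₂)
    (hb : 3 * x₂ ^ 2 + A = (x - x₂) * (x - x₂) - 2 * l * y₂) (hc : y₂ ^ 2 = x₂ ^ 3 + A * x₂ + B)
    (hh : y = h.a1 * x + h.a0) :
    dblC A B h * y₂ = dblU1 A B h * x₂ + dblU0 A B h := by
  have e₁ := dbl_identity x l (-y₂ - l * x₂) (h.a1 - l)
  have hx : l ^ 2 - x - x = x₂ := by linear_combination hl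
  have hA : x * x + (x + x) * x₂ + 2 * l * (-y₂ - l * x₂) = A := by
    linear_combination -hb - 2 * x₂ * hl
  have hB : (-y₂ - l * x₂) ^ 2 - x * x * x₂ = B := by
    linear_combination hc + x₂ ^ 2 * hl + x₂ * hb
  have hh' : (⟨l + (h.a1 - l), -y₂ - l * x₂ - (h.a1 - l) * x⟩ : Line K) = h := by
    ext
    · simp
    · linear_combination hh - h₁
  have hy : -(l * x₂ + (-y₂ - l * x₂)) = y₂ := by ring
  dsimp only at e₁
  rw [hx, hA, hB, hh', hy] at e₁
  exact e₁

theorem tri_eval (h2 : (2 : K) ≠ 0) (h3 : (3 : K) ≠ 0) {A B x y x₂ y₂ x₃ y₃ l m : K} {h : Line K}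
    (hl : l ^ 2 = x + x + x₂) (h₁ : y = l * (x - x₂) - y₂)
    (hb : 3 * x₂ ^ 2 + A = (x - x₂) * (x - x₂) - 2 * l * y₂) (hc : y ^ 2 = x ^ 3 + A * x + B)
    (hm : m ^ 2 = x + x₂ + x₃) (h₂ : y = m * (x - x₃) - y₃) (h₃ : y₂ = m * (x₂ - x₃) - y₃)
    (hh : y = h.a1 * x + h.a0) :
    triD A B h * y₃ = triV1 A B h * x₃ + triV0 A B h := by
  -- Adding the equations of the tangent and of the chord gives `2 y = -(m + l)(x₂ - x)`; halving
  -- the sum of slopes makes `y` polynomial in the parameters.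
  obtain ⟨r, hr⟩ : ∃ r, m + l = 2 * r := ⟨(m + l) / 2, by field_simp⟩
  have hA : 3 * x ^ 2 + A - 3 * x ^ 2 = A := by ring
  have hB : y ^ 2 - x ^ 3 - A * x = B := by linear_combination hc
  have hh' : (⟨h.a1, y - h.a1 * x⟩ : Line K) = h := by
    ext
    · rfl
    · linear_combination hh
  have hy : -(r * (x₂ - x)) = y := by
    apply mul_left_cancel₀ h2
    linear_combination (x₂ - x) * hr + h₃ - h₂ - h₁
  have ha : l ^ 2 - (x₂ - x) = 3 * x := by linear_combination hl
  have hb' : -2 * l * r * (x₂ - x) = 3 * x ^ 2 + A := by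
    linear_combination (2 * l) * hy - hb + 2 * l * h₁ + 2 * (x - x₂) * hl
  have hx : 4 * r * (r - l) = x₃ - x := by
    linear_combination (-2 * r - m + l) * hr + hm - hl
  have hm' : 2 * r - l = m := by linear_combination -hr
  have hy₃ : -(y + m * (x₃ - x)) = y₃ := by linear_combination -h₂
  have e := triShift_identity l (x₂ - x) r h.a1
  have e₀ := triD_eq_shift h3 x (3 * x ^ 2 + A) y h.a1
  have e₁ := triV1_eq_shift h3 x (3 * x ^ 2 + A) y h.a1
  have e₂ := triV0_eq_shift h3 x (3 * x ^ 2 + A) y h.a1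
  rw [hA, hB, hh'] at e₀ e₁ e₂
  rw [ha, hb', hx, hm', hy, hy₃, ← e₀, ← e₁, ← e₂] at e
  apply mul_left_cancel₀ h3
  linear_combination e

theorem triD_eq_prod (h3 : (3 : K) ≠ 0) {A B x₀ x₁ x₂ : K} {h : Line K}
    (e₁ : x₀ + x₁ + x₂ = h.a1 ^ 2) (e₂ : A = x₀ * x₁ + x₀ * x₂ + x₁ * x₂ + 2 * h.a1 * h.a0)
    (e₃ : B = h.a0 ^ 2 - x₀ * x₁ * x₂) :
    3 * triD A B h = (12 * x₀ * (h.a1 * x₀ + h.a0) ^ 2 - (3 * x₀ ^ 2 + A) ^ 2) *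
      (12 * x₁ * (h.a1 * x₁ + h.a0) ^ 2 - (3 * x₁ ^ 2 + A) ^ 2) *
      (12 * x₂ * (h.a1 * x₂ + h.a0) ^ 2 - (3 * x₂ ^ 2 + A) ^ 2) := by
  have e := triD_eq_shift h3 x₀ (3 * x₀ ^ 2 + A) (h.a1 * x₀ + h.a0) h.a1
  have hA : 3 * x₀ ^ 2 + A - 3 * x₀ ^ 2 = A := by ring
  have hB : (h.a1 * x₀ + h.a0) ^ 2 - x₀ ^ 3 - A * x₀ = B := by
    linear_combination -e₃ - x₀ * e₂ - x₀ ^ 2 * e₁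
  have hh' : (⟨h.a1, h.a1 * x₀ + h.a0 - h.a1 * x₀⟩ : Line K) = h := by ext <;> simp
  have e' := triDShift_eq_prod (x₁ - x₀) (x₂ - x₀) (h.a1 * x₀ + h.a0) h.a1
  have ha : h.a1 ^ 2 - (x₁ - x₀) - (x₂ - x₀) = 3 * x₀ := by linear_combination -e₁
  have hb : (x₁ - x₀) * (x₂ - x₀) + 2 * h.a1 * (h.a1 * x₀ + h.a0) = 3 * x₀ ^ 2 + A := by
    linear_combination -e₂ - 2 * x₀ * e₁
  dsimp only at e'
  rw [hA, hB, hh'] at e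
  rw [ha, hb] at e'
  rw [e, e']
  ring

/-- The right side is `-(h.a1 + k.a1)³` times the value of `f - h²` at the abscissa where `h` meets
the opposite of `k`, whenever `h.a1 + k.a1` is nonzero. -/
theorem coefB3_eq (A B : K) (h k : Line K) :
    coefB3 A B h k = (h.a0 + k.a0) ^ 3 + A * (h.a0 + k.a0) * (h.a1 + k.a1) ^ 2 -
      B * (h.a1 + k.a1) ^ 3 + (h.a1 + k.a1) * (h.a1 * k.a0 - h.a0 * k.a1) ^ 2 := by
  simp only [coefB3]
  ring

/-- For opposite lines, three of the nine sums are the point at infinity and the other six form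
opposite pairs, so the function is a cubic in `x` alone. Its leading coefficient is a discriminant
of `f - h²` up to sign, hence nonzero for distinct abscissas. -/
theorem coef_neg (A B : K) (h : Line K) :
    coefB3 A B h h.neg = 0 ∧ coefB2 A B h h.neg = 0 ∧ coefB1 A B h h.neg = 0 ∧
      coefB0 A B h h.neg = 0 ∧ coefA4 A B h h.neg = 0 ∧ coefA3 A B h h.neg =
        -(⟨1, -h.a1 ^ 2, A - 2 * h.a1 * h.a0, B - h.a0 ^ 2⟩ : Cubic K).discr := by
  refine ⟨?_, ?_, ?_, ?_, ?_, ?_⟩ <;>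
    simp only [coefB3, coefB2, coefB1, coefB0, coefA4, coefA3, Line.neg, Cubic.discr] <;> ring

theorem discr_eq {A B x₀ x₁ x₂ : K} {h : Line K}
    (e₁ : x₀ + x₁ + x₂ = h.a1 ^ 2) (e₂ : A = x₀ * x₁ + x₀ * x₂ + x₁ * x₂ + 2 * h.a1 * h.a0)
    (e₃ : B = h.a0 ^ 2 - x₀ * x₁ * x₂) :
    (⟨1, -h.a1 ^ 2, A - 2 * h.a1 * h.a0, B - h.a0 ^ 2⟩ : Cubic K).discr =
      ((x₀ - x₁) * (x₀ - x₂) * (x₁ - x₂)) ^ 2 := by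
  simp only [Cubic.discr, e₂, e₃, ← e₁]
  ring

end Identities

end TraceZero

namespace TraceZero

/-! ### Coordinates and chords on the curve. -/

section Points

open WeierstrassCurve WeierstrassCurve.Affine

theorem slope_relations {K : Type*} [Field K] [DecidableEq K] {W : Affine K} (ha₁ : W.a₁ = 0)
    (ha₂ : W.a₂ = 0) (ha₃ : W.a₃ = 0) {x₁ y₁ x₂ y₂ : K} (h₁ : W.Equation x₁ y₁)
    (h₂ : W.Equation x₂ y₂) (hxy : ¬(x₁ = x₂ ∧ y₁ = W.negY x₂ y₂)) :
    let l := W.slope x₁ x₂ y₁ y₂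
    let x₃ := W.addX x₁ x₂ l
    let y₃ := W.addY x₁ x₂ y₁ l
    l ^ 2 = x₁ + x₂ + x₃ ∧ y₁ = l * (x₁ - x₃) - y₃ ∧ y₂ = l * (x₂ - x₃) - y₃ ∧
      3 * x₃ ^ 2 + W.a₄ = (x₁ - x₃) * (x₂ - x₃) - 2 * l * y₃ := by
  intro l x₃ y₃
  have hx₃ : x₃ = l ^ 2 - x₁ - x₂ := by
    simp only [x₃, addX, ha₁, ha₂]; ring
  have hy₃ : y₃ = -(l * (x₃ - x₁) + y₁) := by
    simp only [y₃, x₃, addY, negAddY, negY, ha₁, ha₃]; ring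
  have hyy : y₁ - y₂ = l * (x₁ - x₂) := by
    by_cases hx : x₁ = x₂
    · have := Y_eq_of_Y_ne h₁ h₂ hx (fun h => hxy ⟨hx, h⟩)
      rw [this, hx]; ring
    · simp only [l]
      rw [slope_of_X_ne hx, div_mul_cancel₀ _ (sub_ne_zero.mpr hx)]
  -- The curve equation restricted to the chord factors over the three abscissas; its coefficient of
  -- `x` gives the last relation.
  have hp := addPolynomial_slope h₁ h₂ hxy
  rw [addPolynomial_eq, neg_inj, Cubic.prod_X_sub_C_eq, Cubic.toPoly_injective] at hp
  have hd := congrArg Cubic.c hp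
  simp only [ha₁, ha₃] at hd
  change _ = x₁ * x₂ + x₁ * x₃ + x₂ * x₃ at hd
  refine ⟨?_, ?_, ?_, ?_⟩
  · rw [hx₃]; ring
  · rw [hy₃]; ring
  · rw [hy₃]; linear_combination -hyy
  · rw [hy₃]; linear_combination hd + 2 * x₃ * hx₃

variable {F K : Type*} [Field F] [Field K] [Algebra F K] {A B : F}

/-- The `x`-coordinate of a point (with value `0` at infinity). -/
def xOf : Pts K A B → K
  | .zero => 0
  | .some x _ _ => x

/-- The `y`-coordinate of a point (with value `0` at infinity). -/
def yOf : Pts K A B → K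
  | .zero => 0
  | .some _ y _ => y

theorem yOf_sq {Q : Pts K A B} (hQ : Q ≠ 0) :
    yOf Q ^ 2 = xOf Q ^ 3 + algebraMap F K A * xOf Q + algebraMap F K B := by
  match Q, hQ with
  | .zero, hQ => exact absurd rfl hQ
  | .some x y h, _ =>
    have := (equation_iff x y).mp h.1
    simpa [curve, xOf, yOf] using this

theorem Pts.ext' {Q R : Pts K A B} (hQ : Q ≠ 0) (hR : R ≠ 0) (hx : xOf Q = xOf R)
    (hy : yOf Q = yOf R) : Q = R := by
  match Q, R, hQ, hR with
  | .zero, _, hQ, _ => exact absurd rfl hQ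
  | .some _ _ _, .zero, _, hR => exact absurd rfl hR
  | .some x y h, .some x' y' h', _, _ =>
    simp only [xOf, yOf] at hx hy
    subst hx hy
    rfl

theorem xOf_neg (Q : Pts K A B) : xOf (-Q) = xOf Q := by
  match Q with
  | .zero => rfl
  | .some x y h => rfl

theorem yOf_neg (Q : Pts K A B) : yOf (-Q) = -yOf Q := by
  match Q with
  | .zero => exact neg_zero.symm
  | .some x y h =>
    have : (((curve A B).baseChange K).toAffine.negY x y) = -y := by simp [curve, negY]
    exact this

theorem eq_or_eq_neg_of_xOf_eq {Q R : Pts K A B} (hQ : Q ≠ 0) (hR : R ≠ 0)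
    (hx : xOf Q = xOf R) : Q = R ∨ Q = -R := by
  have h : (yOf Q - yOf R) * (yOf Q + yOf R) = 0 := by
    have h₁ := yOf_sq hQ
    have h₂ := yOf_sq hR
    rw [hx] at h₁
    linear_combination h₁ - h₂
  rcases mul_eq_zero.mp h with h | h
  · exact .inl (Pts.ext' hQ hR hx (sub_eq_zero.mp h))
  · refine .inr (Pts.ext' hQ (fun h0 => hR (by rw [← neg_neg R, h0, Point.neg_zero])) (hx.trans (xOf_neg R).symm) ?_)
    rw [yOf_neg]
    exact eq_neg_of_add_eq_zero_left h

theorem contains_iff {h : Line F} {Q : Pts K A B} :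
    h.Contains Q ↔ Q ≠ 0 ∧ yOf Q = algebraMap F K h.a1 * xOf Q + algebraMap F K h.a0 := by
  match Q with
  | .zero => exact ⟨False.elim, fun h => h.1 rfl⟩
  | .some x y hn => exact ⟨fun h => ⟨Point.some_ne_zero hn, h⟩, fun h => h.2⟩

variable [DecidableEq K]

/-- The line through `Q` and `R`, of slope `l`, and its third point of intersection `-(Q + R)`. -/
theorem exists_slope {Q R : Pts K A B} (hQ : Q ≠ 0) (hR : R ≠ 0) (hQR : Q + R ≠ 0) :
    ∃ l : K, l ^ 2 = xOf Q + xOf R + xOf (Q + R) ∧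
      yOf Q = l * (xOf Q - xOf (Q + R)) - yOf (Q + R) ∧
      yOf R = l * (xOf R - xOf (Q + R)) - yOf (Q + R) ∧
      3 * xOf (Q + R) ^ 2 + algebraMap F K A =
        (xOf Q - xOf (Q + R)) * (xOf R - xOf (Q + R)) - 2 * l * yOf (Q + R) := by
  match Q, R, hQ, hR, hQR with
  | .zero, _, hQ, _, _ => exact absurd rfl hQ
  | .some _ _ _, .zero, _, hR, _ => exact absurd rfl hR
  | .some x₁ y₁ h₁, .some x₂ y₂ h₂, _, _, hQR =>
    have hxy : ¬(x₁ = x₂ ∧ y₁ = ((curve A B).baseChange K).toAffine.negY x₂ y₂) :=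
      fun h => hQR (Point.add_of_Y_eq h.1 h.2)
    have := slope_relations (W := ((curve A B).baseChange K).toAffine) (by simp [curve])
      (by simp [curve]) (by simp [curve]) h₁.1 h₂.1 hxy
    rw [Point.add_some hxy]
    refine ⟨_, this.1, this.2.1, this.2.2.1, this.2.2.2⟩

end Points

/-! ### Frobenius on points and lines. -/

section Frobenius

variable {F K : Type*} [Field F] [Field K] [Algebra F K] {A B : F} [Fintype F] [DecidableEq K]

theorem xOf_frob (Q : Pts K A B) : xOf (frob K A B Q) = xOf Q ^ Fintype.card F := by
  match Q with
  | .zero => exact (zero_pow Fintype.card_ne_zero).symm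
  | .some x y h => rfl

theorem yOf_frob (Q : Pts K A B) : yOf (frob K A B Q) = yOf Q ^ Fintype.card F := by
  match Q with
  | .zero => exact (zero_pow Fintype.card_ne_zero).symm
  | .some x y h => rfl

theorem frob_injective : Function.Injective (frob K A B) :=
  WeierstrassCurve.Affine.Point.map_injective _

theorem contains_frob {h : Line F} {Q : Pts K A B} (hh : h.Contains Q) :
    h.Contains (frob K A B Q) := by
  obtain ⟨hQ, hy⟩ := contains_iff.mp hh
  refine contains_iff.mpr ⟨fun h0 => hQ (frob_injective (h0.trans (map_zero _).symm)), ?_⟩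
  have := congrArg (FiniteField.frobeniusAlgHom F K) hy
  rw [map_add, map_mul, AlgHom.commutes, AlgHom.commutes] at this
  rw [xOf_frob, yOf_frob]
  exact this

/-- A line with coefficients in `F` is stable under Frobenius, so one incidence implies the other
two. -/
theorem isLineOf_iff {h : Line F} {Q : Pts K A B} : IsLineOf h Q ↔ h.Contains Q :=
  ⟨fun H => H.1, fun H => ⟨H, contains_frob H, contains_frob (contains_frob H)⟩⟩

end Frobenius

/-! ### Compatibility of the formulas with extension of scalars. -/

section Coefficients

variable {F K : Type*} [Field F] [Field K] [Algebra F K]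

/-- The image of a line under extension of the base field. -/
def Line.map (K : Type*) [Field K] [Algebra F K] (h : Line F) : Line K :=
  ⟨algebraMap F K h.a1, algebraMap F K h.a0⟩

theorem map_coef (A B : F) (h k : Line F) :
    algebraMap F K (coefA4 A B h k) =
      coefA4 (algebraMap F K A) (algebraMap F K B) (h.map K) (k.map K) ∧
    algebraMap F K (coefA3 A B h k) =
      coefA3 (algebraMap F K A) (algebraMap F K B) (h.map K) (k.map K) ∧
    algebraMap F K (coefA2 A B h k) =
      coefA2 (algebraMap F K A) (algebraMap F K B) (h.map K) (k.map K) ∧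
    algebraMap F K (coefA1 A B h k) =
      coefA1 (algebraMap F K A) (algebraMap F K B) (h.map K) (k.map K) ∧
    algebraMap F K (coefA0 A B h k) =
      coefA0 (algebraMap F K A) (algebraMap F K B) (h.map K) (k.map K) := by
  refine ⟨?_, ?_, ?_, ?_, ?_⟩ <;>
    simp only [coefA4, coefA3, coefA2, coefA1, coefA0, Line.map, map_add, map_sub, map_mul,
      map_pow, map_neg, map_ofNat]

theorem map_coefB (A B : F) (h k : Line F) :
    algebraMap F K (coefB3 A B h k) =
      coefB3 (algebraMap F K A) (algebraMap F K B) (h.map K) (k.map K) ∧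
    algebraMap F K (coefB2 A B h k) =
      coefB2 (algebraMap F K A) (algebraMap F K B) (h.map K) (k.map K) ∧
    algebraMap F K (coefB1 A B h k) =
      coefB1 (algebraMap F K A) (algebraMap F K B) (h.map K) (k.map K) ∧
    algebraMap F K (coefB0 A B h k) =
      coefB0 (algebraMap F K A) (algebraMap F K B) (h.map K) (k.map K) := by
  refine ⟨?_, ?_, ?_, ?_⟩ <;>
    simp only [coefB3, coefB2, coefB1, coefB0, Line.map, map_add, map_sub, map_mul,
      map_pow, map_neg, map_ofNat]

theorem map_dbl (A B : F) (h : Line F) :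
    algebraMap F K (dblC A B h) = dblC (algebraMap F K A) (algebraMap F K B) (h.map K) ∧
    algebraMap F K (dblU1 A B h) = dblU1 (algebraMap F K A) (algebraMap F K B) (h.map K) ∧
    algebraMap F K (dblU0 A B h) = dblU0 (algebraMap F K A) (algebraMap F K B) (h.map K) := by
  refine ⟨?_, ?_, ?_⟩ <;>
    simp only [dblC, dblU1, dblU0, Line.map, map_add, map_sub, map_mul,
      map_pow, map_neg, map_ofNat]

theorem map_tri (A B : F) (h : Line F) :
    algebraMap F K (triD A B h) = triD (algebraMap F K A) (algebraMap F K B) (h.map K) ∧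
    algebraMap F K (triV1 A B h) = triV1 (algebraMap F K A) (algebraMap F K B) (h.map K) ∧
    algebraMap F K (triV0 A B h) = triV0 (algebraMap F K A) (algebraMap F K B) (h.map K) := by
  refine ⟨?_, ?_, ?_⟩ <;>
    simp only [triD, triV1, triV0, Line.map, map_add, map_sub, map_mul,
      map_pow, map_neg, map_ofNat, map_div₀, map_one]

end Coefficients

end TraceZero

namespace TraceZero

/-! ### Minimal polynomials and conjugates in the cubic extension. -/

section CubicExtension

section Minpoly

variable {F K : Type*} [Field F] [Field K] [Algebra F K]

theorem irreducible_minpoly (hK : Module.finrank F K = 3) (x : K) :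
    Irreducible (minpoly F x) := by
  have : FiniteDimensional F K := FiniteDimensional.of_finrank_pos (by omega)
  exact minpoly.irreducible (Algebra.IsIntegral.isIntegral x)

theorem monic_minpoly (hK : Module.finrank F K = 3) (x : K) : (minpoly F x).Monic := by
  have : FiniteDimensional F K := FiniteDimensional.of_finrank_pos (by omega)
  exact minpoly.monic (Algebra.IsIntegral.isIntegral x)

theorem natDegree_minpoly (hK : Module.finrank F K = 3) {x : K}
    (hx : x ∉ Set.range (algebraMap F K)) : (minpoly F x).natDegree = 3 := by
  have : FiniteDimensional F K := FiniteDimensional.of_finrank_pos (by omega)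
  have hd := minpoly.degree_dvd (K := F) (x := x) (Algebra.IsIntegral.isIntegral x)
  rw [hK] at hd
  rcases (Nat.dvd_prime Nat.prime_three).mp hd with h | h
  · exact absurd (minpoly.natDegree_eq_one_iff.mp h) hx
  · exact h

end Minpoly

variable {F K : Type*} [Field F] [Fintype F] [Field K] [Algebra F K]

theorem mem_range_of_pow_card (hK : Module.finrank F K = 3) {x : K}
    (hx : x ^ Fintype.card F = x) : x ∈ Set.range (algebraMap F K) := by
  have : FiniteDimensional F K := FiniteDimensional.of_finrank_pos (by omega)
  have : Finite K := Module.finite_of_finite F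
  have : x ∈ (⊥ : IntermediateField F K) := by
    rw [IsGalois.mem_bot_iff_fixed]
    intro f
    obtain ⟨n, hn⟩ := (FiniteField.bijective_frobeniusAlgEquivOfAlgebraic_pow F K).2 f
    rw [← hn]
    simp only [AlgEquiv.coe_pow]
    exact Function.iterate_fixed hx _
  exact IntermediateField.mem_bot.mp this

theorem exists_pow_of_aeval_minpoly (hK : Module.finrank F K = 3) {x x' : K}
    (h : aeval x' (minpoly F x) = 0) : ∃ j : ℕ, x' = x ^ (Fintype.card F ^ j) := by
  have : FiniteDimensional F K := FiniteDimensional.of_finrank_pos (by omega)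
  have : Finite K := Module.finite_of_finite F
  have hc : IsConjRoot F x x' := by
    rw [isConjRoot_iff_aeval_eq_zero (Algebra.IsIntegral.isIntegral x)]
    exact h
  obtain ⟨f, hf⟩ := isConjRoot_iff_exists_algEquiv.mp hc.symm
  obtain ⟨n, hn⟩ := (FiniteField.bijective_frobeniusAlgEquivOfAlgebraic_pow F K).2 f
  refine ⟨n, ?_⟩
  rw [← hf, ← hn]
  simp only [AlgEquiv.coe_pow]
  rw [FiniteField.coe_frobeniusAlgEquivOfAlgebraic_iterate]

end CubicExtension

/-- A subgroup of prime order `p` of the trace zero subgroup, parametrised by `ZMod p`, on which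
the Frobenius endomorphism is multiplication by `s`. -/
structure Param {F : Type*} [Field F] [Fintype F] (K : Type*) [Field K] [Algebra F K]
    [DecidableEq K] (A B : F) {p : ℕ} [Fact p.Prime] (s : ZMod p) where
  pt : ZMod p →+ Pts K A B
  inj : Function.Injective pt
  frob_pt : ∀ c, frob K A B (pt c) = pt (s * c)
  s_sq : s ^ 2 + s + 1 = 0
  finrank : Module.finrank F K = 3
  two : (2 : F) ≠ 0
  three : (3 : F) ≠ 0
  two' : (2 : ZMod p) ≠ 0
  three' : (3 : ZMod p) ≠ 0

/-! ### Lines of the parametrised subgroup, doubling and tripling. -/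

namespace Param

variable {F K : Type*} [Field F] [Fintype F] [Field K] [Algebra F K] [DecidableEq K]
  {A B : F} {p : ℕ} [Fact p.Prime] {s : ZMod p} (S : Param K A B s)

theorem s_ne_zero (S : Param K A B s) : s ≠ 0 := by
  rintro rfl
  simpa using S.s_sq

theorem s_cube (S : Param K A B s) : s ^ 3 = 1 := by
  linear_combination (s - 1) * S.s_sq

theorem s_ne_one (S : Param K A B s) : s ≠ 1 := by
  rintro rfl
  exact S.three' (by linear_combination S.s_sq)

theorem s_ne_neg_one (S : Param K A B s) : s ≠ -1 := by
  rintro rfl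
  exact one_ne_zero (α := ZMod p) (by linear_combination S.s_sq)

theorem pt_ne_zero {c : ZMod p} (hc : c ≠ 0) : S.pt c ≠ 0 :=
  fun h => hc (S.inj (h.trans (map_zero _).symm))

theorem neg_ne (S : Param K A B s) {c : ZMod p} (hc : c ≠ 0) : c ≠ -c := fun h => by
  have : 2 * c = 0 := by linear_combination h
  exact (mul_ne_zero S.two' hc) this

theorem xOf_pow (c : ZMod p) (j : ℕ) :
    xOf (S.pt c) ^ (Fintype.card F ^ j) = xOf (S.pt (s ^ j * c)) := by
  induction j with
  | zero => simp
  | succ j ih => rw [pow_succ, pow_mul, ih, ← xOf_frob, S.frob_pt, ← mul_assoc, ← pow_succ']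

theorem contains_pow {h : Line F} {c : ZMod p} (hc : h.Contains (S.pt c)) (j : ℕ) :
    h.Contains (S.pt (s ^ j * c)) := by
  induction j with
  | zero => simpa using hc
  | succ j ih => rw [pow_succ', mul_assoc, ← S.frob_pt]; exact contains_frob ih

theorem eq_or_eq_neg {c d : ZMod p} (hc : c ≠ 0) (hd : d ≠ 0)
    (h : xOf (S.pt c) = xOf (S.pt d)) : c = d ∨ c = -d := by
  rcases eq_or_eq_neg_of_xOf_eq (S.pt_ne_zero hc) (S.pt_ne_zero hd) h with h | h
  · exact .inl (S.inj h)
  · exact .inr (S.inj (by rw [h, map_neg]))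

theorem xOf_ne {c : ZMod p} (hc : c ≠ 0) : xOf (S.pt c) ≠ xOf (S.pt (s * c)) := by
  intro h
  rcases S.eq_or_eq_neg hc (mul_ne_zero S.s_ne_zero hc) h with h | h
  · exact S.s_ne_one (mul_right_cancel₀ hc (by linear_combination -h))
  · exact S.s_ne_neg_one (mul_right_cancel₀ hc (by linear_combination h))

/-- An abscissa in `F` would be fixed by Frobenius, giving `c = ± s c`, whereas `s` is neither 1 nor
-1. Consequently its minimal polynomial over `F` has degree 3. -/
theorem xOf_notMem {c : ZMod p} (hc : c ≠ 0) :
    xOf (S.pt c) ∉ Set.range (algebraMap F K) := by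
  rintro ⟨a, ha⟩
  apply S.xOf_ne hc
  rw [← S.frob_pt, xOf_frob, ← ha, ← map_pow, FiniteField.pow_card]

theorem exists_of_aeval_minpoly {c d : ZMod p} (hc : c ≠ 0) (hd : d ≠ 0)
    (h : aeval (xOf (S.pt d)) (minpoly F (xOf (S.pt c))) = 0) :
    ∃ j : ℕ, d = s ^ j * c ∨ d = -(s ^ j * c) := by
  obtain ⟨j, hj⟩ := exists_pow_of_aeval_minpoly S.finrank h
  rw [xOf_pow] at hj
  exact ⟨j, S.eq_or_eq_neg hd (mul_ne_zero (pow_ne_zero _ S.s_ne_zero) hc) hj⟩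

theorem ne_zero_of_contains {h : Line F} {c : ZMod p} (hc : h.Contains (S.pt c)) : c ≠ 0 := by
  rintro rfl
  exact (contains_iff.mp hc).1 (map_zero _)

/-- The abscissa is not in `F`, so 1 and `x` are linearly independent over `F`, and one point fixes
both coefficients. -/
theorem line_unique {h k : Line F} {c : ZMod p} (hc : h.Contains (S.pt c))
    (kc : k.Contains (S.pt c)) : h = k := by
  have h0 := S.ne_zero_of_contains hc
  have h₁ := (contains_iff.mp hc).2
  have h₂ := (contains_iff.mp kc).2
  have h₃ : algebraMap F K (h.a1 - k.a1) * xOf (S.pt c) = algebraMap F K (k.a0 - h.a0) := by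
    rw [map_sub, map_sub]; linear_combination h₂ - h₁
  have h₄ : h.a1 = k.a1 := by
    by_contra hne
    have hne' : h.a1 - k.a1 ≠ 0 := sub_ne_zero.mpr hne
    refine S.xOf_notMem h0 ⟨(k.a0 - h.a0) / (h.a1 - k.a1), ?_⟩
    rw [map_div₀, ← h₃, mul_div_cancel_left₀]
    exact (_root_.map_ne_zero _).mpr hne'
  ext
  · exact h₄
  · rw [h₄, sub_self, map_zero, zero_mul] at h₃
    exact (sub_eq_zero.mp ((map_eq_zero _).mp h₃.symm)).symm

theorem contains_neg {h : Line F} {c : ZMod p} (hc : h.Contains (S.pt c)) :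
    h.neg.Contains (S.pt (-c)) := by
  obtain ⟨h₁, h₂⟩ := contains_iff.mp hc
  rw [map_neg, contains_iff]
  refine ⟨neg_ne_zero.mpr h₁, ?_⟩
  rw [xOf_neg, yOf_neg, h₂, Line.neg, map_neg, map_neg]
  ring

/-- The slope and Vieta's formulas for the three points `c`, `s c`, `s² c` on a line. -/
theorem exists_slope {c : ZMod p} (hc : c ≠ 0) :
    ∃ l m : K, yOf (S.pt c) = l * xOf (S.pt c) + m ∧
      yOf (S.pt (s * c)) = l * xOf (S.pt (s * c)) + m ∧
      yOf (S.pt (s * (s * c))) = l * xOf (S.pt (s * (s * c))) + m ∧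
      xOf (S.pt c) + xOf (S.pt (s * c)) + xOf (S.pt (s * (s * c))) = l ^ 2 ∧
      algebraMap F K A = xOf (S.pt c) * xOf (S.pt (s * c)) +
        xOf (S.pt c) * xOf (S.pt (s * (s * c))) +
        xOf (S.pt (s * c)) * xOf (S.pt (s * (s * c))) + 2 * l * m ∧
      algebraMap F K B =
        m ^ 2 - xOf (S.pt c) * xOf (S.pt (s * c)) * xOf (S.pt (s * (s * c))) := by
  have hs := S.s_ne_zero
  have e₀ : S.pt c + S.pt (s * c) = -S.pt (s * (s * c)) := by
    rw [← map_add, ← map_neg]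
    congr 1
    linear_combination c * S.s_sq
  have h₁ := S.pt_ne_zero hc
  have h₂ := S.pt_ne_zero (mul_ne_zero hs hc)
  have h₃ := S.pt_ne_zero (mul_ne_zero hs (mul_ne_zero hs hc))
  obtain ⟨l, r₁, r₂, r₃, r₄⟩ := TraceZero.exists_slope h₁ h₂ (by rw [e₀]; exact neg_ne_zero.mpr h₃)
  have r₅ := yOf_sq h₃
  rw [e₀, xOf_neg, yOf_neg] at *
  set x₀ := xOf (S.pt c)
  set x₁ := xOf (S.pt (s * c))
  set x₂ := xOf (S.pt (s * (s * c)))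
  set y₂ := yOf (S.pt (s * (s * c)))
  have hA : algebraMap F K A = x₀ * x₁ + x₀ * x₂ + x₁ * x₂ + 2 * l * (y₂ - l * x₂) := by
    linear_combination r₄ + 2 * x₂ * r₁
  refine ⟨l, y₂ - l * x₂, ?_, ?_, ?_, ?_, hA, ?_⟩
  · linear_combination r₂
  · linear_combination r₃
  · ring
  · linear_combination -r₁
  · linear_combination -r₅ - x₂ * hA + x₂ ^ 2 * r₁

theorem exists_line {c : ZMod p} (hc : c ≠ 0) : ∃ h : Line F, h.Contains (S.pt c) := by
  obtain ⟨l, m, h₀, h₁, h₂, -⟩ := S.exists_slope hc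
  have hs := S.s_ne_zero
  have f₁ : yOf (S.pt (s * c)) =
      l ^ Fintype.card F * xOf (S.pt (s * c)) + m ^ Fintype.card F := by
    have := congrArg (FiniteField.frobeniusAlgHom F K) h₀
    rw [map_add (FiniteField.frobeniusAlgHom F K), map_mul (FiniteField.frobeniusAlgHom F K)] at this
    rw [← S.frob_pt, xOf_frob, yOf_frob]
    exact this
  have f₂ : yOf (S.pt (s * (s * c))) =
      l ^ Fintype.card F * xOf (S.pt (s * (s * c))) + m ^ Fintype.card F := by
    have := congrArg (FiniteField.frobeniusAlgHom F K) h₁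
    rw [map_add (FiniteField.frobeniusAlgHom F K), map_mul (FiniteField.frobeniusAlgHom F K)] at this
    rw [← S.frob_pt (s * c), xOf_frob, yOf_frob]
    exact this
  -- The line and its Frobenius conjugate both pass through the points `s c` and `s² c`, whose
  -- abscissas differ, so they coincide and the coefficients descend to `F`.
  have hl : l ^ Fintype.card F = l := by
    have := sub_ne_zero.mpr (S.xOf_ne (mul_ne_zero hs hc))
    apply mul_right_cancel₀ this
    linear_combination f₂ - f₁ + h₁ - h₂
  have hm : m ^ Fintype.card F = m := by
    rw [hl] at f₁
    linear_combination h₁ - f₁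
  obtain ⟨a, rfl⟩ := mem_range_of_pow_card S.finrank hl
  obtain ⟨b, rfl⟩ := mem_range_of_pow_card S.finrank hm
  exact ⟨⟨a, b⟩, contains_iff.mpr ⟨S.pt_ne_zero hc, h₀⟩⟩

theorem vieta {h : Line F} {c : ZMod p} (hc : h.Contains (S.pt c)) :
    xOf (S.pt c) + xOf (S.pt (s * c)) + xOf (S.pt (s * (s * c))) = (h.map K).a1 ^ 2 ∧
      algebraMap F K A = xOf (S.pt c) * xOf (S.pt (s * c)) +
        xOf (S.pt c) * xOf (S.pt (s * (s * c))) +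
        xOf (S.pt (s * c)) * xOf (S.pt (s * (s * c))) + 2 * (h.map K).a1 * (h.map K).a0 ∧
      algebraMap F K B = (h.map K).a0 ^ 2 -
        xOf (S.pt c) * xOf (S.pt (s * c)) * xOf (S.pt (s * (s * c))) := by
  have h0 := S.ne_zero_of_contains hc
  obtain ⟨l, m, h₀, h₁, -, h₃⟩ := S.exists_slope h0
  have k₀ := (contains_iff.mp hc).2
  have k₁ := (contains_iff.mp (S.contains_pow hc 1)).2
  rw [pow_one] at k₁
  have hl : l = (h.map K).a1 := by
    apply mul_right_cancel₀ (sub_ne_zero.mpr (S.xOf_ne h0))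
    simp only [Line.map]
    linear_combination k₀ - k₁ + h₁ - h₀
  have hm : m = (h.map K).a0 := by
    rw [hl] at h₀
    simp only [Line.map] at *
    linear_combination k₀ - h₀
  rw [← hl, ← hm]
  exact h₃

/-- The polynomial `f - h²` of the `x`-coordinates of the points of `E` on the line `h`. -/
theorem minpoly_eq {h : Line F} {c : ZMod p} (hc : h.Contains (S.pt c)) :
    minpoly F (xOf (S.pt c)) =
      X ^ 3 + C A * X + C B - (C h.a1 * X + C h.a0) ^ 2 := by
  obtain ⟨h₁, h₂⟩ := contains_iff.mp hc
  have hd := natDegree_minpoly S.finrank (S.xOf_notMem (S.ne_zero_of_contains hc))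
  have hm : (X ^ 3 + C A * X + C B - (C h.a1 * X + C h.a0) ^ 2 : F[X]).Monic := by monicity!
  have hn : (X ^ 3 + C A * X + C B - (C h.a1 * X + C h.a0) ^ 2 : F[X]).natDegree = 3 := by
    compute_degree!
  refine (Polynomial.eq_of_monic_of_dvd_of_natDegree_le (monic_minpoly S.finrank _) hm
    (minpoly.dvd _ _ ?_) (by omega)).symm
  have := yOf_sq h₁
  simp only [map_sub, map_add, map_mul, map_pow, aeval_X, aeval_C]
  rw [← h₂]
  linear_combination -this

/-- All abscissas on the line are conjugate, so `d = ± sʲ c`. With the minus sign, `d` and `-d`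
would have the same `y`-coordinate, forcing `d = -d`. -/
theorem exists_of_contains {h : Line F} {c d : ZMod p} (hc : h.Contains (S.pt c))
    (hd : h.Contains (S.pt d)) : ∃ j : ℕ, d = s ^ j * c := by
  have hc0 := S.ne_zero_of_contains hc
  have hd0 := S.ne_zero_of_contains hd
  have h₁ : aeval (xOf (S.pt d)) (minpoly F (xOf (S.pt c))) = 0 := by
    rw [S.minpoly_eq hc, ← S.minpoly_eq hd, minpoly.aeval]
  obtain ⟨j, hj | hj⟩ := S.exists_of_aeval_minpoly hc0 hd0 h₁
  · exact ⟨j, hj⟩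
  · have k₁ := (contains_iff.mp (S.contains_pow hc j)).2
    have k₂ := (contains_iff.mp hd).2
    exfalso
    refine S.neg_ne hd0 (S.inj (Pts.ext' (S.pt_ne_zero hd0)
      (S.pt_ne_zero (neg_ne_zero.mpr hd0)) ?_ ?_))
    · rw [map_neg, xOf_neg]
    · have e : xOf (S.pt d) = xOf (S.pt (s ^ j * c)) := by rw [hj, map_neg, xOf_neg]
      rw [e, ← k₁] at k₂
      rw [k₂, hj, neg_neg]

theorem not_isRoot {h : Line F} {c : ZMod p} (hc : h.Contains (S.pt c)) (r : F) :
    r ^ 3 + A * r + B - (h.a1 * r + h.a0) ^ 2 ≠ 0 := by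
  intro hr
  have : FiniteDimensional F K := FiniteDimensional.of_finrank_pos (by rw [S.finrank]; omega)
  have : (minpoly F (xOf (S.pt c))).IsRoot r := by
    rw [S.minpoly_eq hc, IsRoot.def]
    simpa using hr
  exact S.xOf_notMem (S.ne_zero_of_contains hc)
    ⟨r, minpoly.root (Algebra.IsIntegral.isIntegral _) this⟩

theorem yOf_ne_zero {c : ZMod p} (hc : c ≠ 0) : yOf (S.pt c) ≠ 0 := by
  intro h
  refine S.neg_ne hc (S.inj (Pts.ext' (S.pt_ne_zero hc) (S.pt_ne_zero (neg_ne_zero.mpr hc)) ?_ ?_))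
  · rw [map_neg, xOf_neg]
  · rw [map_neg, yOf_neg, h, neg_zero]

/-- If the slopes do not cancel, vanishing would give the irreducible cubic `f - h²` a root in `F`;
if they do, the coefficient is `(h.a0 + k.a0)³`, which vanishes only for opposite lines. -/
theorem coefB3_ne_zero {h k : Line F} {c : ZMod p} (hc : h.Contains (S.pt c))
    (hk : h ≠ k.neg) : coefB3 A B h k ≠ 0 := by
  intro h0
  rw [coefB3_eq] at h0
  by_cases h1 : h.a1 + k.a1 = 0
  · rw [h1] at h0
    have h2 : h.a0 + k.a0 = 0 := by
      apply pow_eq_zero_iff (n := 3) (by norm_num) |>.mp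
      linear_combination h0
    exact hk (Line.ext (eq_neg_of_add_eq_zero_left h1) (eq_neg_of_add_eq_zero_left h2))
  · apply S.not_isRoot hc (-(h.a0 + k.a0) / (h.a1 + k.a1))
    field_simp
    linear_combination -h0

/-- Up to a power of 2, the denominator is `h.a1³` times `f - h²` at the zero `-h.a0 / h.a1` of the
line, and `f - h²` has no root in `F`. If `h.a1 = 0` it forces `h = 0`, hence a point with `y = 0`,
of order 2. -/
theorem dblC_ne_zero {h : Line F} {c : ZMod p} (hc : h.Contains (S.pt c)) :
    dblC A B h ≠ 0 := by
  have h2 := S.two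
  intro h0
  have h0' : B * h.a1 ^ 3 - A * h.a1 ^ 2 * h.a0 - h.a0 ^ 3 = 0 := by
    rw [dblC] at h0
    have : (2 : F) ^ 3 ≠ 0 := pow_ne_zero _ h2
    apply (mul_eq_zero.mp _).resolve_left this
    linear_combination h0
  by_cases h1 : h.a1 = 0
  · rw [h1] at h0'
    have h2 : h.a0 = 0 := by
      apply pow_eq_zero_iff (n := 3) (by norm_num) |>.mp
      linear_combination -h0'
    apply S.yOf_ne_zero (S.ne_zero_of_contains hc)
    rw [(contains_iff.mp hc).2, h1, h2]
    simp
  · apply S.not_isRoot hc (-h.a0 / h.a1)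
    field_simp
    linear_combination h0'

theorem double_eq {h : Line F} {c : ZMod p} (hc : h.Contains (S.pt c)) :
    ∃ g, double A B h = some g ∧ g.Contains (S.pt (2 * c)) := by
  have hC := S.dblC_ne_zero hc
  have h0 := S.ne_zero_of_contains hc
  refine ⟨_, by rw [double, if_neg hC], ?_⟩
  have h2c := S.pt_ne_zero (mul_ne_zero S.two' h0)
  have e₀ : S.pt c + S.pt c = S.pt (2 * c) := by rw [two_mul, map_add]
  obtain ⟨l, r₁, r₂, -, r₄⟩ := TraceZero.exists_slope (S.pt_ne_zero h0) (S.pt_ne_zero h0)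
    (by rw [e₀]; exact h2c)
  rw [e₀] at *
  have key := dbl_eval (h := h.map K) r₁ r₂ r₄ (yOf_sq h2c) (contains_iff.mp hc).2
  rw [← (map_dbl A B h).1, ← (map_dbl A B h).2.1, ← (map_dbl A B h).2.2] at key
  refine contains_iff.mpr ⟨h2c, ?_⟩
  have hC' : algebraMap F K (dblC A B h) ≠ 0 := (_root_.map_ne_zero _).mpr hC
  rw [map_div₀, map_div₀]
  field_simp
  linear_combination key

/-- The 3-division polynomial equals `(x(P) - x(2P)) (2y)²`; equal abscissas would mean `c = ± 2c`,
impossible as 3 is nonzero modulo `p`. -/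
theorem division_ne_zero {c : ZMod p} (hc : c ≠ 0) :
    12 * xOf (S.pt c) * yOf (S.pt c) ^ 2 -
      (3 * xOf (S.pt c) ^ 2 + algebraMap F K A) ^ 2 ≠ 0 := by
  have h2c := S.pt_ne_zero (mul_ne_zero S.two' hc)
  have e₀ : S.pt c + S.pt c = S.pt (2 * c) := by rw [two_mul, map_add]
  obtain ⟨l, r₁, r₂, -, r₄⟩ := TraceZero.exists_slope (S.pt_ne_zero hc) (S.pt_ne_zero hc)
    (by rw [e₀]; exact h2c)
  rw [e₀] at *
  have hx : xOf (S.pt c) - xOf (S.pt (2 * c)) ≠ 0 := by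
    refine sub_ne_zero.mpr fun h => ?_
    rcases S.eq_or_eq_neg hc (mul_ne_zero S.two' hc) h with h | h
    · exact hc (by linear_combination -h)
    · exact mul_ne_zero S.three' hc (by linear_combination h)
  set x := xOf (S.pt c)
  set y := yOf (S.pt c)
  set x₂ := xOf (S.pt (2 * c))
  have hb : 3 * x ^ 2 + algebraMap F K A = 2 * l * y := by
    linear_combination r₄ - 2 * l * r₂ - 2 * (x - x₂) * r₁
  have e : 12 * x * y ^ 2 - (3 * x ^ 2 + algebraMap F K A) ^ 2 = (x - x₂) * (2 * y) ^ 2 := by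
    rw [hb]
    linear_combination -4 * y ^ 2 * r₁
  rw [e]
  have h2 : (2 : K) ≠ 0 := by
    have := (_root_.map_ne_zero (algebraMap F K)).mpr S.two
    rwa [map_ofNat] at this
  exact mul_ne_zero hx (pow_ne_zero _ (mul_ne_zero h2 (S.yOf_ne_zero hc)))

theorem triD_ne_zero {h : Line F} {c : ZMod p} (hc : h.Contains (S.pt c)) :
    triD A B h ≠ 0 := by
  have h0 := S.ne_zero_of_contains hc
  have hs := S.s_ne_zero
  have h3 : (3 : K) ≠ 0 := by
    have := (_root_.map_ne_zero (algebraMap F K)).mpr S.three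
    rwa [map_ofNat] at this
  obtain ⟨e₁, e₂, e₃⟩ := S.vieta hc
  have key := triD_eq_prod h3 e₁ e₂ e₃
  have y₀ := (contains_iff.mp hc).2
  have y₁ := (contains_iff.mp (S.contains_pow hc 1)).2
  have y₂ := (contains_iff.mp (S.contains_pow hc 2)).2
  rw [pow_one] at y₁
  rw [pow_two, mul_assoc] at y₂
  change _ = (h.map K).a1 * _ + (h.map K).a0 at y₀ y₁ y₂
  rw [← y₀, ← y₁, ← y₂, ← (map_tri A B h).1] at key
  intro h0'
  rw [h0', map_zero, mul_zero] at key
  exact mul_ne_zero (mul_ne_zero (S.division_ne_zero h0)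
    (S.division_ne_zero (mul_ne_zero hs h0)))
    (S.division_ne_zero (mul_ne_zero hs (mul_ne_zero hs h0))) key.symm

theorem triple_eq {h : Line F} {c : ZMod p} (hc : h.Contains (S.pt c)) :
    ∃ g, triple A B h = some g ∧ g.Contains (S.pt (3 * c)) := by
  have hD := S.triD_ne_zero hc
  have h0 := S.ne_zero_of_contains hc
  refine ⟨_, by rw [triple, if_neg hD], ?_⟩
  have h2c := S.pt_ne_zero (mul_ne_zero S.two' h0)
  have h3c := S.pt_ne_zero (mul_ne_zero S.three' h0)
  have e₀ : S.pt c + S.pt c = S.pt (2 * c) := by rw [two_mul, map_add]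
  have e₁ : S.pt c + S.pt (2 * c) = S.pt (3 * c) := by rw [← map_add]; congr 1; ring
  have h2 : (2 : K) ≠ 0 := by
    have := (_root_.map_ne_zero (algebraMap F K)).mpr S.two
    rwa [map_ofNat] at this
  have h3 : (3 : K) ≠ 0 := by
    have := (_root_.map_ne_zero (algebraMap F K)).mpr S.three
    rwa [map_ofNat] at this
  obtain ⟨l, r₁, r₂, -, r₄⟩ := TraceZero.exists_slope (S.pt_ne_zero h0) (S.pt_ne_zero h0)
    (by rw [e₀]; exact h2c)
  obtain ⟨m, t₁, t₂, t₃, -⟩ := TraceZero.exists_slope (S.pt_ne_zero h0) h2c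
    (by rw [e₁]; exact h3c)
  rw [e₀] at r₁ r₂ r₄
  rw [e₁] at t₁ t₂ t₃
  have key := tri_eval h2 h3 (h := h.map K) r₁ r₂ r₄ (yOf_sq (S.pt_ne_zero h0)) t₁ t₂ t₃
    (contains_iff.mp hc).2
  rw [← (map_tri A B h).1, ← (map_tri A B h).2.1, ← (map_tri A B h).2.2] at key
  refine contains_iff.mpr ⟨h3c, ?_⟩
  have hD' : algebraMap F K (triD A B h) ≠ 0 := (_root_.map_ne_zero _).mpr hD
  rw [map_div₀, map_div₀]
  field_simp
  linear_combination key

end Param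

end TraceZero

namespace TraceZero

/-! ### Zeros of `S₁ + y S₂` and roots of its norm. -/

section Zeros

variable {F K : Type*} [Field F] [Field K] [Algebra F K] {A B : F}

/-- The value of the function `S₁ + y S₂` at a point. -/
noncomputable def SPoly.val (T : SPoly F) (Q : Pts K A B) : K :=
  aeval (xOf Q) T.fst + yOf Q * aeval (xOf Q) T.snd

theorem aeval_sigma (T : SPoly F) {Q : Pts K A B} (hQ : Q ≠ 0) :
    aeval (xOf Q) (sigma A B T) =
      (yOf Q * aeval (xOf Q) T.snd - aeval (xOf Q) T.fst) * T.val Q := by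
  have := yOf_sq hQ
  simp only [sigma, SPoly.val, map_sub, map_mul, map_add, map_pow, aeval_X, aeval_C]
  rw [← this]
  ring

/-- The values at `Q` and `-Q` are `S₁ ± y S₂`; take their sum and difference. -/
theorem aeval_eq_zero_of_val_neg (h2 : (2 : K) ≠ 0) (T : SPoly F) {Q : Pts K A B}
    (hy : yOf Q ≠ 0) (h₁ : T.val Q = 0) (h₂ : T.val (-Q) = 0) :
    aeval (xOf Q) T.fst = 0 ∧ aeval (xOf Q) T.snd = 0 := by
  simp only [SPoly.val, xOf_neg, yOf_neg] at h₁ h₂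
  constructor
  · apply (mul_eq_zero.mp (_ : (2 : K) * _ = 0)).resolve_left h2
    linear_combination h₁ + h₂
  · apply (mul_eq_zero.mp (_ : (2 * yOf Q) * _ = 0)).resolve_left (mul_ne_zero h2 hy)
    linear_combination h₁ - h₂

/-- The `x`-coordinates of zeros of `S` are roots of `f S₂² - S₁²`, with multiplicities. -/
theorem map_xOf_le_roots [DecidableEq K] (h2 : (2 : K) ≠ 0) {T : SPoly F}
    (hT : sigma A B T ≠ 0) (Z : Finset (Pts K A B))
    (hZ : ∀ Q ∈ Z, Q ≠ 0 ∧ T.val Q = 0) :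
    Z.val.map xOf ≤ ((sigma A B T).map (algebraMap F K)).roots := by
  classical
  have hT' : (sigma A B T).map (algebraMap F K) ≠ 0 :=
    (Polynomial.map_ne_zero_iff (algebraMap F K).injective).mpr hT
  rw [Multiset.le_iff_count]
  intro x₀
  rw [count_roots, Multiset.count_map]
  change (Z.filter (fun Q => x₀ = xOf Q)).card ≤ _
  set Y := Z.filter (fun Q => x₀ = xOf Q) with hY
  rcases Nat.lt_or_ge 1 Y.card with h | h
  -- At most two zeros share an abscissa, and two must be `Q` and `-Q`. Then `S₁` and `S₂` both
  -- vanish at `x₀`, so `(X - x₀)²` divides both terms of the norm.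
  · obtain ⟨Q, hQ, R, hR, hne⟩ := Finset.one_lt_card.mp h
    rw [hY, Finset.mem_filter] at hQ hR
    have hQ0 := (hZ Q hQ.1).1
    have key : ∀ R' ∈ Y, R' = Q ∨ R' = -Q := fun R' hR' => by
      rw [hY, Finset.mem_filter] at hR'
      exact eq_or_eq_neg_of_xOf_eq (hZ R' hR'.1).1 hQ0 (hR'.2.symm.trans hQ.2)
    have hRQ : R = -Q :=
      (key R (by rw [hY, Finset.mem_filter]; exact hR)).resolve_left (Ne.symm hne)
    have hy : yOf Q ≠ 0 := fun h0 => hne <| by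
      rw [hRQ]
      exact Pts.ext' hQ0 (neg_ne_zero.mpr hQ0) (xOf_neg Q).symm (by rw [yOf_neg, h0, neg_zero])
    obtain ⟨h₁, h₂⟩ := aeval_eq_zero_of_val_neg h2 T hy (hZ Q hQ.1).2
      (by rw [← hRQ]; exact (hZ R hR.1).2)
    have hle : Y.card ≤ 2 := by
      refine (Finset.card_le_card (t := {Q, -Q}) fun R' hR' => ?_).trans Finset.card_le_two
      simpa using key R' hR'
    refine hle.trans ((le_rootMultiplicity_iff hT').mpr ?_)
    rw [← hQ.2] at h₁ h₂
    rw [← eval_map_algebraMap, ← IsRoot.def, ← dvd_iff_isRoot] at h₁ h₂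
    simp only [sigma, Polynomial.map_sub, Polynomial.map_mul, Polynomial.map_pow]
    exact dvd_sub ((pow_dvd_pow_of_dvd h₂ 2).mul_left _) (pow_dvd_pow_of_dvd h₁ 2)
  · rcases Nat.eq_zero_or_pos Y.card with h0 | h0
    · rw [h0]; exact Nat.zero_le _
    · refine h.trans ?_
      obtain ⟨Q, hQ⟩ := Finset.card_pos.mp h0
      rw [hY, Finset.mem_filter] at hQ
      rw [Nat.succ_le_iff, rootMultiplicity_pos hT', IsRoot.def, eval_map_algebraMap, hQ.2,
        aeval_sigma T (hZ Q hQ.1).1, (hZ Q hQ.1).2, mul_zero]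

end Zeros

/-! ### The linear system as a divisibility condition. -/

section LinearSystem

variable {F : Type*} [Field F]

theorem eq_of_monic_natDegree_three {W : F[X]} (hW : W.Monic) (h : W.natDegree = 3) :
    W = X ^ 3 + C (W.coeff 2) * X ^ 2 + C (W.coeff 1) * X + C (W.coeff 0) := by
  have h3 : W.coeff 3 = 1 := by rw [← h]; exact hW
  conv_lhs => rw [W.as_sum_range_C_mul_X_pow' (show W.natDegree < 4 by omega)]
  simp only [Finset.sum_range_succ, Finset.sum_range_zero, h3, C_1]
  ring

theorem eq_of_natDegree_le_four {R : F[X]} (h : R.natDegree ≤ 4) :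
    R = C (R.coeff 4) * X ^ 4 + C (R.coeff 3) * X ^ 3 + C (R.coeff 2) * X ^ 2 +
      C (R.coeff 1) * X + C (R.coeff 0) := by
  conv_lhs => rw [R.as_sum_range_C_mul_X_pow' (Nat.lt_succ_of_le h)]
  simp only [Finset.sum_range_succ, Finset.sum_range_zero]
  ring

/-- Divide `γ S₂ + S₁` by `W`, with quotient `d₁ X + d₀` and remainder `r₂, r₁, r₀`. The first row
is `r₀ = 0`; the other two are `w₀ r₂ = 0` and `w₀ r₁ = 0` after `w₀ d₀` is replaced by the constant
coefficient of the dividend. Recovering the remainder therefore needs `w₀ ≠ 0`. -/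
theorem isSolution_iff {W : F[X]} {T : SPoly F} {g : Line F} (hW : W.Monic)
    (hW3 : W.natDegree = 3) (hW0 : W.coeff 0 ≠ 0) (h₂ : T.snd.Monic) (h₂' : T.snd.natDegree = 3)
    (h₁ : T.fst.natDegree ≤ 4) :
    IsSolution W T g ↔ W ∣ (C g.a1 * X + C g.a0) * T.snd + T.fst := by
  have eW := eq_of_monic_natDegree_three hW hW3
  have e₂ := eq_of_monic_natDegree_three h₂ h₂'
  have e₁ := eq_of_natDegree_le_four h₁
  simp only [IsSolution]
  set w := W.coeff
  set a := T.fst.coeff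
  set b := T.snd.coeff
  set d₁ := g.a1 + a 4 with hd₁
  set d₀ := g.a0 + g.a1 * b 2 + a 3 - d₁ * w 2 with hd₀
  set r₂ := g.a0 * b 2 + g.a1 * b 1 + a 2 - d₁ * w 1 - d₀ * w 2 with hr₂
  set r₁ := g.a0 * b 1 + g.a1 * b 0 + a 1 - d₁ * w 0 - d₀ * w 1 with hr₁
  set r₀ := g.a0 * b 0 + a 0 - d₀ * w 0 with hr₀
  have key : (C g.a1 * X + C g.a0) * T.snd + T.fst =
      W * (C d₁ * X + C d₀) + (C r₂ * X ^ 2 + C r₁ * X + C r₀) := by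
    rw [eW, e₂, e₁]
    simp only [hr₂, hr₁, hr₀, hd₀, hd₁, map_add, map_sub, map_mul]
    ring
  have hdvd : W ∣ (C g.a1 * X + C g.a0) * T.snd + T.fst ↔ r₂ = 0 ∧ r₁ = 0 ∧ r₀ = 0 := by
    rw [key, dvd_add_right (dvd_mul_right _ _)]
    constructor
    · intro h
      have h0 : C r₂ * X ^ 2 + C r₁ * X + C r₀ = 0 := by
        refine eq_zero_of_dvd_of_natDegree_lt h ?_
        rw [hW3]
        exact (natDegree_quadratic_le).trans_lt (by norm_num)
      refine ⟨?_, ?_, ?_⟩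
      · simpa [coeff_X, coeff_C] using congrArg (fun q => q.coeff 2) h0
      · simpa [coeff_X, coeff_C] using congrArg (fun q => q.coeff 1) h0
      · simpa [coeff_X, coeff_C] using congrArg (fun q => q.coeff 0) h0
    · rintro ⟨h, h', h''⟩
      rw [h, h', h'']
      simp
  rw [hdvd]
  constructor
  · rintro ⟨h, h', h''⟩
    have e0 : r₀ = 0 := by
      rw [hr₀, hd₀, hd₁]; linear_combination h
    refine ⟨?_, ?_, e0⟩
    · apply (mul_eq_zero.mp (_ : w 0 * r₂ = 0)).resolve_left hW0
      rw [hr₂]; rw [hr₀] at e0; linear_combination -h' + w 2 * e0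
    · apply (mul_eq_zero.mp (_ : w 0 * r₁ = 0)).resolve_left hW0
      rw [hr₁]; rw [hr₀] at e0; linear_combination -h'' + w 1 * e0
  · rintro ⟨h, h', h''⟩
    rw [hr₂] at h
    rw [hr₁] at h'
    rw [hr₀] at h''
    refine ⟨?_, ?_, ?_⟩
    · rw [hd₀, hd₁] at h''; linear_combination h''
    · linear_combination -w 0 * h + w 2 * h''
    · linear_combination -w 0 * h' + w 1 * h''

end LinearSystem

/-! ### Degrees of `S` and of its norm. -/

section SPolyFacts

variable {F : Type*} [Field F]

theorem natDegree_fst_le (A B : F) (h k : Line F) : (sPoly A B h k).fst.natDegree ≤ 4 := by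
  simp only [sPoly]
  compute_degree

theorem snd_monic {A B : F} {h k : Line F} (h0 : coefB3 A B h k ≠ 0) :
    (sPoly A B h k).snd.Monic ∧ (sPoly A B h k).snd.natDegree = 3 := by
  have e : (sPoly A B h k).snd = X ^ 3 + C ((coefB3 A B h k)⁻¹ * coefB2 A B h k) * X ^ 2 +
      C ((coefB3 A B h k)⁻¹ * coefB1 A B h k) * X +
      C ((coefB3 A B h k)⁻¹ * coefB0 A B h k) := by
    have : (C (coefB3 A B h k)⁻¹ * C (coefB3 A B h k) : F[X]) = 1 := by
      rw [← C_mul, inv_mul_cancel₀ h0, C_1]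
    simp only [sPoly, if_neg h0, map_mul]
    linear_combination X ^ 3 * this
  rw [e]
  constructor
  · monicity!
  · compute_degree!

theorem sigma_degree {A B : F} {T : SPoly F} (h₂ : T.snd.Monic) (h₂' : T.snd.natDegree = 3)
    (h₁ : T.fst.natDegree ≤ 4) : sigma A B T ≠ 0 ∧ (sigma A B T).natDegree = 9 := by
  have hf : (X ^ 3 + C A * X + C B : F[X]).Monic := by monicity!
  have hf' : (X ^ 3 + C A * X + C B : F[X]).natDegree = 3 := by compute_degree!
  have h₃ : ((X ^ 3 + C A * X + C B) * T.snd ^ 2).natDegree = 9 := by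
    rw [hf.natDegree_mul (h₂.pow 2), h₂.natDegree_pow, hf', h₂']
  have h₄ : (T.fst ^ 2).natDegree < ((X ^ 3 + C A * X + C B) * T.snd ^ 2).natDegree := by
    rw [h₃]
    exact (natDegree_pow_le_of_le 2 h₁).trans_lt (by norm_num)
  have h₅ : (sigma A B T).natDegree = 9 := by
    rw [sigma, natDegree_sub_eq_left_of_natDegree_lt h₄, h₃]
  exact ⟨fun h => by rw [h] at h₅; simp at h₅, h₅⟩

end SPolyFacts

end TraceZero

namespace TraceZero

/-! ### The nine zeros attached to a generic pair of lines. -/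

namespace Param

variable {F K : Type*} [Field F] [Fintype F] [Field K] [Algebra F K] [DecidableEq K]
  {A B : F} {p : ℕ} [Fact p.Prime] {s : ZMod p} (S : Param K A B s)

theorem two_ne_zero (S : Param K A B s) : (2 : K) ≠ 0 := by
  have := (_root_.map_ne_zero (algebraMap F K)).mpr S.two
  rwa [map_ofNat] at this

open Classical in
theorem val_sPoly {h k : Line F} {c d : ZMod p} (hc : h.Contains (S.pt c))
    (kd : k.Contains (S.pt d)) (hcd : c + d ≠ 0) : (sPoly A B h k).val (S.pt (c + d)) = 0 := by
  obtain ⟨hc0, hc⟩ := contains_iff.mp hc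
  obtain ⟨kd0, kd⟩ := contains_iff.mp kd
  have hcd0 := S.pt_ne_zero hcd
  rw [map_add] at hcd0 ⊢
  obtain ⟨l, r₁, r₂, r₃, r₄⟩ := TraceZero.exists_slope hc0 kd0 hcd0
  have key := coef_eval_eq_zero (h := h.map K) (k := k.map K) r₁ r₂ r₃ r₄ (yOf_sq hcd0) hc kd
  obtain ⟨a₄, a₃, a₂, a₁, a₀⟩ := map_coef (K := K) A B h k
  obtain ⟨b₃, b₂, b₁, b₀⟩ := map_coefB (K := K) A B h k
  rw [← a₄, ← a₃, ← a₂, ← a₁, ← a₀, ← b₃, ← b₂, ← b₁, ← b₀] at key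
  simp only [SPoly.val, sPoly, map_mul, map_add, map_pow, aeval_X, aeval_C]
  linear_combination algebraMap F K (if coefB3 A B h k = 0 then 1 else (coefB3 A B h k)⁻¹) * key

/-- Two lines of the points `c` and `d`, which are different and not opposite to each other. -/
structure Generic (S : Param K A B s) (h k : Line F) (c d : ZMod p) : Prop where
  left : h.Contains (S.pt c)
  right : k.Contains (S.pt d)
  ne : h ≠ k
  ne_neg : h ≠ k.neg

namespace Generic

variable {S} {h k : Line F} {c d : ZMod p} (G : S.Generic h k c d)

include G

theorem ne_pow (j : ℕ) : d ≠ s ^ j * c := fun hd =>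
  G.ne (S.line_unique (S.contains_pow G.left j) (hd ▸ G.right))

theorem ne_neg_pow (j : ℕ) : d ≠ -(s ^ j * c) := fun hd =>
  G.ne_neg (S.line_unique (S.contains_pow G.left j)
    (by have := S.contains_neg G.right; rwa [hd, neg_neg] at this))

theorem add_ne_zero (i j : ℕ) : s ^ i * c + s ^ j * d ≠ 0 := fun h0 => by
  -- As `s³ = 1`, the factor `s ^ (2 * j)` inverts `s ^ j`.
  apply G.ne_neg_pow (i + 2 * j)
  have h3 : (s ^ 3) ^ j = 1 := by rw [S.s_cube, one_pow]
  rw [← pow_mul] at h3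
  linear_combination s ^ (2 * j) * h0 - d * h3

theorem val_eq_zero (i j : ℕ) : (sPoly A B h k).val (S.pt (s ^ i * c + s ^ j * d)) = 0 :=
  S.val_sPoly (S.contains_pow G.left i) (S.contains_pow G.right j) (G.add_ne_zero i j)

end Generic

theorem pow_sub_pow (S : Param K A B s) {i i' : Fin 3} (h : i ≠ i') :
    ∃ (e : ZMod p) (n : ℕ), (e = 1 ∨ e = -1) ∧
      s ^ (i : ℕ) - s ^ (i' : ℕ) = e * s ^ n * (1 - s) := by
  have hs := S.s_sq
  fin_cases i <;> fin_cases i' <;> first | exact absurd rfl h | skip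
  · exact ⟨1, 0, .inl rfl, by change s ^ 0 - s ^ 1 = _; ring⟩
  · exact ⟨-1, 2, .inr rfl, by change s ^ 0 - s ^ 2 = _; linear_combination (1 - s) * hs⟩
  · exact ⟨-1, 0, .inr rfl, by change s ^ 1 - s ^ 0 = _; ring⟩
  · exact ⟨1, 1, .inl rfl, by change s ^ 1 - s ^ 2 = _; ring⟩
  · exact ⟨1, 2, .inl rfl, by change s ^ 2 - s ^ 0 = _; linear_combination -(1 - s) * hs⟩
  · exact ⟨-1, 1, .inr rfl, by change s ^ 2 - s ^ 1 = _; ring⟩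

namespace Generic

variable {S} {h k : Line F} {c d : ZMod p} (G : S.Generic h k c d)

include G

/-- Differences of distinct cube roots of unity are `± sⁿ (1 - s)`. If only one index differs, a
coincidence makes `c` or `d` zero; if both differ, cancelling `1 - s` gives `d = ± sⁿ c`, so equal
or opposite lines. -/
theorem injective : Function.Injective
    (fun i : Fin 3 × Fin 3 => s ^ (i.1 : ℕ) * c + s ^ (i.2 : ℕ) * d) := by
  have hc := S.ne_zero_of_contains G.left
  have hd := S.ne_zero_of_contains G.right
  have hs := S.s_ne_zero
  have h1 : (1 - s) ≠ 0 := sub_ne_zero.mpr S.s_ne_one.symm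
  have he : ∀ e : ZMod p, (e = 1 ∨ e = -1) → e ≠ 0 := by
    rintro e (rfl | rfl) <;> simp
  rintro ⟨i, j⟩ ⟨i', j'⟩ hij
  simp only at hij
  by_cases hi : i = i' <;> by_cases hj : j = j'
  · rw [hi, hj]
  · exfalso
    obtain ⟨e, n, h₁, h₂⟩ := S.pow_sub_pow hj
    have : e * s ^ n * (1 - s) * d = 0 := by
      rw [← h₂]; rw [hi] at hij; linear_combination hij
    exact mul_ne_zero (mul_ne_zero (mul_ne_zero (he e h₁) (pow_ne_zero n hs)) h1) hd this
  · exfalso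
    obtain ⟨e, n, h₁, h₂⟩ := S.pow_sub_pow hi
    have : e * s ^ n * (1 - s) * c = 0 := by
      rw [← h₂]; rw [hj] at hij; linear_combination hij
    exact mul_ne_zero (mul_ne_zero (mul_ne_zero (he e h₁) (pow_ne_zero n hs)) h1) hc this
  · exfalso
    obtain ⟨e, n, h₁, h₂⟩ := S.pow_sub_pow hi
    obtain ⟨e', n', h₁', h₂'⟩ := S.pow_sub_pow (Ne.symm hj)
    have e₀ : e * s ^ n * c = e' * s ^ n' * d := by
      apply mul_left_cancel₀ h1
      linear_combination hij - c * h₂ + d * h₂'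
    have h3 : (s ^ 3) ^ n' = 1 := by rw [S.s_cube, one_pow]
    rw [← pow_mul] at h3
    have n₁ := G.ne_pow (n + 2 * n')
    have n₂ := G.ne_neg_pow (n + 2 * n')
    rcases h₁ with rfl | rfl <;> rcases h₁' with rfl | rfl
    · exact n₁ (by linear_combination -s ^ (2 * n') * e₀ - d * h3)
    · exact n₂ (by linear_combination s ^ (2 * n') * e₀ - d * h3)
    · exact n₂ (by linear_combination -s ^ (2 * n') * e₀ - d * h3)
    · exact n₁ (by linear_combination s ^ (2 * n') * e₀ - d * h3)

/-- The nine zeros of the function attached to two lines. -/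
theorem exists_zeros : ∃ Z : Finset (Pts K A B), Z.card = 9 ∧
    (∀ Q ∈ Z, Q ≠ 0 ∧ (sPoly A B h k).val Q = 0) ∧
    ∀ Q ∈ Z, ∃ i j : ℕ, Q = S.pt (s ^ i * c + s ^ j * d) := by
  classical
  refine ⟨Finset.univ.image
    (fun i : Fin 3 × Fin 3 => S.pt (s ^ (i.1 : ℕ) * c + s ^ (i.2 : ℕ) * d)), ?_, ?_, ?_⟩
  · exact Finset.card_image_of_injective _ (S.inj.comp G.injective)
  · intro Q hQ
    obtain ⟨i, -, rfl⟩ := Finset.mem_image.mp hQ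
    exact ⟨S.pt_ne_zero (G.add_ne_zero _ _), G.val_eq_zero _ _⟩
  · intro Q hQ
    obtain ⟨i, -, rfl⟩ := Finset.mem_image.mp hQ
    exact ⟨_, _, rfl⟩

theorem coefB3_ne_zero : coefB3 A B h k ≠ 0 := S.coefB3_ne_zero G.left G.ne_neg

theorem sigma_ne_zero : sigma A B (sPoly A B h k) ≠ 0 :=
  (sigma_degree (snd_monic G.coefB3_ne_zero).1 (snd_monic G.coefB3_ne_zero).2
    (natDegree_fst_le A B h k)).1

theorem card_roots_le :
    ((sigma A B (sPoly A B h k)).map (algebraMap F K)).roots.card ≤ 9 := by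
  refine (card_roots' _).trans ?_
  rw [natDegree_map, (sigma_degree (snd_monic G.coefB3_ne_zero).1 (snd_monic G.coefB3_ne_zero).2
    (natDegree_fst_le A B h k)).2]

/-- A tenth zero would give ten roots, with multiplicity, of a norm of degree nine. -/
theorem eq_of_val_eq_zero {a : ZMod p} (ha : a ≠ 0) (h0 : (sPoly A B h k).val (S.pt a) = 0) :
    ∃ i j : ℕ, a = s ^ i * c + s ^ j * d := by
  classical
  obtain ⟨Z, h₁, h₂, h₃⟩ := G.exists_zeros
  by_cases hZ : S.pt a ∈ Z
  · obtain ⟨i, j, hij⟩ := h₃ _ hZ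
    exact ⟨i, j, S.inj hij⟩
  · exfalso
    have := Multiset.card_le_card (map_xOf_le_roots S.two_ne_zero G.sigma_ne_zero
      (insert (S.pt a) Z) (fun Q hQ => by
        rcases Finset.mem_insert.mp hQ with rfl | hQ
        · exact ⟨S.pt_ne_zero ha, h0⟩
        · exact h₂ Q hQ))
    rw [Multiset.card_map] at this
    change (insert (S.pt a) Z).card ≤ _ at this
    rw [Finset.card_insert_of_notMem hZ, h₁] at this
    exact absurd (this.trans G.card_roots_le) (by norm_num)

theorem roots_eq : ∃ Z : Finset (Pts K A B), Z.card = 9 ∧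
    Z.val.map xOf = ((sigma A B (sPoly A B h k)).map (algebraMap F K)).roots ∧
    ∀ Q ∈ Z, ∃ i j : ℕ, Q = S.pt (s ^ i * c + s ^ j * d) := by
  obtain ⟨Z, h₁, h₂, h₃⟩ := G.exists_zeros
  refine ⟨Z, h₁, Multiset.eq_of_le_of_card_le
    (map_xOf_le_roots S.two_ne_zero G.sigma_ne_zero Z h₂) ?_, h₃⟩
  rw [Multiset.card_map]
  exact G.card_roots_le.trans h₁.ge

/-- An irreducible cubic factor of `f S₂² - S₁²` is the minimal polynomial of the
`x`-coordinate of one of the nine zeros. -/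
theorem exists_eq_minpoly {W : F[X]} (hW : Irreducible W) (hm : W.Monic)
    (hd : W ∣ sigma A B (sPoly A B h k)) :
    ∃ i j : ℕ, W = minpoly F (xOf (S.pt (s ^ i * c + s ^ j * d))) := by
  obtain ⟨Z, h₁, h₂, h₃⟩ := G.roots_eq
  -- The nine abscissas lie in `K` and exhaust the degree, so every nonconstant factor of the norm
  -- has one of them as a root.
  have hs : ((sigma A B (sPoly A B h k)).map (algebraMap F K)).Splits := by
    rw [splits_iff_card_roots, ← h₂, Multiset.card_map, natDegree_map,
      (sigma_degree (snd_monic G.coefB3_ne_zero).1 (snd_monic G.coefB3_ne_zero).2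
        (natDegree_fst_le A B h k)).2]
    exact h₁
  have hne : (sigma A B (sPoly A B h k)).map (algebraMap F K) ≠ 0 :=
    (Polynomial.map_ne_zero_iff (algebraMap F K).injective).mpr G.sigma_ne_zero
  have hWs : (W.map (algebraMap F K)).Splits := hs.of_dvd hne (Polynomial.map_dvd _ hd)
  obtain ⟨x, hx⟩ := hWs.exists_eval_eq_zero (by
    rw [degree_map]; exact hW.degree_pos.ne')
  rw [eval_map_algebraMap] at hx
  have hr : x ∈ ((sigma A B (sPoly A B h k)).map (algebraMap F K)).roots := by
    rw [mem_roots hne, IsRoot.def, eval_map_algebraMap]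
    exact aeval_eq_zero_of_dvd_aeval_eq_zero hd hx
  rw [← h₂, Multiset.mem_map] at hr
  obtain ⟨Q, hQ, rfl⟩ := hr
  obtain ⟨i, j, rfl⟩ := h₃ Q hQ
  exact ⟨i, j, minpoly.eq_of_irreducible_of_monic hW hx hm⟩

/-- The linear system determines the line of a zero of `S` from its `x`-coordinate. -/
theorem solve_eq {a : ZMod p} {g : Line F} (hg : g.Contains (S.pt a))
    (h0 : (sPoly A B h k).val (S.pt a) = 0)
    (hne : minpoly F (xOf (S.pt a)) ≠ (sPoly A B h k).snd) :
    solve (minpoly F (xOf (S.pt a))) (sPoly A B h k) = some g := by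
  have ha := S.ne_zero_of_contains hg
  have hm := monic_minpoly S.finrank (xOf (S.pt a))
  have h3 := natDegree_minpoly S.finrank (S.xOf_notMem ha)
  have hT := snd_monic G.coefB3_ne_zero
  have hc : (minpoly F (xOf (S.pt a))).coeff 0 ≠ 0 := fun h => by
    rw [coeff_zero_eq_eval_zero, S.minpoly_eq hg] at h
    exact S.not_isRoot hg 0 (by simpa using h)
  -- Two monic cubics, one dividing the other, would coincide, contrary to `hne`.
  have hS₂ : aeval (xOf (S.pt a)) (sPoly A B h k).snd ≠ 0 := fun h => by
    refine hne (Polynomial.eq_of_monic_of_dvd_of_natDegree_le hm hT.1 (minpoly.dvd _ _ h) ?_).symm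
    omega
  -- Divisibility by the minimal polynomial means `g'(x) S₂(x) + S₁(x) = 0`. Since `S₁(x) = -y
  -- S₂(x)` with `S₂(x) ≠ 0`, this is `g'(x) = y`.
  have key : ∀ g' : Line F,
      IsSolution (minpoly F (xOf (S.pt a))) (sPoly A B h k) g' ↔ g' = g := by
    intro g'
    rw [isSolution_iff hm h3 hc hT.1 hT.2 (natDegree_fst_le A B h k), minpoly.dvd_iff]
    simp only [map_add, map_mul, aeval_X, aeval_C]
    rw [SPoly.val] at h0
    constructor
    · intro h
      refine S.line_unique (contains_iff.mpr ⟨S.pt_ne_zero ha, ?_⟩) hg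
      apply mul_right_cancel₀ hS₂
      linear_combination h0 - h
    · rintro rfl
      rw [← (contains_iff.mp hg).2]
      linear_combination h0
  have hu : ∃! g', IsSolution (minpoly F (xOf (S.pt a))) (sPoly A B h k) g' :=
    ⟨g, (key g).mpr rfl, fun g' => (key g').mp⟩
  rw [solve, dif_pos hu, (key _).mp hu.choose_spec.1]

end Generic

/-- If the minimal polynomial of the `x`-coordinate of a zero is `S₂`, then the opposite point is
a zero as well. -/
theorem val_eq_zero_of_minpoly {h k : Line F} {a b : ZMod p}
    (h0 : (sPoly A B h k).val (S.pt a) = 0)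
    (hW : minpoly F (xOf (S.pt a)) = (sPoly A B h k).snd)
    (hb : aeval (xOf (S.pt b)) (minpoly F (xOf (S.pt a))) = 0) :
    (sPoly A B h k).val (S.pt b) = 0 := by
  have h₂ : aeval (xOf (S.pt a)) (sPoly A B h k).snd = 0 := by rw [← hW, minpoly.aeval]
  have h₁ : aeval (xOf (S.pt a)) (sPoly A B h k).fst = 0 := by
    rw [SPoly.val, h₂, mul_zero, add_zero] at h0
    exact h0
  rw [SPoly.val, aeval_eq_zero_of_dvd_aeval_eq_zero (minpoly.dvd _ _ h₁) hb,
    aeval_eq_zero_of_dvd_aeval_eq_zero (minpoly.dvd _ _ h₂) hb, mul_zero, add_zero]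


end Param

end TraceZero

/-! ### Correctness of the subalgorithm. -/

namespace TraceZero

theorem mem_cubicFactors {F : Type*} [Field F] {G W : F[X]} (hG : G ≠ 0) :
    W ∈ cubicFactors G ↔ Irreducible W ∧ W.Monic ∧ W ∣ G ∧ W.natDegree = 3 := by
  classical
  rw [cubicFactors, Finset.mem_toList, Finset.mem_filter, Multiset.mem_toFinset]
  constructor
  · rintro ⟨h, h3⟩
    have hi := UniqueFactorizationMonoid.irreducible_of_normalized_factor W h
    refine ⟨hi, ?_, UniqueFactorizationMonoid.dvd_of_mem_normalizedFactors h, h3⟩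
    rw [← UniqueFactorizationMonoid.normalize_normalized_factor W h]
    exact monic_normalize hi.ne_zero
  · rintro ⟨hi, hm, hd, h3⟩
    refine ⟨?_, h3⟩
    obtain ⟨q, hq, ha⟩ := UniqueFactorizationMonoid.exists_mem_normalizedFactors_of_dvd hG hi hd
    have hq' := UniqueFactorizationMonoid.irreducible_of_normalized_factor q hq
    have hqm : q.Monic := by
      rw [← UniqueFactorizationMonoid.normalize_normalized_factor q hq]
      exact monic_normalize hq'.ne_zero
    rwa [eq_of_monic_of_associated hm hqm ha]

/-- The multiples of `t` by powers of `s` are the only common elements of the two families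
`sⁱ c₁ + sʲ d₁` and `sⁱ c₂ + sʲ d₂`. -/
def OnlyCommon {p : ℕ} (s c₁ d₁ c₂ d₂ t : ZMod p) : Prop :=
  ∀ i j i' j' : ℕ, s ^ i * c₁ + s ^ j * d₁ = s ^ i' * c₂ + s ^ j' * d₂ →
    ∃ n : ℕ, s ^ i * c₁ + s ^ j * d₁ = s ^ n * t

theorem OnlyCommon.symm {p : ℕ} {s c₁ d₁ c₂ d₂ t : ZMod p} (h : OnlyCommon s c₁ d₁ c₂ d₂ t) :
    OnlyCommon s c₂ d₂ c₁ d₁ t := fun i j i' j' e => by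
  rw [e]
  exact h i' j' i j e.symm

namespace Param

variable {F K : Type*} [Field F] [Fintype F] [Field K] [Algebra F K] [DecidableEq K]
  {A B : F} {p : ℕ} [Fact p.Prime] {s : ZMod p} {S : Param K A B s}

/-- Powers of `s` have cube 1, while -1 has cube -1. This is what rules out opposite points both
lying in the orbit of `t`. -/
theorem not_pow_neg (S : Param K A B s) {t : ZMod p} (ht : t ≠ 0) (n : ℕ) : -t ≠ s ^ n * t := by
  intro h
  have h1 : s ^ n = -1 := mul_right_cancel₀ ht (by linear_combination -h)
  have h3 : (s ^ 3) ^ n = 1 := by rw [S.s_cube, one_pow]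
  rw [← pow_mul, mul_comm, pow_mul, h1] at h3
  exact S.two' (by linear_combination -h3)

/-- A factor `W ≠ S₂` belongs to a zero `a` of `S`, and the divisibility test asks whether `a` is
also a zero of `S'`; passing it puts `a` in the orbit of `t`. The induction keeps the minimal
polynomial of `x(t)` in the remaining list, so the loop cannot run out. -/
theorem factorLoop_eq {h₁ k₁ h₂ k₂ g : Line F} {c₁ d₁ c₂ d₂ t : ZMod p}
    (G₁ : S.Generic h₁ k₁ c₁ d₁) (G₂ : S.Generic h₂ k₂ c₂ d₂)
    (e₁ : c₁ + d₁ = t) (e₂ : c₂ + d₂ = t) (hc : OnlyCommon s c₁ d₁ c₂ d₂ t)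
    (hg : g.Contains (S.pt t)) (l : List F[X])
    (hl : ∀ W ∈ l, Irreducible W ∧ W.Monic ∧ W ∣ sigma A B (sPoly A B h₁ k₁) ∧
      W ∣ sigma A B (sPoly A B h₂ k₂))
    (ht : minpoly F (xOf (S.pt t)) ∈ l) :
    factorLoop (sPoly A B h₁ k₁) (sPoly A B h₂ k₂) l = some g := by
  have ht0 := S.ne_zero_of_contains hg
  have common : ∀ a : ZMod p, a ≠ 0 → (sPoly A B h₁ k₁).val (S.pt a) = 0 →
      (sPoly A B h₂ k₂).val (S.pt a) = 0 → ∃ n : ℕ, a = s ^ n * t := by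
    intro a ha z₁ z₂
    obtain ⟨i, j, rfl⟩ := G₁.eq_of_val_eq_zero ha z₁
    obtain ⟨i', j', e⟩ := G₂.eq_of_val_eq_zero ha z₂
    exact hc i j i' j' e
  have vt₁ : (sPoly A B h₁ k₁).val (S.pt t) = 0 := by
    have := G₁.val_eq_zero 0 0
    rwa [pow_zero, one_mul, one_mul, e₁] at this
  have vt₂ : (sPoly A B h₂ k₂).val (S.pt t) = 0 := by
    have := G₂.val_eq_zero 0 0
    rwa [pow_zero, one_mul, one_mul, e₂] at this
  induction l with
  | nil => simp at ht
  | cons W l ih =>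
    obtain ⟨hi, hm, w₁, w₂⟩ := hl W List.mem_cons_self
    rw [factorLoop]
    by_cases hW : W = (sPoly A B h₁ k₁).snd
    -- Here `W = S₂` divides the norm, hence divides `S₁`, so `a` and `-a` are both zeros of `S`.
    · rw [if_neg (not_not.mpr hW)]
      obtain ⟨i, j, rfl⟩ := G₂.exists_eq_minpoly hi hm w₂
      have v₂ := G₂.val_eq_zero i j
      have ha := G₂.add_ne_zero i j
      set a := s ^ i * c₂ + s ^ j * d₂
      have h2 : aeval (xOf (S.pt a)) (sPoly A B h₁ k₁).snd = 0 := by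
        rw [← hW, minpoly.aeval]
      have h1 : aeval (xOf (S.pt a)) (sPoly A B h₁ k₁).fst = 0 := by
        have := minpoly.dvd_iff.mp w₁
        rw [sigma, map_sub, map_mul, map_pow, map_pow, h2] at this
        exact pow_eq_zero_iff (n := 2) (by norm_num) |>.mp (by linear_combination -this)
      have v₁ : (sPoly A B h₁ k₁).val (S.pt a) = 0 := by
        rw [SPoly.val, h1, h2, mul_zero, add_zero]
      obtain ⟨n, hn⟩ := common a ha v₁ v₂
      -- If `W` were also the second component of `S'`, then `a` and `-a` would both be common
      -- zeros, hence both in the orbit of `t`.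
      refine G₂.solve_eq (hn ▸ S.contains_pow hg n) v₂ fun hW₂ => ?_
      have ex : xOf (S.pt (-a)) = xOf (S.pt a) := by rw [map_neg, xOf_neg]
      have v₁' := S.val_eq_zero_of_minpoly (b := -a) v₁ hW (by rw [ex, minpoly.aeval])
      have v₂' := S.val_eq_zero_of_minpoly (b := -a) v₂ hW₂ (by rw [ex, minpoly.aeval])
      obtain ⟨n', hn'⟩ := common (-a) (neg_ne_zero.mpr ha) v₁' v₂'
      have h3 : (s ^ 3) ^ n = 1 := by rw [S.s_cube, one_pow]
      rw [← pow_mul] at h3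
      refine S.not_pow_neg ha (n' + 2 * n) ?_
      linear_combination hn' - s ^ (n' + 2 * n) * hn - s ^ n' * t * h3
    · rw [if_pos hW]
      obtain ⟨i, j, rfl⟩ := G₁.exists_eq_minpoly hi hm w₁
      have v₁ := G₁.val_eq_zero i j
      have ha := G₁.add_ne_zero i j
      set a := s ^ i * c₁ + s ^ j * d₁
      obtain ⟨g', hg'⟩ := S.exists_line ha
      rw [G₁.solve_eq hg' v₁ hW, Option.bind_some]
      have hiff : minpoly F (xOf (S.pt a)) ∣
          (C g'.a1 * X + C g'.a0) * (sPoly A B h₂ k₂).snd + (sPoly A B h₂ k₂).fst ↔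
          (sPoly A B h₂ k₂).val (S.pt a) = 0 := by
        rw [minpoly.dvd_iff]
        simp only [map_add, map_mul, aeval_X, aeval_C]
        rw [← (contains_iff.mp hg').2, SPoly.val, add_comm]
      by_cases hv : (sPoly A B h₂ k₂).val (S.pt a) = 0
      · rw [if_pos (hiff.mpr hv)]
        obtain ⟨n, hn⟩ := common a ha v₁ hv
        have hg₁ : g'.Contains (S.pt (s ^ n * t)) := by rw [← hn]; exact hg'
        exact congrArg some (S.line_unique hg₁ (S.contains_pow hg n))
      · rw [if_neg (fun h => hv (hiff.mp h))]
        refine ih (fun W hW => hl W (List.mem_cons_of_mem _ hW)) ?_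
        -- A rejected `W` is not the polynomial of `x(t)`: otherwise `a = sⁿ t`, which passes the
        -- test, or `a = -sⁿ t`, in which case `S` vanishes at both `a` and `-a` and `W = S₂`.
        refine (List.mem_cons.mp ht).resolve_left fun hta => ?_
        have hroot : aeval (xOf (S.pt a)) (minpoly F (xOf (S.pt t))) = 0 := by
          rw [hta, minpoly.aeval]
        obtain ⟨n, hn | hn⟩ := S.exists_of_aeval_minpoly ht0 ha hroot
        · apply hv
          have := G₂.val_eq_zero n n
          rwa [← mul_add, e₂, ← hn] at this
        · have v₁' : (sPoly A B h₁ k₁).val (S.pt (-a)) = 0 := by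
            have := G₁.val_eq_zero n n
            rw [← mul_add, e₁] at this
            rwa [hn, neg_neg]
          have hy := S.yOf_ne_zero ha
          rw [map_neg] at v₁'
          obtain ⟨-, z⟩ := aeval_eq_zero_of_val_neg S.two_ne_zero _ hy v₁ v₁'
          apply hW
          refine (Polynomial.eq_of_monic_of_dvd_of_natDegree_le hm
            (snd_monic G₁.coefB3_ne_zero).1 (minpoly.dvd _ _ z) ?_).symm
          rw [(snd_monic G₁.coefB3_ne_zero).2, natDegree_minpoly S.finrank (S.xOf_notMem ha)]

theorem sPoly_neg {h : Line F} {c d : ZMod p} (hc : h.Contains (S.pt c))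
    (hd : h.neg.Contains (S.pt d)) (hcd : c + d ≠ 0) :
    toMonic (sPoly A B h h.neg).fst = minpoly F (xOf (S.pt (c + d))) ∧
      (sPoly A B h h.neg).snd = 0 := by
  obtain ⟨b₃, b₂, b₁, b₀, a₄, a₃⟩ := coef_neg A B h
  have h₂ : (sPoly A B h h.neg).snd = 0 := by
    simp only [sPoly, b₃, b₂, b₁, b₀]
    simp
  have h₁ : (sPoly A B h h.neg).fst = C (coefA3 A B h h.neg) * X ^ 3 +
      C (coefA2 A B h h.neg) * X ^ 2 + C (coefA1 A B h h.neg) * X + C (coefA0 A B h h.neg) := by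
    simp only [sPoly, b₃, a₄]
    simp
  have h0 := S.ne_zero_of_contains hc
  have hs := S.s_ne_zero
  have hne : coefA3 A B h h.neg ≠ 0 := by
    obtain ⟨e₁, e₂, e₃⟩ := S.vieta hc
    have ha := (coef_neg (algebraMap F K A) (algebraMap F K B) (h.map K)).2.2.2.2.2
    rw [discr_eq e₁ e₂ e₃] at ha
    have hm := (map_coef (K := K) A B h h.neg).2.1
    have hn : (h.map K).neg = h.neg.map K := by simp [Line.neg, Line.map]
    rw [← hn, ha] at hm
    have n₁ := S.xOf_ne h0
    have n₂ := S.xOf_ne (mul_ne_zero hs h0)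
    have n₃ := S.xOf_ne (mul_ne_zero hs (mul_ne_zero hs h0))
    have e : s * (s * (s * c)) = c := by linear_combination c * S.s_cube
    rw [e] at n₃
    intro hz
    rw [hz, map_zero, eq_comm, neg_eq_zero] at hm
    exact pow_ne_zero 2 (mul_ne_zero (mul_ne_zero (sub_ne_zero.mpr n₁)
      (sub_ne_zero.mpr n₃.symm)) (sub_ne_zero.mpr n₂)) hm
  have hdeg : (sPoly A B h h.neg).fst.natDegree = 3 := by
    rw [h₁]; exact natDegree_cubic hne
  have hv : aeval (xOf (S.pt (c + d))) (sPoly A B h h.neg).fst = 0 := by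
    have := S.val_sPoly hc hd hcd
    rwa [SPoly.val, h₂, map_zero, mul_zero, add_zero] at this
  have hf0 : (sPoly A B h h.neg).fst ≠ 0 := fun h => by rw [h] at hdeg; simp at hdeg
  have hlc := leadingCoeff_ne_zero.mpr hf0
  refine ⟨?_, h₂⟩
  refine Polynomial.eq_of_monic_of_dvd_of_natDegree_le (monic_minpoly S.finrank _) ?_
    (minpoly.dvd _ _ ?_) ?_
  · rw [toMonic, mul_comm]
    exact monic_mul_leadingCoeff_inv hf0
  · rw [toMonic, map_mul, hv, mul_zero]
  · rw [toMonic, natDegree_C_mul (inv_ne_zero hlc), hdeg,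
      natDegree_minpoly S.finrank (S.xOf_notMem hcd)]

/-- For opposite lines the sums `sⁱ c + sʲ d` include `-t` as well as `t`. Were `W` the second
component of `S'`, then `-t` would be a zero of `S'` too, hence a common element outside the orbit
of `t`. -/
theorem solve_of_neg {h h₂ k₂ g : Line F} {c d c₂ d₂ t : ZMod p} (hc : h.Contains (S.pt c))
    (hd : h.neg.Contains (S.pt d)) (G₂ : S.Generic h₂ k₂ c₂ d₂)
    (e₁ : c + d = t) (e₂ : c₂ + d₂ = t) (hcom : OnlyCommon s c d c₂ d₂ t)
    (hg : g.Contains (S.pt t)) :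
    solve (toMonic (sPoly A B h h.neg).fst) (sPoly A B h₂ k₂) = some g := by
  have ht0 := S.ne_zero_of_contains hg
  have hdc : ∃ j : ℕ, d = -(s ^ j * c) := by
    have := S.contains_neg hc
    obtain ⟨j, hj⟩ := S.exists_of_contains this hd
    exact ⟨j, by rw [hj]; ring⟩
  obtain ⟨j, hj⟩ := hdc
  rw [(sPoly_neg hc hd (e₁ ▸ ht0)).1, e₁]
  have vt₂ : (sPoly A B h₂ k₂).val (S.pt t) = 0 := by
    have := G₂.val_eq_zero 0 0
    rwa [pow_zero, one_mul, one_mul, e₂] at this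
  refine G₂.solve_eq hg vt₂ fun hW => ?_
  have ex : xOf (S.pt (-t)) = xOf (S.pt t) := by rw [map_neg, xOf_neg]
  have v' := S.val_eq_zero_of_minpoly (b := -t) vt₂ hW (by rw [ex, minpoly.aeval])
  obtain ⟨i', j', e'⟩ := G₂.eq_of_val_eq_zero (neg_ne_zero.mpr ht0) v'
  have h3 : (s ^ 3) ^ j = 1 := by rw [S.s_cube, one_pow]
  rw [← pow_mul] at h3
  have e : s ^ j * c + s ^ (2 * j) * d = -t := by
    rw [← e₁, hj]
    linear_combination -c * h3
  obtain ⟨n, hn⟩ := hcom j (2 * j) i' j' (e.trans e')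
  exact S.not_pow_neg ht0 n (e ▸ hn)

open Classical in
/-- Correctness of the subalgorithm. -/
theorem subalg_eq {h₁ k₁ h₂ k₂ g : Line F} {c₁ d₁ c₂ d₂ t : ZMod p}
    (hc₁ : h₁.Contains (S.pt c₁)) (kd₁ : k₁.Contains (S.pt d₁))
    (hc₂ : h₂.Contains (S.pt c₂)) (kd₂ : k₂.Contains (S.pt d₂))
    (n₁ : c₁ ≠ d₁) (n₂ : c₂ ≠ d₂) (e₁ : c₁ + d₁ = t) (e₂ : c₂ + d₂ = t)
    (hcom : OnlyCommon s c₁ d₁ c₂ d₂ t) (hg : g.Contains (S.pt t)) :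
    subalg A B h₁ k₁ h₂ k₂ = some g := by
  have ht0 := S.ne_zero_of_contains hg
  -- Distinct points of one line are two conjugates, whose sum is minus the third.
  have same : ∀ {h : Line F} {c d : ZMod p}, h.Contains (S.pt c) → h.Contains (S.pt d) →
      c ≠ d → c + d = t → h.neg = g := by
    intro h c d hc hd hne he
    obtain ⟨j, hj⟩ := S.exists_of_contains hc hd
    have hn := S.contains_neg hc
    have hs := S.s_sq
    have h3 := S.s_cube
    have key : ∃ n : ℕ, t = s ^ n * -c := by
      have hp : s ^ j = s ^ (j % 3) := by
        conv_lhs => rw [← Nat.div_add_mod j 3, pow_add, pow_mul, h3, one_pow, one_mul]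
      rw [hp] at hj
      have : j % 3 < 3 := Nat.mod_lt _ (by norm_num)
      interval_cases j % 3
      · exact absurd (by rw [hj]; ring) hne
      · exact ⟨2, by rw [← he, hj]; linear_combination c * hs⟩
      · exact ⟨1, by rw [← he, hj]; linear_combination c * hs⟩
    obtain ⟨n, hn'⟩ := key
    exact S.line_unique (hn' ▸ S.contains_pow hn n) hg
  rw [subalg]
  by_cases q₁ : h₁ = k₁
  · rw [if_pos q₁, same hc₁ (q₁ ▸ kd₁) n₁ e₁]
  rw [if_neg q₁]
  by_cases q₂ : h₂ = k₂
  · rw [if_pos q₂, same hc₂ (q₂ ▸ kd₂) n₂ e₂]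
  rw [if_neg q₂]
  have negneg : ∀ k : Line F, k.neg.neg = k := fun k => by simp [Line.neg]
  dsimp only
  by_cases q₃ : h₁ = k₁.neg
  · rw [if_pos q₃]
    obtain rfl : k₁ = h₁.neg := by rw [q₃, negneg]
    by_cases q₄ : h₂ = k₂.neg
    -- If both pairs were opposite, `-t` would belong to both families.
    · exfalso
      obtain rfl : k₂ = h₂.neg := by rw [q₄, negneg]
      have aux : ∀ {h : Line F} {c d : ZMod p}, h.Contains (S.pt c) → h.neg.Contains (S.pt d) →
          c + d = t → ∃ i j : ℕ, s ^ i * c + s ^ j * d = -t := by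
        intro h c d hc hd he
        obtain ⟨j, hj⟩ := S.exists_of_contains (S.contains_neg hc) hd
        have h3 : (s ^ 3) ^ j = 1 := by rw [S.s_cube, one_pow]
        rw [← pow_mul] at h3
        exact ⟨j, 2 * j, by rw [← he, hj]; linear_combination -c * h3⟩
      obtain ⟨i, j, e⟩ := aux hc₁ kd₁ e₁
      obtain ⟨i', j', e'⟩ := aux hc₂ kd₂ e₂
      obtain ⟨n, hn⟩ := hcom i j i' j' (e.trans e'.symm)
      exact S.not_pow_neg ht0 n (e ▸ hn)
    · exact solve_of_neg hc₁ kd₁ ⟨hc₂, kd₂, q₂, q₄⟩ e₁ e₂ hcom hg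
  rw [if_neg q₃]
  have G₁ : S.Generic h₁ k₁ c₁ d₁ := ⟨hc₁, kd₁, q₁, q₃⟩
  by_cases q₄ : h₂ = k₂.neg
  · rw [if_pos q₄]
    obtain rfl : k₂ = h₂.neg := by rw [q₄, negneg]
    exact solve_of_neg hc₂ kd₂ G₁ e₂ e₁ hcom.symm hg
  rw [if_neg q₄]
  have G₂ : S.Generic h₂ k₂ c₂ d₂ := ⟨hc₂, kd₂, q₂, q₄⟩
  have hgcd : EuclideanDomain.gcd (sigma A B (sPoly A B h₁ k₁)) (sigma A B (sPoly A B h₂ k₂)) ≠ 0 :=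
    fun h => G₁.sigma_ne_zero (EuclideanDomain.gcd_eq_zero_iff.mp h).1
  refine factorLoop_eq G₁ G₂ e₁ e₂ hcom hg _ (fun W hW => ?_) ?_
  · obtain ⟨hi, hm, hd, -⟩ := (mem_cubicFactors hgcd).mp hW
    exact ⟨hi, hm, hd.trans (EuclideanDomain.gcd_dvd_left _ _),
      hd.trans (EuclideanDomain.gcd_dvd_right _ _)⟩
  · have root : ∀ {h k : Line F} {c d : ZMod p}, S.Generic h k c d → c + d = t →
        minpoly F (xOf (S.pt t)) ∣ sigma A B (sPoly A B h k) := by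
      intro h k c d G e
      have := G.val_eq_zero 0 0
      rw [pow_zero, one_mul, one_mul, e] at this
      refine minpoly.dvd _ _ ?_
      rw [aeval_sigma _ (S.pt_ne_zero ht0), this, mul_zero]
    exact (mem_cubicFactors hgcd).mpr ⟨irreducible_minpoly S.finrank _,
      monic_minpoly S.finrank _, EuclideanDomain.dvd_gcd (root G₁ e₁) (root G₂ e₂),
      natDegree_minpoly S.finrank (S.xOf_notMem ht0)⟩

end Param

end TraceZero

namespace TraceZero

/-! ### Coincidences among sums, and Eisenstein integers modulo `p`. -/

section CubeRoots

variable {p : ℕ} {s : ZMod p}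

/-- Multiplying by a power of `s` normalises the first exponent to 0, and the others matter modulo
3. A relative exponent 0 on either side already gives a multiple of `t`, so only twelve equations
are left to exclude. -/
theorem onlyCommon_of_ne (hs : s ^ 2 + s + 1 = 0) {c₁ d₁ c₂ d₂ t : ZMod p} (e₁ : c₁ + d₁ = t)
    (e₂ : c₂ + d₂ = t)
    (H : ∀ a ∈ [1, 2], ∀ b ∈ [1, 2], ∀ c ∈ [0, 1, 2],
      c₁ + s ^ a * d₁ ≠ s ^ c * (c₂ + s ^ b * d₂)) :
    OnlyCommon s c₁ d₁ c₂ d₂ t := by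
  intro i j i' j' h
  have h3 : s ^ 3 = 1 := by linear_combination (s - 1) * hs
  have red : ∀ n : ℕ, s ^ n = s ^ (n % 3) := fun n => by
    conv_lhs => rw [← Nat.div_add_mod n 3, pow_add, pow_mul, h3, one_pow, one_mul]
  have hi : (s ^ 3) ^ i = 1 := by rw [h3, one_pow]
  have hi' : (s ^ 3) ^ i' = 1 := by rw [h3, one_pow]
  rw [← pow_mul] at hi hi'
  have key : c₁ + s ^ ((j + 2 * i) % 3) * d₁ =
      s ^ ((i' + 2 * i) % 3) * (c₂ + s ^ ((j' + 2 * i') % 3) * d₂) := by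
    rw [← red, ← red, ← red]
    linear_combination s ^ (2 * i) * h - c₁ * hi - s ^ (j' + 2 * i) * d₂ * hi'
  have small : ∀ n : ℕ, n % 3 ≠ 0 → n % 3 ∈ [1, 2] := fun n hn => by
    have := Nat.mod_lt n (show 3 > 0 by norm_num)
    simp only [List.mem_cons, List.not_mem_nil, or_false]
    omega
  have small' : ∀ n : ℕ, n % 3 ∈ [0, 1, 2] := fun n => by
    have := Nat.mod_lt n (show 3 > 0 by norm_num)
    simp only [List.mem_cons, List.not_mem_nil, or_false]
    omega
  by_cases ha : (j + 2 * i) % 3 = 0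
  · refine ⟨i, ?_⟩
    have := red (j + 2 * i)
    rw [ha, pow_zero] at this
    rw [← e₁]
    linear_combination s ^ i * d₁ * this - s ^ j * d₁ * hi
  by_cases hb : (j' + 2 * i') % 3 = 0
  · refine ⟨i', ?_⟩
    have := red (j' + 2 * i')
    rw [hb, pow_zero] at this
    rw [h, ← e₂]
    linear_combination s ^ i' * d₂ * this - s ^ j' * d₂ * hi'
  exact absurd key (H _ (small _ ha) _ (small _ hb) _ (small' _))

/-- Since `(2 s + 1)² = -3` and `s`, `s + 1` are units, each fraction becomes an Eisenstein integer
divided by 1 or 3. -/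
theorem mem_setM_iff [Fact p.Prime] (hs : s ^ 2 + s + 1 = 0) (h3 : (3 : ZMod p) ≠ 0)
    (N : ZMod p) :
    N ∈ setM s ↔ N = -(2 * s + 1) ∨ N = 2 * s + 1 ∨ 3 * N = 5 + 4 * s ∨ N = 2 * s + 3 ∨
      3 * N = 1 - 4 * s ∨ N = 1 - 2 * s := by
  have hr : (2 * s + 1) * (2 * s + 1) = -3 := by linear_combination 4 * hs
  have n₁ : 2 * s + 1 ≠ 0 := fun h => h3 (by linear_combination hr - (2 * s + 1) * h)
  have n₂ : s ≠ 0 := fun h => by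
    rw [h] at hs; exact one_ne_zero (α := ZMod p) (by linear_combination hs)
  have n₃ : s + 1 ≠ 0 := fun h => by
    exact one_ne_zero (α := ZMod p) (by linear_combination hs - s * h)
  have f₁ : 3 / (2 * s + 1) = -(2 * s + 1) := by
    rw [div_eq_iff n₁]; linear_combination hr
  have f₂ : -3 / (2 * s + 1) = 2 * s + 1 := by
    rw [div_eq_iff n₁]; linear_combination -hr
  have f₃ : (s - 4) / (3 * s) = (5 + 4 * s) / 3 := by
    rw [div_eq_div_iff (mul_ne_zero h3 n₂) h3]; linear_combination -12 * hs
  have f₄ : (4 * s - 1) / (2 * s + 1) = 2 * s + 3 := by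
    rw [div_eq_iff n₁]; linear_combination -4 * hs
  have f₅ : (s + 5) / (3 * (s + 1)) = (1 - 4 * s) / 3 := by
    rw [div_eq_div_iff (mul_ne_zero h3 n₃) h3]; linear_combination 12 * hs
  have f₆ : (4 * s + 5) / (2 * s + 1) = 1 - 2 * s := by
    rw [div_eq_iff n₁]; linear_combination 4 * hs
  simp only [setM, Set.mem_insert_iff, Set.mem_singleton_iff, f₁, f₂, f₃, f₄, f₅, f₆,
    eq_div_iff h3, mul_comm N 3]

/-- The class of `x + y s` modulo `p`. -/
def eis (s : ZMod p) (x : ℤ × ℤ) : ZMod p := x.1 + x.2 * s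

/-- Multiplication of Eisenstein integers `x + y s`, `s² + s + 1 = 0`. -/
def eisMul (x y : ℤ × ℤ) : ℤ × ℤ :=
  (x.1 * y.1 - x.2 * y.2, x.1 * y.2 + x.2 * y.1 - x.2 * y.2)

/-- The norm of an Eisenstein integer. -/
def eisNorm (x : ℤ × ℤ) : ℤ := x.1 ^ 2 - x.1 * x.2 + x.2 ^ 2

/-- The powers of a primitive cube root of unity. -/
def eisPow : ℕ → ℤ × ℤ
  | 0 => (1, 0)
  | n + 1 => eisMul (0, 1) (eisPow n)

theorem eis_mul (hs : s ^ 2 + s + 1 = 0) (x y : ℤ × ℤ) :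
    eis s (eisMul x y) = eis s x * eis s y := by
  simp only [eis, eisMul]
  push_cast
  linear_combination -(x.2 : ZMod p) * y.2 * hs

theorem eis_pow (hs : s ^ 2 + s + 1 = 0) (n : ℕ) : eis s (eisPow n) = s ^ n := by
  induction n with
  | zero => simp [eis, eisPow]
  | succ n ih => rw [eisPow, eis_mul hs, ih, pow_succ']; simp [eis]

theorem eis_add (x y : ℤ × ℤ) : eis s (x + y) = eis s x + eis s y := by
  simp only [eis, Prod.fst_add, Prod.snd_add]; push_cast; ring

theorem eis_sub (x y : ℤ × ℤ) : eis s (x - y) = eis s x - eis s y := by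
  simp only [eis, Prod.fst_sub, Prod.snd_sub]; push_cast; ring

/-- The norm is the product of `x` with its conjugate, so vanishing modulo `p` makes `p` divide a
positive integer smaller than `p`. -/
theorem eis_ne_zero (hs : s ^ 2 + s + 1 = 0) (hp : 10800 < p) {x : ℤ × ℤ} (h₀ : 0 < eisNorm x)
    (h₁ : eisNorm x ≤ 10800) : eis s x ≠ 0 := by
  intro h
  have hn : ((eisNorm x : ℤ) : ZMod p) = 0 := by
    simp only [eis] at h
    simp only [eisNorm]
    push_cast
    linear_combination (x.1 - x.2 - x.2 * s) * h + (x.2 : ZMod p) ^ 2 * hs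
  have := Int.le_of_dvd h₀ ((ZMod.intCast_zmod_eq_zero_iff_dvd _ _).mp hn)
  omega

/-- The elements of `M`, multiplied by `3`. -/
def excList : List (ℤ × ℤ) := [(-3, -6), (3, 6), (5, 4), (9, 6), (1, -4), (3, -6)]

theorem exists_of_mem_setM [Fact p.Prime] (hs : s ^ 2 + s + 1 = 0) (h3 : (3 : ZMod p) ≠ 0)
    {N : ZMod p} (hN : N ∈ setM s) : ∃ n ∈ excList, 3 * N = eis s n := by
  simp only [excList, List.mem_cons, List.not_mem_nil, or_false, eis]
  rcases (mem_setM_iff hs h3 N).mp hN with h | h | h | h | h | h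
  · exact ⟨(-3, -6), by simp, by push_cast; rw [h]; ring⟩
  · exact ⟨(3, 6), by simp, by push_cast; rw [h]; ring⟩
  · exact ⟨(5, 4), by simp, by push_cast; rw [h]⟩
  · exact ⟨(9, 6), by simp, by push_cast; rw [h]; ring⟩
  · exact ⟨(1, -4), by simp, by push_cast; rw [h]; ring⟩
  · exact ⟨(3, -6), by simp, by push_cast; rw [h]; ring⟩

/-- The values 5 and 7 serve for the precomputed lines and the first ladder step; `±6, ±10, ±14` are
the doubles of the constants in type (b), where two summands could coincide. -/
theorem natCast_notMem_setM [Fact p.Prime] (hs : s ^ 2 + s + 1 = 0) (h3 : (3 : ZMod p) ≠ 0)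
    (hp : 10800 < p) {z : ℤ} (hz : z ∈ [5, 7, 6, -6, 10, -10, 14, -14]) :
    (z : ZMod p) ∉ setM s := by
  intro h
  obtain ⟨n, hn, e⟩ := exists_of_mem_setM hs h3 h
  have key : ∀ n ∈ excList, ∀ z ∈ [5, 7, 6, -6, 10, -10, 14, -14],
      0 < eisNorm (n - (3 * z, 0)) ∧ eisNorm (n - (3 * z, 0)) ≤ 10800 := by decide
  refine eis_ne_zero hs hp (key n hn z hz).1 (key n hn z hz).2 ?_
  rw [eis_sub, ← e]
  simp [eis]

/-- The exceptional residue classes do not meet the inputs of type (b). -/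
theorem onlyCommon_of_mem [Fact p.Prime] (hs : s ^ 2 + s + 1 = 0) (h3 : (3 : ZMod p) ≠ 0)
    (hp : 10800 < p) {N : ZMod p} (hN : N ∈ setM s) {x : ℤ × ℤ}
    (hx : x ∈ [(3, 7), (3, -5), (-3, 5), (-3, -7)]) :
    OnlyCommon s (x.1 : ZMod p) (N - x.1) (x.2 : ZMod p) (N - x.2) N := by
  obtain ⟨n, hn, e⟩ := exists_of_mem_setM hs h3 hN
  refine onlyCommon_of_ne hs (by ring) (by ring) fun a ha b hb c hc h => ?_
  -- Finite check: three times the difference of the two sides, as an Eisenstein integer, has norm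
  -- between 1 and 10800.
  have key : ∀ n ∈ excList, ∀ x ∈ [((3 : ℤ), (7 : ℤ)), (3, -5), (-3, 5), (-3, -7)],
      ∀ a ∈ [1, 2], ∀ b ∈ [1, 2], ∀ c ∈ [0, 1, 2],
      0 < eisNorm ((3 * x.1, 0) + eisMul (eisPow a) (n - (3 * x.1, 0)) -
        eisMul (eisPow c) ((3 * x.2, 0) + eisMul (eisPow b) (n - (3 * x.2, 0)))) ∧
      eisNorm ((3 * x.1, 0) + eisMul (eisPow a) (n - (3 * x.1, 0)) -
        eisMul (eisPow c) ((3 * x.2, 0) + eisMul (eisPow b) (n - (3 * x.2, 0)))) ≤ 10800 := by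
    decide
  obtain ⟨k₁, k₂⟩ := key n hn x hx a ha b hb c hc
  refine eis_ne_zero hs hp k₁ k₂ ?_
  simp only [eis_sub, eis_add, eis_mul hs, eis_pow hs, ← e]
  simp only [eis]
  push_cast
  linear_combination 3 * h

/-- Outside the exceptional residue classes the inputs of type (a) have no further common
zeros. -/
theorem onlyCommon_of_notMem [Fact p.Prime] (hs : s ^ 2 + s + 1 = 0) (h3 : (3 : ZMod p) ≠ 0)
    {N k : ZMod p} (hk : 2 * k + 1 = N) (hN : N ∉ setM s) (hN₁ : N ≠ 1) (hN₃ : N ≠ 3) :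
    OnlyCommon s 1 (2 * k) k (k + 1) N := by
  rw [mem_setM_iff hs h3] at hN
  simp only [not_or] at hN
  obtain ⟨m₁, m₂, m₃, m₄, m₅, m₆⟩ := hN
  refine onlyCommon_of_ne hs (by rw [← hk]; ring) (by rw [← hk]; ring)
    fun a ha b hb c hc h => ?_
  have e₀ : 2 * k = N - 1 := by rw [← hk]; ring
  have h' : 2 + 2 * s ^ a * (N - 1) = s ^ c * ((N - 1) + s ^ b * (N + 1)) := by
    linear_combination 2 * h - 2 * s ^ a * e₀ + s ^ c * (1 + s ^ b) * e₀
  have q : s ^ 2 = -1 - s := by linear_combination hs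
  simp only [List.mem_cons, List.not_mem_nil, or_false] at ha hb hc
  -- Each of the twelve equations is linear in `N`: four give `N = 1`, two give `N = 3`, and the
  -- other six give each class of `M` once.
  rcases ha with rfl | rfl <;> rcases hb with rfl | rfl <;> rcases hc with rfl | rfl | rfl <;>
    simp only [q, pow_zero, pow_one] at h'
  · exact hN₃ (mul_left_cancel₀ h3 (by grind))
  · exact m₂ (mul_left_cancel₀ h3 (by grind))
  · exact hN₁ (mul_left_cancel₀ h3 (by grind))
  · exact m₃ (by grind)
  · exact hN₁ (mul_left_cancel₀ h3 (by grind))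
  · exact m₄ (mul_left_cancel₀ h3 (by grind))
  · exact m₅ (by grind)
  · exact m₆ (mul_left_cancel₀ h3 (by grind))
  · exact hN₁ (mul_left_cancel₀ h3 (by grind))
  · exact hN₃ (mul_left_cancel₀ h3 (by grind))
  · exact hN₁ (mul_left_cancel₀ h3 (by grind))
  · exact m₁ (mul_left_cancel₀ h3 (by grind))

end CubeRoots

end TraceZero

namespace TraceZero

/-! ### Binary prefixes and special steps. -/

section Digits

theorem bit_eq (m i : ℕ) : bit m i = m / 2 ^ i % 2 := Nat.toNat_testBit m i

theorem div_two_pow_eq (m i : ℕ) : m / 2 ^ i = 2 * (m / 2 ^ (i + 1)) + bit m i := by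
  rw [bit_eq, pow_succ, ← Nat.div_div_eq_div_mul]
  omega

theorem prefixVal_eq (m i : ℕ) : prefixVal m i = m / 2 ^ i := by
  induction h : len m - i generalizing i with
  | zero =>
    have hi : len m ≤ i := by omega
    rw [prefixVal, Finset.Ico_eq_empty_of_le hi, Finset.sum_empty,
      Nat.div_eq_of_lt (Nat.size_le.mp hi)]
  | succ n ih =>
    have hi : i < len m := by omega
    rw [div_two_pow_eq, ← ih (i + 1) (by omega), prefixVal, Finset.sum_eq_sum_Ico_succ_bot hi,
      Nat.sub_self, pow_zero, mul_one, add_comm, prefixVal, Finset.mul_sum]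
    congr 1
    refine Finset.sum_congr rfl fun j hj => ?_
    have hj' := (Finset.mem_Ico.mp hj).1
    rw [show j - i = j - (i + 1) + 1 by omega, pow_succ]
    ring

theorem div_two_pow_len {m : ℕ} (hm : 0 < m) : m / 2 ^ (len m - 1) = 1 := by
  have h₀ : 0 < len m := Nat.size_pos.mpr hm
  have h₁ : 2 ^ (len m - 1) ≤ m := Nat.lt_size.mp (by rw [← len]; omega)
  have h₂ : m < 2 ^ len m := Nat.lt_size_self m
  have h₃ : 2 ^ len m = 2 * 2 ^ (len m - 1) := by
    rw [← pow_succ', Nat.sub_add_cancel h₀]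
  exact Nat.div_eq_of_lt_le (by omega) (by omega)

theorem two_le_div_two_pow {m j : ℕ} (hm : 0 < m) (hj : j + 2 ≤ len m) : 2 ≤ m / 2 ^ j := by
  have h₁ := div_two_pow_len hm
  have h₂ : m / 2 ^ (len m - 1) ≤ m / 2 ^ (j + 1) :=
    Nat.div_le_div_left (Nat.pow_le_pow_right (by norm_num) (by omega)) (by positivity)
  have := div_two_pow_eq m j
  omega

/-- Exactly one of `kᵢ` and `kᵢ + 1` is odd, namely `2 kᵢ₊₁ + 1`, whatever the digit. This is the
multiple that the subalgorithm has to compute at step `i`. -/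
theorem mem_specialSteps_iff {p : ℕ} [Fact p.Prime] {s : ZMod p} {m i : ℕ} (hi : i + 2 ≤ len m)
    (hN : 2 * (m / 2 ^ (i + 1)) + 1 < p) :
    i ∈ specialSteps s m ↔ ((2 * (m / 2 ^ (i + 1)) + 1 : ℕ) : ZMod p) ∈ setM s := by
  have hb : bit m i = 0 ∨ bit m i = 1 := by rw [bit_eq]; omega
  have odd : Odd (2 * (m / 2 ^ (i + 1)) + 1) := ⟨_, rfl⟩
  have even : ¬ Odd (2 * (m / 2 ^ (i + 1))) := by rw [Nat.odd_iff]; omega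
  have even' : ¬ Odd (2 * (m / 2 ^ (i + 1)) + 1 + 1) := by rw [Nat.odd_iff]; omega
  rw [specialSteps, Set.mem_ofPred_eq, prefixVal_eq, div_two_pow_eq]
  rcases hb with hb | hb <;>
    simp only [setMOdd, Set.mem_ofPred_eq, hi, hb, hN, odd, even, even', add_zero, true_and,
      false_and, and_false, false_or, or_false]

end Digits

theorem natCast_ne {p a b : ℕ} (ha : a < p) (hb : b < p) (h : a ≠ b) : (a : ZMod p) ≠ b := by
  rw [Ne, ZMod.natCast_eq_natCast_iff', Nat.mod_eq_of_lt ha, Nat.mod_eq_of_lt hb]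
  exact h

/-! ### The ladder and its invariant. -/

namespace Param

variable {F K : Type*} [Field F] [Fintype F] [Field K] [Algebra F K] [DecidableEq K]
  {A B : F} {p : ℕ} [Fact p.Prime] {s : ZMod p} (S : Param K A B s)

/-- The value `o` is defined and is the line through the point with parameter `c`. -/
def IsLineAt (o : Option (Line F)) (c : ZMod p) : Prop :=
  ∃ h : Line F, o = some h ∧ h.Contains (S.pt c)

variable {S}

theorem IsLineAt.congr {o : Option (Line F)} {c d : ZMod p} (h : S.IsLineAt o c) (e : c = d) :
    S.IsLineAt o d := e ▸ h

theorem IsLineAt.neg {o : Option (Line F)} {c : ZMod p} (h : S.IsLineAt o c) :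
    S.IsLineAt (o.map Line.neg) (-c) := by
  obtain ⟨k, rfl, hk⟩ := h
  exact ⟨k.neg, rfl, S.contains_neg hk⟩

theorem IsLineAt.dbl {o : Option (Line F)} {c : ZMod p} (h : S.IsLineAt o c) (n : ℕ) :
    S.IsLineAt (dbl A B n o) (2 ^ n * c) := by
  induction n generalizing o c with
  | zero => simpa [TraceZero.dbl] using h
  | succ n ih =>
    obtain ⟨k, rfl, hk⟩ := h
    obtain ⟨g, hg, hg'⟩ := S.double_eq hk
    have := ih ⟨g, hg, hg'⟩
    rw [pow_succ, mul_assoc]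
    exact this

theorem IsLineAt.subalgO {o₁ o₂ o₃ o₄ : Option (Line F)} {c₁ d₁ c₂ d₂ t : ZMod p}
    (hc₁ : S.IsLineAt o₁ c₁) (hd₁ : S.IsLineAt o₂ d₁) (hc₂ : S.IsLineAt o₃ c₂)
    (hd₂ : S.IsLineAt o₄ d₂) (n₁ : c₁ ≠ d₁) (n₂ : c₂ ≠ d₂) (e₁ : c₁ + d₁ = t)
    (e₂ : c₂ + d₂ = t) (hcom : OnlyCommon s c₁ d₁ c₂ d₂ t) (ht : t ≠ 0) :
    S.IsLineAt (subalgO A B o₁ o₂ o₃ o₄) t := by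
  obtain ⟨h₁, rfl, k₁⟩ := hc₁
  obtain ⟨h₂, rfl, k₂⟩ := hd₁
  obtain ⟨h₃, rfl, k₃⟩ := hc₂
  obtain ⟨h₄, rfl, k₄⟩ := hd₂
  obtain ⟨g, hg⟩ := S.exists_line ht
  exact ⟨g, S.subalg_eq k₁ k₂ k₃ k₄ n₁ n₂ e₁ e₂ hcom hg, hg⟩

/-- Correctness of the subalgorithm on inputs of type (a). -/
theorem IsLineAt.subalgO_of_notMem {o₁ o₂ o₃ o₄ : Option (Line F)} {k : ℕ} (hk : 2 ≤ k)
    (hkp : 2 * k + 1 < p) (hN : ((2 * k + 1 : ℕ) : ZMod p) ∉ setM s)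
    (h₁ : S.IsLineAt o₁ 1) (h₂ : S.IsLineAt o₂ (2 * k)) (h₃ : S.IsLineAt o₃ k)
    (h₄ : S.IsLineAt o₄ (k + 1)) :
    S.IsLineAt (TraceZero.subalgO A B o₁ o₂ o₃ o₄) ((2 * k + 1 : ℕ) : ZMod p) := by
  refine h₁.subalgO h₂ h₃ h₄ ?_ ?_ (by push_cast; ring) (by push_cast; ring)
    (onlyCommon_of_notMem S.s_sq S.three' (by push_cast; ring) hN ?_ ?_) ?_
  · exact_mod_cast natCast_ne (a := 1) (b := 2 * k) (by omega) (by omega) (by omega)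
  · exact_mod_cast natCast_ne (a := k) (b := k + 1) (by omega) (by omega) (by omega)
  · exact_mod_cast natCast_ne (b := 1) hkp (by omega) (by omega)
  · exact_mod_cast natCast_ne (b := 3) hkp (by omega) (by omega)
  · exact_mod_cast natCast_ne (b := 0) hkp (by omega) (by omega)

/-- Correctness of the subalgorithm on inputs of type (b). -/
theorem IsLineAt.subalgO_of_mem (hp : 10800 < p) {o₁ o₂ o₃ o₄ : Option (Line F)} {N : ZMod p}
    (hN : N ∈ setM s) (hN₀ : N ≠ 0) {x : ℤ × ℤ}
    (hx : x ∈ [(3, 7), (3, -5), (-3, 5), (-3, -7)])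
    (h₁ : S.IsLineAt o₁ x.1) (h₂ : S.IsLineAt o₂ (N - x.1)) (h₃ : S.IsLineAt o₃ x.2)
    (h₄ : S.IsLineAt o₄ (N - x.2)) : S.IsLineAt (TraceZero.subalgO A B o₁ o₂ o₃ o₄) N := by
  -- Equal summands would mean `N = 2z`, but none of these doubles lies in `M`.
  have key : ∀ z : ℤ, 2 * z ∈ [5, 7, 6, -6, 10, -10, 14, -14] →
      (z : ZMod p) ≠ N - z := fun z hz h =>
    natCast_notMem_setM S.s_sq S.three' hp hz (by
      have : ((2 * z : ℤ) : ZMod p) = N := by push_cast; linear_combination h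
      rwa [this])
  have hx' : ∀ x ∈ [((3 : ℤ), (7 : ℤ)), (3, -5), (-3, 5), (-3, -7)],
      2 * x.1 ∈ [5, 7, 6, -6, 10, -10, 14, -14] ∧
      2 * x.2 ∈ [5, 7, 6, -6, 10, -10, 14, -14] := by decide
  exact h₁.subalgO h₂ h₃ h₄ (key _ (hx' x hx).1) (key _ (hx' x hx).2) (by ring) (by ring)
    (onlyCommon_of_mem S.s_sq S.three' hp hN hx) hN₀

section Ladder

variable (hp : 10800 < p) {h : Line F} (hh : h.Contains (S.pt 1))

include hh in
theorem isLineAt_some : S.IsLineAt (some h) 1 := ⟨h, rfl, hh⟩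

include hh in
theorem isLineAt_h3 : S.IsLineAt (h3 A B h) 3 := by
  obtain ⟨g, hg, hg'⟩ := S.triple_eq hh
  exact ⟨g, hg, by rwa [mul_one] at hg'⟩

include hh in
theorem isLineAt_dbl_some (n : ℕ) : S.IsLineAt (dbl A B n (some h)) (2 ^ n) := by
  simpa using (isLineAt_some hh).dbl n

include hp hh in
theorem isLineAt_h5 : S.IsLineAt (h5 A B h) 5 := by
  have h₂ := isLineAt_dbl_some hh 1
  have h₄ := isLineAt_dbl_some hh 2
  have key := IsLineAt.subalgO_of_notMem (k := 2) le_rfl (by omega)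
    (by simpa using natCast_notMem_setM S.s_sq S.three' hp (z := 5) (by simp))
    (isLineAt_some hh) (h₄.congr (by norm_num)) (by simpa using h₂)
    ((isLineAt_h3 hh).congr (by norm_num))
  exact_mod_cast key

include hp hh in
theorem isLineAt_h7 : S.IsLineAt (h7 A B h) 7 := by
  have h₆ := (isLineAt_h3 hh).dbl 1
  have h₄ := isLineAt_dbl_some hh 2
  have key := IsLineAt.subalgO_of_notMem (k := 3) (by norm_num) (by omega)
    (by simpa using natCast_notMem_setM S.s_sq S.three' hp (z := 7) (by simp))
    (isLineAt_some hh) (by simpa using h₆) (by exact_mod_cast isLineAt_h3 hh)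
    (h₄.congr (by norm_num))
  exact_mod_cast key

/-- The pair `(h_{kP}, h_{(k + 1)P})`. -/
def IsPairAt (S : Param K A B s) (u : Option (Line F) × Option (Line F)) (k : ℕ) : Prop :=
  S.IsLineAt u.1 k ∧ S.IsLineAt u.2 (k + 1)

/-- The list at the beginning of the step `n - 1`. -/
def IsState (S : Param K A B s) (m n : ℕ) (L : List (Option (Line F) × Option (Line F))) : Prop :=
  ∃ T u v, L = T ++ [u, v] ∧ S.IsPairAt u (m / 2 ^ (n + 1)) ∧ S.IsPairAt v (m / 2 ^ n) ∧
    (T = [] ∧ n + 2 = len m ∨ ∃ t, T = [t] ∧ S.IsPairAt t (m / 2 ^ (n + 2)))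

-- With `N = 2k₁ + 1`, the last two digits give `N = 8k₃ + 1, 8k₃ + 5, 8k₃ + 3, 8k₃ + 7` in the
-- order of the cases below. The constants `±3, ±5, ±7` are chosen so that each complement is 4 or 8
-- times a stored `k` or `k + 1`, thus reachable by doublings.
include hp hh in
theorem isLineAt_hExc {m i : ℕ} {t u v : Option (Line F) × Option (Line F)}
    (ht : S.IsPairAt t (m / 2 ^ (i + 3))) (hu : S.IsPairAt u (m / 2 ^ (i + 2)))
    (hN : ((2 * (m / 2 ^ (i + 1)) + 1 : ℕ) : ZMod p) ∈ setM s)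
    (hN₀ : ((2 * (m / 2 ^ (i + 1)) + 1 : ℕ) : ZMod p) ≠ 0) :
    S.IsLineAt (hExc A B h m i [t, u, v]) ((2 * (m / 2 ^ (i + 1)) + 1 : ℕ) : ZMod p) := by
  have b₁ : bit m (i + 1) = 0 ∨ bit m (i + 1) = 1 := by rw [bit_eq]; omega
  have b₂ : bit m (i + 2) = 0 ∨ bit m (i + 2) = 1 := by rw [bit_eq]; omega
  have d₁ := div_two_pow_eq m (i + 1)
  have d₂ := div_two_pow_eq m (i + 2)
  obtain ⟨ht₁, ht₂⟩ := ht
  obtain ⟨hu₁, hu₂⟩ := hu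
  have i₃ := isLineAt_h3 hh
  have i₅ := isLineAt_h5 hp hh
  have i₇ := isLineAt_h7 hp hh
  generalize m / 2 ^ (i + 1) = k₁ at *
  have e₂ : m / 2 ^ (i + 1 + 1) = m / 2 ^ (i + 2) := rfl
  have e₃ : m / 2 ^ (i + 2 + 1) = m / 2 ^ (i + 3) := rfl
  rw [e₂] at d₁
  rw [e₃] at d₂
  generalize m / 2 ^ (i + 2) = k₂ at *
  generalize m / 2 ^ (i + 3) = k₃ at *
  rw [hExc]
  rcases b₁ with b₁ | b₁ <;> rcases b₂ with b₂ | b₂ <;> rw [b₁] at d₁ <;> rw [b₂] at d₂ <;>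
    simp only [b₁, b₂, if_true, if_false, zero_ne_one]
  · refine IsLineAt.subalgO_of_mem hp hN hN₀ (x := (-3, -7)) (by simp) ?_ ?_ ?_ ?_
    · simpa using i₃.neg
    · exact (hu₂.dbl 2).congr (by rw [d₁]; push_cast; ring)
    · simpa using i₇.neg
    · exact (ht₂.dbl 3).congr (by rw [d₁, d₂]; push_cast; ring)
  · refine IsLineAt.subalgO_of_mem hp hN hN₀ (x := (-3, 5)) (by simp) ?_ ?_ ?_ ?_
    · simpa using i₃.neg
    · exact (ht₂.dbl 3).congr (by rw [d₁, d₂]; push_cast; ring)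
    · simpa using i₅
    · exact (ht₁.dbl 3).congr (by rw [d₁, d₂]; push_cast; ring)
  · refine IsLineAt.subalgO_of_mem hp hN hN₀ (x := (3, -5)) (by simp) ?_ ?_ ?_ ?_
    · simpa using i₃
    · exact (ht₁.dbl 3).congr (by rw [d₁, d₂]; push_cast; ring)
    · simpa using i₅.neg
    · exact (ht₂.dbl 3).congr (by rw [d₁, d₂]; push_cast; ring)
  · refine IsLineAt.subalgO_of_mem hp hN hN₀ (x := (3, 7)) (by simp) ?_ ?_ ?_ ?_
    · simpa using i₃
    · exact (hu₁.dbl 2).congr (by rw [d₁]; push_cast; ring)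
    · simpa using i₇
    · exact (ht₁.dbl 3).congr (by rw [d₁, d₂]; push_cast; ring)

-- The second line of the new pair is claimed only for `kᵢ + 1 < p`: in the last step with `m = p -
-- 1` it would belong to the point at infinity. The output needs the first line only.
include hp hh in
open Classical in
theorem exists_step {m i : ℕ} (hm : 0 < m) (hmp : m < p) (hi : i + 3 ≤ len m)
    {L : List (Option (Line F) × Option (Line F))} (hL : S.IsState m (i + 1) L) :
    ∃ u v w, step A B s h m i L = [u, v, w] ∧ S.IsPairAt u (m / 2 ^ (i + 2)) ∧
      S.IsPairAt v (m / 2 ^ (i + 1)) ∧ S.IsLineAt w.1 ((m / 2 ^ i : ℕ) : ZMod p) ∧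
      (m / 2 ^ i + 1 < p → S.IsPairAt w (m / 2 ^ i)) := by
  obtain ⟨T, u, v, rfl, hu, hv, hT⟩ := hL
  have hk := two_le_div_two_pow hm (j := i + 1) (by omega)
  have hb : bit m i = 0 ∨ bit m i = 1 := by rw [bit_eq]; omega
  have hd := div_two_pow_eq m i
  have hle : m / 2 ^ i ≤ m := Nat.div_le_self _ _
  set exc := hExc A B h m i (T ++ [u, v]) with hexc
  set new := if i ∈ specialSteps s m then exc
    else subalgO A B (some h) (TraceZero.dbl A B 1 v.1) v.1 v.2 with hnew
  have hstep : step A B s h m i (T ++ [u, v]) =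
      if bit m i = 0 then [u, v, (TraceZero.dbl A B 1 v.1, new)]
      else [u, v, (new, TraceZero.dbl A B 1 v.2)] := by
    rcases hT with ⟨rfl, -⟩ | ⟨t, rfl, -⟩ <;> simp [step, uAt, vAt, hnew, hexc]
  have d₁ : S.IsLineAt (TraceZero.dbl A B 1 v.1) (2 * (m / 2 ^ (i + 1) : ℕ)) := by
    simpa using hv.1.dbl 1
  have d₂ : S.IsLineAt (TraceZero.dbl A B 1 v.2) (2 * (m / 2 ^ (i + 1) : ℕ) + 2) := by
    exact (hv.2.dbl 1).congr (by ring)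
  have key : 2 * (m / 2 ^ (i + 1)) + 1 < p →
      S.IsLineAt new ((2 * (m / 2 ^ (i + 1)) + 1 : ℕ) : ZMod p) := by
    intro hN
    rw [hnew]
    have hiff := mem_specialSteps_iff (s := s) (m := m) (i := i) (by omega) hN
    split_ifs with hs
    · have hmem := hiff.mp hs
      have hN₀ : ((2 * (m / 2 ^ (i + 1)) + 1 : ℕ) : ZMod p) ≠ 0 := by
        exact_mod_cast natCast_ne (b := 0) hN (by omega) (by omega)
      rcases hT with ⟨-, hT⟩ | ⟨t, rfl, ht⟩
      -- With only two stored pairs, `kᵢ₊₁` is 2 or 3, so the odd multiple is 5 or 7 and the step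
      -- cannot be special.
      · exfalso
        have h₁ := div_two_pow_len hm
        rw [← hT, show i + 1 + 2 - 1 = i + 1 + 1 by omega] at h₁
        have h₂ := div_two_pow_eq m (i + 1)
        have h₃ : bit m (i + 1) = 0 ∨ bit m (i + 1) = 1 := by rw [bit_eq]; omega
        rcases h₃ with h₃ | h₃
        · rw [h₂, h₁, h₃] at hmem
          exact natCast_notMem_setM S.s_sq S.three' hp (z := 5) (by simp) (by simpa using hmem)
        · rw [h₂, h₁, h₃] at hmem
          exact natCast_notMem_setM S.s_sq S.three' hp (z := 7) (by simp) (by simpa using hmem)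
      · exact isLineAt_hExc hp hh ht hu hmem hN₀
    · exact IsLineAt.subalgO_of_notMem hk hN (fun hmem => hs (hiff.mpr hmem))
        (isLineAt_some hh) d₁ hv.1 hv.2
  rw [hstep]
  rcases hb with hb | hb <;> rw [hb] at hd
  · rw [if_pos hb]
    have e : S.IsLineAt (TraceZero.dbl A B 1 v.1) ((m / 2 ^ i : ℕ) : ZMod p) := by
      rw [hd]; exact_mod_cast d₁
    refine ⟨u, v, _, rfl, hu, hv, e, fun hlt => ⟨e, ?_⟩⟩
    rw [hd]
    exact_mod_cast key (by omega)
  · rw [if_neg (by omega)]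
    have e : S.IsLineAt new ((m / 2 ^ i : ℕ) : ZMod p) := by
      rw [hd]; exact key (by omega)
    refine ⟨u, v, _, rfl, hu, hv, e, fun hlt => ⟨e, ?_⟩⟩
    exact d₂.congr (by rw [hd]; push_cast; ring)

include hp hh in
theorem isLineAt_cycle {m : ℕ} (hm : 0 < m) (hmp : m < p) (n : ℕ) (hn : n + 3 ≤ len m)
    {L : List (Option (Line F) × Option (Line F))} (hL : S.IsState m (n + 1) L) :
    S.IsLineAt (uAt (cycle A B s h m (n + 1) L) 3) m := by
  induction n generalizing L with
  | zero =>
    obtain ⟨u, v, w, e, -, -, hw, -⟩ := exists_step hp hh hm hmp hn hL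
    rw [cycle, cycle, e]
    simpa [uAt] using hw
  | succ n ih =>
    obtain ⟨u, v, w, e, hu, hv, -, hw⟩ := exists_step hp hh hm hmp hn hL
    rw [cycle, e]
    refine ih (by omega) ⟨[u], v, w, rfl, hv, hw ?_, Or.inr ⟨u, rfl, hu⟩⟩
    -- Before the last step the prefix is at most `m / 2`, so its successor stays below `p` and the
    -- full pair is available.
    have h₁ : m / 2 ^ (n + 1) ≤ m / 2 ^ 1 :=
      Nat.div_le_div_left (Nat.pow_le_pow_right (by norm_num) (by omega)) (by norm_num)
    omega

include hp hh in
/-- Correctness of the ladder. -/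
theorem isLineAt_montgomeryLadder {m : ℕ} (hm : 0 < m) (hmp : m < p) :
    S.IsLineAt (montgomeryLadder A B s h m) m := by
  have h₁ := div_two_pow_len hm
  have hlen : 0 < len m := Nat.size_pos.mpr hm
  have i₁ := isLineAt_some hh
  have i₂ : S.IsLineAt (dbl A B 1 (some h)) 2 := by simpa using isLineAt_dbl_some hh 1
  have i₃ := isLineAt_h3 hh
  have i₄ : S.IsLineAt (dbl A B 2 (some h)) 4 := by
    exact (isLineAt_dbl_some hh 2).congr (by norm_num)
  rw [montgomeryLadder]
  by_cases l₁ : len m = 1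
  · rw [if_pos l₁]
    rw [l₁] at h₁
    simp only [Nat.sub_self, pow_zero, Nat.div_one] at h₁
    simpa [h₁] using i₁
  rw [if_neg l₁]
  have h₂ := div_two_pow_eq m (len m - 2)
  rw [show len m - 2 + 1 = len m - 1 by omega, h₁] at h₂
  have hb : bit m (len m - 2) = 0 ∨ bit m (len m - 2) = 1 := by rw [bit_eq]; omega
  have second : S.IsPairAt (if bit m (len m - 2) = 0 then (dbl A B 1 (some h), h3 A B h)
      else (h3 A B h, dbl A B 2 (some h))) (m / 2 ^ (len m - 2)) := by
    rcases hb with hb | hb <;> rw [hb] at h₂ <;> rw [h₂, hb]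
    · refine ⟨by simpa using i₂, ?_⟩
      exact i₃.congr (by push_cast; norm_num)
    · refine ⟨by simpa using i₃, ?_⟩
      exact i₄.congr (by push_cast; norm_num)
  dsimp only
  generalize (if bit m (len m - 2) = 0 then (dbl A B 1 (some h), h3 A B h)
      else (h3 A B h, dbl A B 2 (some h))) = pr at second ⊢
  by_cases l₂ : len m = 2
  · rw [if_pos l₂]
    have := second.1
    rw [l₂] at this
    simpa using this
  · rw [if_neg l₂]
    obtain ⟨n, hn⟩ : ∃ n, len m - 2 = n + 1 := ⟨len m - 3, by omega⟩
    rw [hn] at second ⊢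
    refine isLineAt_cycle hp hh hm hmp n (by omega)
      ⟨[], _, _, rfl, ?_, second, Or.inl ⟨rfl, by omega⟩⟩
    rw [show n + 1 + 1 = len m - 1 by omega, h₁]
    exact ⟨by simpa using i₁, i₂.congr (by push_cast; norm_num)⟩

end Ladder

end Param

/-! ### From the hypotheses on the group to the parametrisation. -/

section Parametrization

variable {F K : Type*} [Field F] [Fintype F] [Field K] [Algebra F K] [DecidableEq K]

/-- The parametrization of a trace zero subgroup of prime order by `ZMod p`. -/
theorem exists_param (hK : Module.finrank F K = 3) (h2 : (2 : F) ≠ 0) (h3 : (3 : F) ≠ 0)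
    (A B : F) (p : ℕ) [Fact p.Prime] (hp : 10800 < p)
    (P : Pts K A B) (hP : addOrderOf P = p)
    (hT : traceZero K A B = AddSubgroup.zmultiples P)
    (s : ZMod p) (hs : frob K A B P = s.val • P) :
    ∃ S : Param K A B s, ∀ m : ℕ, S.pt m = m • P := by
  have hpP : p • P = 0 := hP ▸ addOrderOf_nsmul_eq_zero P
  set pt : ZMod p →+ Pts K A B := ZMod.lift p ⟨zmultiplesHom _ P, by simpa using hpP⟩ with hpt
  have pt_nat : ∀ m : ℕ, pt m = m • P := fun m => by
    have := ZMod.lift_coe p ⟨zmultiplesHom (Pts K A B) P, by simpa using hpP⟩ (m : ℤ)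
    simpa using this
  have pt_val : ∀ c : ZMod p, pt c = c.val • P := fun c => by
    rw [← pt_nat, ZMod.natCast_zmod_val]
  have inj : Function.Injective pt := by
    rw [injective_iff_map_eq_zero]
    intro c hc
    rw [pt_val] at hc
    have := addOrderOf_dvd_of_nsmul_eq_zero hc
    rw [hP] at this
    rw [← ZMod.natCast_zmod_val c]
    exact (ZMod.natCast_eq_zero_iff _ _).mpr this
  have frob_pt : ∀ c, frob K A B (pt c) = pt (s * c) := fun c => by
    rw [pt_val, map_nsmul, hs, ← mul_nsmul', ← pt_nat]
    push_cast
    rw [ZMod.natCast_zmod_val, ZMod.natCast_zmod_val, mul_comm]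
  have pt_one : pt 1 = P := by simpa using pt_nat 1
  have hmem : P ∈ traceZero K A B := hT ▸ AddSubgroup.mem_zmultiples P
  -- This is the trace zero relation for the generator, read through the injection.
  have s_sq : s ^ 2 + s + 1 = 0 := by
    refine inj ?_
    have h : P + frob K A B P + frob K A B (frob K A B P) = 0 := hmem
    rw [← pt_one, frob_pt, frob_pt, ← map_add, ← map_add] at h
    rw [map_zero, ← h]
    congr 1
    ring
  have two' : (2 : ZMod p) ≠ 0 := by
    exact_mod_cast natCast_ne (p := p) (a := 2) (b := 0) (by omega) (by omega) (by omega)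
  have three' : (3 : ZMod p) ≠ 0 := by
    exact_mod_cast natCast_ne (p := p) (a := 3) (b := 0) (by omega) (by omega) (by omega)
  exact ⟨⟨pt, inj, frob_pt, s_sq, hK, h2, h3, two', three'⟩, pt_nat⟩

end Parametrization

end TraceZero

theorem mainTheorem2 {F K : Type*} [Field F] [Fintype F] [Field K] [Algebra F K] [DecidableEq K]
    (hK : Module.finrank F K = 3) (h2 : (2 : F) ≠ 0) (h3 : (3 : F) ≠ 0)
    (A B : F) (hAB : 4 * A ^ 3 + 27 * B ^ 2 ≠ 0)
    (p : ℕ) [Fact p.Prime] (hp : 10800 < p)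
    (P : TraceZero.Pts K A B) (hP : addOrderOf P = p)
    (hT : TraceZero.traceZero K A B = AddSubgroup.zmultiples P)
    (s : ZMod p) (hs : TraceZero.frob K A B P = s.val • P)
    (m : ℕ) (hm0 : 0 < m) (hmp : m < p) :
    (∃! h : TraceZero.Line F, TraceZero.IsLineOf h P) ∧
    (∃! h' : TraceZero.Line F, TraceZero.IsLineOf h' (m • P)) ∧
    ∀ h h' : TraceZero.Line F, TraceZero.IsLineOf h P → TraceZero.IsLineOf h' (m • P) →
      TraceZero.montgomeryLadder A B s h m = some h' := by
  obtain ⟨S, hS⟩ := TraceZero.exists_param hK h2 h3 A B p hp P hP hT s hs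
  have hm : (m : ZMod p) ≠ 0 := by
    exact_mod_cast TraceZero.natCast_ne (b := 0) hmp (by omega) hm0.ne'
  have hP₁ : S.pt 1 = P := by simpa using hS 1
  have unique : ∀ {c : ZMod p} {Q : TraceZero.Pts K A B}, c ≠ 0 → S.pt c = Q →
      ∃! h : TraceZero.Line F, TraceZero.IsLineOf h Q := by
    rintro c _ hc rfl
    obtain ⟨h, hh⟩ := S.exists_line hc
    exact ⟨h, TraceZero.isLineOf_iff.mpr hh,
      fun k hk => S.line_unique (TraceZero.isLineOf_iff.mp hk) hh⟩
  refine ⟨unique one_ne_zero hP₁, unique hm (hS m), fun h h' hh hh' => ?_⟩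
  rw [TraceZero.isLineOf_iff] at hh hh'
  rw [← hP₁] at hh
  rw [← hS m] at hh'
  obtain ⟨g, hg, hgm⟩ := TraceZero.Param.isLineAt_montgomeryLadder hp hh hm0 hmp
  rw [hg, S.line_unique hgm hh']
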